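/- An overpartition of $n$ is a partition of $n$ in which the first occurrence of each distinct part may be overlined. Its rank is its largest part minus its number of parts ($0$ for the empty overpartition); let $\overline{N}(m,n)$ be the number of overpartitions of $n$ with rank $m$. The crank of a partition is its largest part ($0$ for the empty partition) if $1$ does not occur in it; otherwise it is the number of parts larger than $\omega$, minus $\omega$, where $\omega$ is the number of $1$'s. For $n\neq 1$ let $M(m,n)$ be the number of partitions of $n$ with crank $m$, and set $M(0,1)=-1$, $M(1,1)=M(-1,1)=1$, and $M(m,1)=0$ otherwise. The first (resp. second) residual crank of an overpartition is the crank of the partition formed by its non-overlined parts (resp. by its even non-overlined parts, each divided by two). Let $\overline{M}(m,n)$ (resp. $\overline{M2}(m,n)$) be the number of overpartitions of $n$ with first (resp. second) residual crank $m$, counted with the above modification: an overpartition for which the partition so formed is the partition $1$ of $1$ contributes $-1$ to the count for $m=0$, $+1$ to the counts for $m=1$ and $m=-1$, and $0$ to all others. Put $$\overline{N}_k(n)=\sum_{m\in\mathbb Z}m^k\,\overline{N}(m,n),\quad \overline{M}_k(n)=\sum_{m\in\mathbb Z}m^k\,\overline{M}(m,n),\quad \overline{M2}_k(n)=\sum_{m\in\mathbb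 Z}m^k\,\overline{M2}(m,n),$$ and let $a_F(n)$ be the coefficient of $q^n$ in $$F=q\,(q;q)_\infty^6\,(q^2;q^2)_\infty^9,\qquad (a;q)_\infty=\prod_{k\ge 0}(1-aq^k).$$ Then for every integer $n\ge 0$, $$\begin{aligned} \overline{N}_8(n) ={}& \left(-17-112n-224n^2-256n^3\right)\overline{N}_2(n)+\tfrac{15815680}{70153149}\,a_F(n)\\ &+\left(-\tfrac{3743678558672}{83365325395}-\tfrac{141447890442736\,n}{1750671833295}-\tfrac{135995781048448\,n^2}{1750671833295}+\tfrac{9269071448192\,n^3}{583557277765}\right)\overline{M}_2(n)\\ &+\left(\tfrac{772193500416}{16673065079}+\tfrac{9412063348224\,n}{116711455553}+\tfrac{9106119501824\,n^2}{116711455553}\right)\overline{M}_4(n)\\ &+\left(-\tfrac{75923065344}{7578665945}-\tfrac{737849634816\,n}{83365325395}\right)\overline{M}_6(n)+\tfrac{2715648}{2125853}\,\overline{M}_8(n)\\ &+\left(\tfrac{4640559869932}{83365325395}+\tfrac{260410320833296\,n}{1750671833295}+\tfrac{345677277049024\,n^2}{1750671833295}+\tfrac{50935374262656\,n^3}{583557277765}\right)\overline{M2}_2(n)\\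 &+\left(-\tfrac{1173668372016}{16673065079}-\tfrac{2419446071808\,n}{16673065079}-\tfrac{2390306267136\,n^2}{16673065079}\right)\overline{M2}_4(n)\\ &+\left(\tfrac{130253841984}{7578665945}+\tfrac{1671243657216\,n}{83365325395}\right)\overline{M2}_6(n)-\tfrac{4858240}{2125853}\,\overline{M2}_8(n). \end{aligned}$$ -/

import Mathlib

/-- An overpartition of `n`: a partition of `n` in which the first occurrence of each distinct
part may be overlined. It is recorded as the partition together with the set of those part sizes
whose first occurrence is overlined. -/
@[ext]
structure Overpartition (n : ℕ) where
  toPartition : n.Partition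
  overlined : Finset ℕ
  overlined_subset : overlined ⊆ toPartition.parts.toFinset

/-- There are finitely many overpartitions of `n`. -/
instance Overpartition.instFintype (n : ℕ) : Fintype (Overpartition n) :=
  Fintype.ofEquiv ((p : n.Partition) × {s : Finset ℕ // s ∈ p.parts.toFinset.powerset})
    { toFun := fun x => ⟨x.1, x.2.1, Finset.mem_powerset.mp x.2.2⟩
      invFun := fun l => ⟨l.toPartition, l.overlined, Finset.mem_powerset.mpr l.overlined_subset⟩
      left_inv := fun _ => rfl
      right_inv := fun _ => rfl }

/-- The largest element of a multiset of natural numbers (`0` for the empty multiset). -/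
def largestPart (s : Multiset ℕ) : ℕ := s.sup

namespace Overpartition

/-- Dyson's rank: the largest part minus the number of parts. -/
def rank {n : ℕ} (l : Overpartition n) : ℤ :=
  (largestPart l.toPartition.parts : ℤ) - (l.toPartition.parts.card : ℤ)

/-- The non-overlined parts: one copy of each overlined part is removed. -/
def nonOverlined {n : ℕ} (l : Overpartition n) : Multiset ℕ :=
  l.toPartition.parts - l.overlined.val

/-- The even non-overlined parts, each divided by two. -/
def evenNonOverlinedHalved {n : ℕ} (l : Overpartition n) : Multiset ℕ :=
  (l.nonOverlined.filter fun x => Even x).map fun x => x / 2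

end Overpartition

/-- The Andrews-Garvan crank of a partition, given by its multiset of parts: the largest part if
`1` does not occur, and otherwise the number of parts larger than the number of `1`'s minus the
number of `1`'s. The empty partition has crank `0`. -/
def agCrank (s : Multiset ℕ) : ℤ :=
  if s.count 1 = 0 then (largestPart s : ℤ)
  else ((s.filter fun x => s.count 1 < x).card : ℤ) - (s.count 1 : ℤ)

/-- The contribution of a partition to the number of partitions with crank `m`. It is `1` or `0`
according to whether the crank is `m`, except that the only partition of `1` contributes `-1` to
`m = 0`, `1` to `m = 1` and `m = -1`, and `0` to every other `m`. -/
def crankWeight (m : ℤ) (s : Multiset ℕ) : ℤ :=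
  if s = {1} then (if m = 0 then -1 else if m = 1 ∨ m = -1 then 1 else 0)
  else (if agCrank s = m then 1 else 0)

/-- The number of overpartitions of `n` with rank `m`. -/
def overN (m : ℤ) (n : ℕ) : ℕ :=
  (Finset.univ.filter fun l : Overpartition n => l.rank = m).card

/-- The (modified) number of overpartitions of `n` with first residual crank `m`. -/
def overM (m : ℤ) (n : ℕ) : ℤ :=
  ∑ l : Overpartition n, crankWeight m l.nonOverlined

/-- The (modified) number of overpartitions of `n` with second residual crank `m`. -/
def overM2 (m : ℤ) (n : ℕ) : ℤ :=
  ∑ l : Overpartition n, crankWeight m l.evenNonOverlinedHalved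

/-- The `k`-th rank moment. -/
noncomputable def rankMoment (k n : ℕ) : ℤ := ∑ᶠ m : ℤ, m ^ k * (overN m n : ℤ)

/-- The `k`-th moment of the first residual crank. -/
noncomputable def firstCrankMoment (k n : ℕ) : ℤ := ∑ᶠ m : ℤ, m ^ k * overM m n

/-- The `k`-th moment of the second residual crank. -/
noncomputable def secondCrankMoment (k n : ℕ) : ℤ := ∑ᶠ m : ℤ, m ^ k * overM2 m n

/-- The sum in the definition of the rank moments is finite. -/
theorem overN_support_finite (n : ℕ) : (Function.support fun m : ℤ => overN m n).Finite := by
  refine (Set.finite_range fun l : Overpartition n => l.rank).subset fun m hm => ?_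
  obtain ⟨l, hl⟩ := Finset.card_ne_zero.mp (Function.mem_support.mp hm)
  exact ⟨l, (Finset.mem_filter.mp hl).2⟩

theorem crankWeight_support_finite (s : Multiset ℕ) :
    (Function.support fun m : ℤ => crankWeight m s).Finite := by
  refine (Set.toFinite ({0, 1, -1, agCrank s} : Set ℤ)).subset fun m hm => ?_
  by_contra h
  simp only [Set.mem_insert_iff, Set.mem_singleton_iff, not_or] at h
  obtain ⟨h0, h1, h2, h3⟩ := h
  exact hm (by simp [crankWeight, h0, h1, h2, Ne.symm h3])

theorem sum_crankWeight_support_finite {n : ℕ} (f : Overpartition n → Multiset ℕ) :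
    (Function.support fun m : ℤ => ∑ l : Overpartition n, crankWeight m (f l)).Finite := by
  refine (Set.finite_iUnion fun l => crankWeight_support_finite (f l)).subset fun m hm => ?_
  obtain ⟨l, -, hl⟩ := Finset.exists_ne_zero_of_sum_ne_zero (Function.mem_support.mp hm)
  exact Set.mem_iUnion.mpr ⟨l, hl⟩

/-- The sum in the definition of the first crank moments is finite. -/
theorem overM_support_finite (n : ℕ) : (Function.support fun m : ℤ => overM m n).Finite :=
  sum_crankWeight_support_finite _

/-- The sum in the definition of the second crank moments is finite. -/
theorem overM2_support_finite (n : ℕ) : (Function.support fun m : ℤ => overM2 m n).Finite :=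
  sum_crankWeight_support_finite _

open scoped PowerSeries.WithPiTopology in
/-- The infinite product `(a; q)_∞ = ∏_{k ≥ 0} (1 - a q ^ k)` of formal power series. -/
noncomputable def qPochInf (a q : PowerSeries ℤ) : PowerSeries ℤ :=
  ∏' k : ℕ, (1 - a * q ^ k)

open scoped PowerSeries.WithPiTopology in
/-- The product `(q ^ d; q ^ d)_∞` converges for every `d ≥ 1`. -/
theorem multipliable_qPochInf_X_pow (d : ℕ) (hd : 1 ≤ d) :
    Multipliable fun k : ℕ =>
      (1 - (PowerSeries.X : PowerSeries ℤ) ^ d * (PowerSeries.X ^ d) ^ k) := by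
  simp_rw [sub_eq_add_neg]
  apply PowerSeries.WithPiTopology.multipliable_one_add_of_tendsto_order_atTop_nhds_top
  refine ENat.tendsto_nhds_top_iff_natCast_lt.mpr fun n => Filter.eventually_atTop.mpr ⟨n, ?_⟩
  intro m hm
  rw [PowerSeries.order_neg, ← pow_mul, ← pow_add, PowerSeries.order_X_pow]
  norm_cast
  nlinarith

/-- The series `F = q (q; q)_∞ ^ 6 (q ^ 2; q ^ 2)_∞ ^ 9`. -/
noncomputable def seriesF : PowerSeries ℤ :=
  PowerSeries.X * qPochInf PowerSeries.X PowerSeries.X ^ 6 *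
    qPochInf (PowerSeries.X ^ 2) (PowerSeries.X ^ 2) ^ 9

/-- The coefficient of `q ^ n` in `F`. -/
noncomputable def coeffF (n : ℕ) : ℤ := PowerSeries.coeff n seriesF

/-! Let P = `overGf` be the generating function of overpartitions, D = q d/dq, e_k = ∑ σ_k(n) q^n
and f_k(q) = e_k(q²). Apart from the second rank moment, every series in the identity can be brought
to the form P times a polynomial in e₁, f₁, e₃. The identity then reduces to a linear relation
between such polynomials.

Eisenstein series. The Jacobi theta series satisfies the heat equation. Combined with the triple
product and expanded at z = ±exp u, this equation yields Ramanujan's differential equations and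
relations of level two (`heat_umom`). They express e₅, e₇, f₃, f₅, f₇ through e₁, f₁, e₃ and show
that ℚ[e₁, f₁, e₃] is stable under D. Since DP = P (2e₁ - 2f₁), so is P · ℚ[e₁, f₁, e₃].

Cranks. The product (q)²/∏(1 - zq^i)(1 - q^i/z), at z = exp u, has a Lambert series as logarithmic
u-derivative, so its moments are polynomials in the e_k (`crankMom_succ`). Separating the overlined
parts, and for the second crank also the odd ones, shows that the two residual crank moments are
generated by P times these polynomials in q and in q² (`crankGf_mul_distinctGf`,
`expand_crankGf_mul`).

Ranks. Let R_m generate the overpartitions of rank at least m, for m > 0. Counting overpartitions in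
a box gives R_m + R_{m+1} = -2P ∑_{n≥1} (-1)^n q^{n²+nm} (`rankTail_add`). Even rank moments are
therefore combinations of T_k = P ∑_{m≥1} m^k ∑_{n≥1} (-1)^n q^{n²+nm} with k odd. These are not
treated as quasimodular, but their images under a heat operator are: the operator replaces (-1)^n by
(-1)^n ((2n+m)² + 2c), and the new coefficients, extended oddly around a constant c, satisfy a
first-order q-recurrence with quadratic inhomogeneity. Each convolution with the theta coefficients
lowers the degree of the inhomogeneity; after two of them the recurrence is solved by 1/(1 +
q^{m-1}). So θ² times the transformed Appell-Lerch sum is elementary (`theta_sq_mul_hat`). Dividing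
by θ² produces the square of the crank function times a Lambert series, and Taylor expansion gives
T_{k+2} + 4DT_k ∈ P · ℚ[e₁, f₁, e₃] for k = 1, 3, 5. Eliminating T₇, T₅, T₃ from the eighth moment
leaves a cubic in D acting on the second moment (`rankGf_eight_eq`).

Finally F/P = q (q;q)^8 (q²;q²)^8 is also a polynomial in e₁, f₁, e₃ (`overGf_mul_cuspQuot`), and
the remaining relation is checked monomial by monomial (`rank_crank_identity`). -/

namespace OverRank

open PowerSeries
open scoped PowerSeries.WithPiTopology

/-! ### Summability and convergence in the coefficientwise topology. -/

section FormalSums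

variable {R : Type*} [CommRing R] [TopologicalSpace R]

/-- The exponent `e i` is a lower bound for the order; finiteness of its sublevel sets leaves
finitely many terms in each coefficient, whatever the topology of `R`. -/
theorem summable_of_X_pow_dvd {ι : Type*} {f : ι → R⟦X⟧} (e : ι → ℕ)
    (he : ∀ N, {i | e i ≤ N}.Finite) (h : ∀ i, X ^ e i ∣ f i) : Summable f := by
  rw [WithPiTopology.summable_iff_summable_coeff]
  intro n
  refine summable_of_hasFiniteSupport ((he n).subset fun i hi => ?_)
  by_contra hlt
  exact hi (X_pow_dvd_iff.mp (h i) n (not_le.mp hlt))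

variable [T2Space R]

theorem coeff_tsum {ι : Type*} {f : ι → R⟦X⟧} (hf : Summable f) (n : ℕ) :
    coeff n (∑' i, f i) = ∑' i, coeff n (f i) :=
  (((WithPiTopology.hasSum_iff_hasSum_coeff R).mp hf.hasSum) n).tsum_eq.symm

theorem X_pow_dvd_tsum {ι : Type*} {f : ι → R⟦X⟧} (N : ℕ) (h : ∀ i, X ^ N ∣ f i) :
    X ^ N ∣ ∑' i, f i := by
  by_cases hf : Summable f
  · rw [X_pow_dvd_iff]
    intro m hm
    rw [coeff_tsum hf]
    simp [fun i => X_pow_dvd_iff.mp (h i) m hm]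
  · rw [tsum_eq_zero_of_not_summable hf]
    exact dvd_zero _

-- The coefficient of index `d` is constant from `N = d + 1` on.
omit [T2Space R] in
theorem tendsto_of_X_pow_dvd {a : ℕ → R⟦X⟧} {b : R⟦X⟧} (h : ∀ N, X ^ N ∣ a N - b) :
    Filter.Tendsto a Filter.atTop (nhds b) := by
  rw [WithPiTopology.tendsto_iff_coeff_tendsto]
  intro d
  refine tendsto_atTop_of_eventually_const (i₀ := d + 1) fun N hN => ?_
  have := X_pow_dvd_iff.mp (h N) d (by omega)
  rwa [map_sub, sub_eq_zero] at this

omit [TopologicalSpace R] [T2Space R] in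
theorem eq_zero_of_X_pow_dvd {a : R⟦X⟧} (h : ∀ N, X ^ N ∣ a) : a = 0 := by
  ext n
  exact X_pow_dvd_iff.mp (h (n + 1)) n (by omega)

end FormalSums

/-! ### The derivation q d/dq and first-order equations. -/

section EulerDerivation

variable {R : Type*} [CommRing R]

/-- The derivation `q d/dq` on formal power series. -/
noncomputable def qD : Derivation R R⟦X⟧ R⟦X⟧ := (X : R⟦X⟧) • derivative R

theorem coeff_qD (f : R⟦X⟧) (n : ℕ) : coeff n (qD f) = n * coeff n f := by
  have : qD f = X * derivative R f := rfl
  rw [this]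
  cases n with
  | zero => simp
  | succ k => rw [coeff_succ_X_mul, coeff_derivative]; push_cast; ring

theorem qD_X_pow (n : ℕ) : qD ((X : R⟦X⟧) ^ n) = (n : R⟦X⟧) * (X : R⟦X⟧) ^ n := by
  ext m
  rw [coeff_qD, ← map_natCast (C (R := R)), coeff_C_mul, coeff_X_pow]
  split_ifs with h
  · rw [h]
  · simp

theorem qD_C (r : R) : qD (C r) = 0 := by
  have : qD (C r) = X * derivative R (C r) := rfl
  rw [this, derivative_C, mul_zero]

theorem continuous_qD [TopologicalSpace R] [IsTopologicalRing R] :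
    Continuous (qD (R := R)) := by
  refine continuous_iff_continuousAt.mpr fun f => ?_
  rw [ContinuousAt, WithPiTopology.tendsto_iff_coeff_tendsto]
  intro d
  simp_rw [coeff_qD]
  exact (((WithPiTopology.continuous_coeff R d).const_mul _).tendsto f)

/-- A first order homogeneous equation `q dh/dq = h g` with `g(0) = 0` determines `h` from its
constant term. -/
theorem eq_zero_of_qD_eq_mul [Algebra ℚ R] {h g : R⟦X⟧} (hg : constantCoeff g = 0)
    (h0 : constantCoeff h = 0) (hd : qD h = h * g) : h = 0 := by
  ext n
  induction n using Nat.strong_induction_on with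
  | _ n ih =>
    cases n with
    | zero => simpa using h0
    | succ n =>
      have h1 := congrArg (coeff (n + 1)) hd
      rw [coeff_qD, coeff_mul] at h1
      -- Lower coefficients of `h` vanish by induction, and the top one is paired with the constant
      -- term of `g`, which is zero. What remains is (n + 1) h_{n+1} = 0, and n + 1 is invertible
      -- over ℚ.
      have h2 : ∑ p ∈ Finset.HasAntidiagonal.antidiagonal (n + 1), coeff p.1 h * coeff p.2 g = 0 := by
        refine Finset.sum_eq_zero fun p hp => ?_
        have hp' := Finset.HasAntidiagonal.mem_antidiagonal.mp hp
        by_cases hlt : p.1 < n + 1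
        · rw [ih p.1 hlt]; simp
        · have : p.2 = 0 := by omega
          rw [this, coeff_zero_eq_constantCoeff_apply, hg, mul_zero]
      rw [h2] at h1
      have h3 : (algebraMap ℚ R ((n + 1 : ℕ) : ℚ)⁻¹) * (((n + 1 : ℕ) : R) * coeff (n + 1) h) = 0 := by
        rw [h1, mul_zero]
      rw [← mul_assoc, ← map_natCast (algebraMap ℚ R), ← map_mul, inv_mul_cancel₀ (by positivity),
        map_one, one_mul] at h3
      simpa using h3

theorem eq_of_qD_eq_mul [Algebra ℚ R] {f f' g : R⟦X⟧} (hg : constantCoeff g = 0)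
    (h0 : constantCoeff f = constantCoeff f') (hf : qD f = f * g) (hf' : qD f' = f' * g) :
    f = f' := by
  refine sub_eq_zero.mp (eq_zero_of_qD_eq_mul hg (by simp [h0]) ?_)
  rw [map_sub, hf, hf', sub_mul]

end EulerDerivation

/-! ### Infinite products and their logarithmic derivatives. -/

section Products

variable {R : Type*} [CommRing R] [TopologicalSpace R]

theorem multipliable_one_add_X_pow_mul (a : ℕ → R⟦X⟧) :
    Multipliable fun i => 1 + X ^ (i + 1) * a i := by
  nontriviality R
  apply WithPiTopology.multipliable_one_add_of_tendsto_order_atTop_nhds_top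
  refine ENat.tendsto_nhds_top_iff_natCast_lt.mpr (fun n ↦ Filter.eventually_atTop.mpr ⟨n, ?_⟩)
  intro m hm
  refine lt_of_lt_of_le ?_ (le_order_mul (φ := X ^ (m + 1)) (ψ := a m))
  rw [order_X_pow]
  refine lt_of_lt_of_le (b := ((m + 1 : ℕ) : ℕ∞)) ?_ le_self_add
  exact_mod_cast Nat.lt_succ_of_le hm

theorem multipliable_of_X_pow_dvd {f : ℕ → R⟦X⟧} (h : ∀ i, X ^ (i + 1) ∣ f i - 1) :
    Multipliable f := by
  choose a ha using h
  have : f = fun i => 1 + X ^ (i + 1) * a i := by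
    funext i
    rw [← ha i]; ring
  rw [this]
  exact multipliable_one_add_X_pow_mul a

variable [IsTopologicalRing R] [T2Space R]

omit [IsTopologicalRing R] [T2Space R] in
theorem tendsto_prod_range {f : ℕ → R⟦X⟧} (h : ∀ i, X ^ (i + 1) ∣ f i - 1) :
    Filter.Tendsto (fun N => ∏ i ∈ Finset.range N, f i) Filter.atTop (nhds (∏' i, f i)) :=
  (multipliable_of_X_pow_dvd h).hasProd.tendsto_prod_nat

omit [TopologicalSpace R] [IsTopologicalRing R] [T2Space R] in
theorem constantCoeff_eq_one_of_dvd {f : R⟦X⟧} {i : ℕ} (h : X ^ (i + 1) ∣ f - 1) :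
    constantCoeff f = 1 := by
  have := X_pow_dvd_iff.mp h 0 (by omega)
  simpa [sub_eq_zero] using this

omit [IsTopologicalRing R] in
theorem constantCoeff_tprod {f : ℕ → R⟦X⟧} (h : ∀ i, X ^ (i + 1) ∣ f i - 1) :
    constantCoeff (∏' i, f i) = 1 := by
  have h1 := ((WithPiTopology.continuous_constantCoeff R).tendsto _).comp (tendsto_prod_range h)
  refine tendsto_nhds_unique h1 ?_
  refine tendsto_const_nhds.congr fun N => ?_
  simp [map_prod, constantCoeff_eq_one_of_dvd (h _)]

/-- Logarithmic derivative of an infinite product with respect to a continuous derivation. -/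
theorem derivation_tprod {A : Type*} [CommRing A] [Algebra A R⟦X⟧] (δ : Derivation A R⟦X⟧ R⟦X⟧)
    (hδ : Continuous δ) {f g : ℕ → R⟦X⟧} (h : ∀ i, X ^ (i + 1) ∣ f i - 1)
    (hg : ∀ i, X ^ (i + 1) ∣ g i) (hfg : ∀ i, δ (f i) = f i * g i) :
    δ (∏' i, f i) = (∏' i, f i) * ∑' i, g i := by
  have h1 := (hδ.tendsto _).comp (tendsto_prod_range h)
  have hs : Summable g := summable_of_X_pow_dvd (fun i => i + 1)
    (fun N => (Set.finite_Iic N).subset fun i (hi : i + 1 ≤ N) => by simp; omega) hg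
  have h2 := (tendsto_prod_range h).mul hs.hasSum.tendsto_sum_nat
  refine tendsto_nhds_unique h1 (h2.congr fun N => ?_)
  simp only [Function.comp]
  induction N with
  | zero => simp
  | succ N ih =>
    rw [Finset.prod_range_succ, Derivation.leibniz, ← ih, Finset.sum_range_succ, hfg]
    simp only [smul_eq_mul]
    ring

/-- Kept in multiplied form so that logarithmic derivatives of factors 1 - y need no inverse. -/
theorem geom_tsum {y : R⟦X⟧} (hy : constantCoeff y = 0) : (1 - y) * ∑' j : ℕ, y ^ (j + 1) = y := by
  have h1 := WithPiTopology.one_sub_mul_tsum_pow_of_constantCoeff_eq_zero hy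
  have h2 := (WithPiTopology.summable_pow_of_constantCoeff_eq_zero hy).tsum_eq_zero_add
  rw [h2] at h1
  linear_combination h1

end Products

/-! ### The finite products (q; q)_n and their inverses. -/

section FinitePochhammer

variable (R : Type*) [CommRing R]

/-- The finite product `(q; q)_n`. -/
noncomputable def eulerFin (n : ℕ) : R⟦X⟧ := ∏ i ∈ Finset.range n, (1 - X ^ (i + 1))

/-- The inverse of `(q; q)_n`. -/
noncomputable def eulerInv (n : ℕ) : R⟦X⟧ := invOfUnit (eulerFin R n) 1

theorem eulerFin_succ (n : ℕ) : eulerFin R (n + 1) = eulerFin R n * (1 - X ^ (n + 1)) :=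
  Finset.prod_range_succ _ _

theorem constantCoeff_eulerFin (n : ℕ) : constantCoeff (eulerFin R n) = 1 := by
  simp [eulerFin, map_prod]

theorem eulerFin_mul_inv (n : ℕ) : eulerFin R n * eulerInv R n = 1 :=
  mul_invOfUnit _ _ (by simp [constantCoeff_eulerFin])

theorem eulerInv_succ (n : ℕ) : (1 - X ^ (n + 1)) * eulerInv R (n + 1) = eulerInv R n := by
  have h1 := eulerFin_mul_inv R n
  have h2 := eulerFin_mul_inv R (n + 1)
  rw [eulerFin_succ] at h2
  linear_combination eulerInv R n * h2 - (1 - X ^ (n + 1)) * eulerInv R (n + 1) * h1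

theorem eulerFin_zero : eulerFin R 0 = 1 := by simp [eulerFin]

theorem eulerInv_zero : eulerInv R 0 = 1 := by
  have := eulerFin_mul_inv R 0
  rwa [eulerFin_zero, one_mul] at this

end FinitePochhammer

/-! ### The double series of the crank and its infinite product. -/

section CrankProduct

variable {R : Type*} [CommRing R]

/-- The constant power series `z ^ k`. -/
noncomputable def zC (z : Rˣ) (k : ℤ) : R⟦X⟧ := C ((z ^ k : Rˣ) : R)

theorem zC_add (z : Rˣ) (k l : ℤ) : zC z (k + l) = zC z k * zC z l := by
  simp [zC, zpow_add]

theorem zC_zero (z : Rˣ) : zC z 0 = 1 := by simp [zC]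

theorem zC_mul_neg (z : Rˣ) (k : ℤ) : zC z k * zC z (-k) = 1 := by
  rw [← zC_add, add_neg_cancel, zC_zero]

/-- The summands of the double series whose sum is the crank generating function. -/
noncomputable def crankTerm (z : Rˣ) (i j : ℕ) (p : ℕ × ℕ) : R⟦X⟧ :=
  X ^ (p.1 * p.2 + i * p.2 + j * p.1) *
    (zC z (p.2 - p.1) * eulerInv R p.1 * eulerInv R p.2)

/-- Raising `j` by one multiplies the term by q^{ω+1}, and 1 - q^{ω+1} cancels the last factor of
(q)_{ω+1}. -/
theorem crankTerm_succ_left (z : Rˣ) (i j : ℕ) (p : ℕ × ℕ) :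
    crankTerm z i j (p.1 + 1, p.2) - crankTerm z i (j + 1) (p.1 + 1, p.2) =
      zC z (-1) * X ^ j * crankTerm z (i + 1) j p := by
  simp only [crankTerm]
  rw [← eulerInv_succ R p.1, show ((p.2 : ℤ) - ((p.1 + 1 : ℕ) : ℤ)) = -1 + (p.2 - p.1) by
    push_cast; ring, zC_add]
  ring

theorem crankTerm_succ_right (z : Rˣ) (i j : ℕ) (p : ℕ × ℕ) :
    crankTerm z i j (p.1, p.2 + 1) - crankTerm z (i + 1) j (p.1, p.2 + 1) =
      zC z 1 * X ^ i * crankTerm z i (j + 1) p := by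
  simp only [crankTerm]
  rw [← eulerInv_succ R p.2, show (((p.2 + 1 : ℕ) : ℤ) - (p.1 : ℤ)) = 1 + (p.2 - p.1) by
    push_cast; ring, zC_add]
  ring

variable [TopologicalSpace R]

/-- The double series `∑ z ^ (μ - ω) q ^ (ω μ + i μ + j ω) / ((q)_ω (q)_μ)`. -/
noncomputable def crankSeries (z : Rˣ) (i j : ℕ) : R⟦X⟧ := ∑' p, crankTerm z i j p

theorem summable_crankTerm (z : Rˣ) (i j : ℕ) : Summable (crankTerm z (i + 1) (j + 1)) := by
  refine summable_of_X_pow_dvd (fun p => p.1 * p.2 + (i + 1) * p.2 + (j + 1) * p.1) (fun N => ?_)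
    (fun p => Dvd.intro _ rfl)
  refine (Set.finite_Iic ((N, N) : ℕ × ℕ)).subset fun p hp => ?_
  simp only [Set.mem_ofPred_eq] at hp
  constructor <;> simp <;> nlinarith [Nat.zero_le (p.1 * p.2), Nat.zero_le (i * p.2),
    Nat.zero_le (j * p.1)]

variable [IsTopologicalRing R] [T2Space R]

theorem crankSeries_sub_left (z : Rˣ) (i j : ℕ) :
    crankSeries z (i + 1) (j + 1) - crankSeries z (i + 1) (j + 2) =
      zC z (-1) * X ^ (j + 1) * crankSeries z (i + 2) (j + 1) := by
  rw [crankSeries, crankSeries, ← (summable_crankTerm z i j).tsum_sub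
    (summable_crankTerm z i (j + 1)), crankSeries,
    ← (summable_crankTerm z (i + 1) j).tsum_mul_left]
  -- Terms with first index 0 do not depend on `j` and cancel, so the difference is a sum over
  -- successors.
  have hinj : Function.Injective fun p : ℕ × ℕ => (p.1 + 1, p.2) := by
    rintro ⟨a, b⟩ ⟨c, d⟩ h
    simpa using h
  rw [← hinj.tsum_eq]
  · exact tsum_congr fun p => crankTerm_succ_left z (i + 1) (j + 1) p
  · rintro ⟨a, b⟩ hp
    cases a with
    | zero => exact absurd (by simp [crankTerm]) hp
    | succ a => exact ⟨(a, b), rfl⟩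

theorem crankSeries_sub_right (z : Rˣ) (i j : ℕ) :
    crankSeries z (i + 1) (j + 1) - crankSeries z (i + 2) (j + 1) =
      zC z 1 * X ^ (i + 1) * crankSeries z (i + 1) (j + 2) := by
  rw [crankSeries, crankSeries, ← (summable_crankTerm z i j).tsum_sub
    (summable_crankTerm z (i + 1) j), crankSeries,
    ← (summable_crankTerm z i (j + 1)).tsum_mul_left]
  have hinj : Function.Injective fun p : ℕ × ℕ => (p.1, p.2 + 1) := by
    rintro ⟨a, b⟩ ⟨c, d⟩ h
    simpa using h
  rw [← hinj.tsum_eq]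
  · exact tsum_congr fun p => crankTerm_succ_right z (i + 1) (j + 1) p
  · rintro ⟨a, b⟩ hp
    cases b with
    | zero => exact absurd (by simp [crankTerm]) hp
    | succ b => exact ⟨(a, b), rfl⟩

/-- The factors of the two-sided theta product. -/
noncomputable def thetaFactor (z : Rˣ) (i : ℕ) : R⟦X⟧ :=
  (1 - zC z 1 * X ^ (i + 1)) * (1 - zC z (-1) * X ^ (i + 1))

/-- The two contiguous relations combine into a diagonal step: one factor of the theta product moves
(i+1, i+1) to (i+2, i+1), the other moves on to (i+2, i+2). -/
theorem thetaFactor_mul_crankSeries (z : Rˣ) (i : ℕ) :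
    thetaFactor z i * crankSeries z (i + 1) (i + 1) =
      (1 - X ^ (2 * i + 2)) * (1 - X ^ (2 * i + 3)) * crankSeries z (i + 2) (i + 2) := by
  have hz : zC z 1 * zC z (-1) = 1 := zC_mul_neg z 1
  have h1 := crankSeries_sub_left z i i
  have h2 := crankSeries_sub_right z i i
  have h3 := crankSeries_sub_left z (i + 1) i
  have h4 := crankSeries_sub_right z (i + 1) i
  have h5 := crankSeries_sub_right z i (i + 1)
  have e1 : (1 - zC z 1 * X ^ (i + 1)) * crankSeries z (i + 1) (i + 1) =
      (1 - X ^ (2 * i + 2)) * crankSeries z (i + 2) (i + 1) := by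
    linear_combination h2 - zC z 1 * X ^ (i + 1) * h1 +
      X ^ (2 * i + 2) * crankSeries z (i + 2) (i + 1) * (-hz)
  have e2 : (1 - zC z (-1) * X ^ (i + 1)) * crankSeries z (i + 2) (i + 1) =
      (1 - X ^ (2 * i + 3)) * crankSeries z (i + 2) (i + 2) := by
    linear_combination h3 - zC z (-1) * X ^ (i + 1) * h4 +
      X ^ (2 * i + 3) * crankSeries z (i + 2) (i + 2) * (-hz)
  rw [thetaFactor]
  linear_combination (1 - zC z (-1) * X ^ (i + 1)) * e1 + (1 - X ^ (2 * i + 2)) * e2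

/-- Telescoping of the diagonal step. The factor 1 - q completes the product of (1 - q^{2i+2})(1 -
q^{2i+3}) to (q; q)_{2N+1}, and the series on the right tends to 1. -/
theorem prod_thetaFactor_mul (z : Rˣ) (N : ℕ) :
    (∏ i ∈ Finset.range N, thetaFactor z i) * ((1 - X) * crankSeries z 1 1) =
      eulerFin R (2 * N + 1) * crankSeries z (N + 1) (N + 1) := by
  induction N with
  | zero => simp [eulerFin]
  | succ N ih =>
    rw [Finset.prod_range_succ, show 2 * (N + 1) + 1 = (2 * N + 2) + 1 by ring, eulerFin_succ,
      show 2 * N + 2 = (2 * N + 1) + 1 by ring, eulerFin_succ]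
    have h := thetaFactor_mul_crankSeries z N
    calc _ = thetaFactor z N * ((∏ i ∈ Finset.range N, thetaFactor z i) *
          ((1 - X) * crankSeries z 1 1)) := by ring
      _ = eulerFin R (2 * N + 1) * (thetaFactor z N * crankSeries z (N + 1) (N + 1)) := by
          rw [ih]; ring
      _ = _ := by rw [h]; ring

theorem X_pow_dvd_crankSeries_sub_one (z : Rˣ) (N : ℕ) :
    X ^ N ∣ crankSeries z (N + 1) (N + 1) - 1 := by
  classical
  rw [crankSeries, (summable_crankTerm z N N).tsum_eq_add_tsum_ite (0, 0)]
  have : crankTerm z (N + 1) (N + 1) (0, 0) = 1 := by simp [crankTerm, zC_zero, eulerInv_zero]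
  rw [this, add_sub_cancel_left]
  refine X_pow_dvd_tsum N fun p => ?_
  split_ifs with hp
  · exact dvd_zero _
  · refine Dvd.dvd.mul_right (pow_dvd_pow _ ?_) _
    have : 1 ≤ p.1 + p.2 := by
      by_contra h
      exact hp (Prod.ext (by simp; omega) (by simp; omega))
    nlinarith [Nat.zero_le (p.1 * p.2)]

variable (R) in
/-- The infinite product `(q; q)_∞`. -/
noncomputable def euler : R⟦X⟧ := ∏' i : ℕ, (1 - X ^ (i + 1))

/-- The infinite product `∏ (1 - z q ^ i) (1 - q ^ i / z)`. -/
noncomputable def thetaProd (z : Rˣ) : R⟦X⟧ := ∏' i, thetaFactor z i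

omit [TopologicalSpace R] [IsTopologicalRing R] [T2Space R] in
theorem X_pow_dvd_thetaFactor (z : Rˣ) (i : ℕ) : X ^ (i + 1) ∣ thetaFactor z i - 1 :=
  ⟨-zC z 1 - zC z (-1) + zC z 1 * zC z (-1) * X ^ (i + 1), by rw [thetaFactor]; ring⟩

omit [TopologicalSpace R] [IsTopologicalRing R] [T2Space R] in
theorem X_pow_dvd_eulerFactor (i : ℕ) : (X : R⟦X⟧) ^ (i + 1) ∣ (1 - X ^ (i + 1)) - 1 :=
  ⟨-1, by ring⟩

omit [IsTopologicalRing R] [T2Space R] in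
theorem tendsto_eulerFin : Filter.Tendsto (eulerFin R) Filter.atTop (nhds (euler R)) :=
  tendsto_prod_range X_pow_dvd_eulerFactor

/-- The product formula for the crank generating function. -/
theorem thetaProd_mul_crankSeries (z : Rˣ) :
    thetaProd z * ((1 - X) * crankSeries z 1 1) = euler R := by
  have h1 := (tendsto_prod_range (X_pow_dvd_thetaFactor z)).mul_const ((1 - X) * crankSeries z 1 1)
  have h2 : Filter.Tendsto (fun N : ℕ => 2 * N + 1) Filter.atTop Filter.atTop :=
    Filter.tendsto_atTop_mono (fun n => by simp; omega) Filter.tendsto_id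
  have h3 := (tendsto_eulerFin (R := R)).comp h2
  have h4 := tendsto_of_X_pow_dvd (X_pow_dvd_crankSeries_sub_one z)
  have h5 := h3.mul h4
  rw [mul_one] at h5
  refine tendsto_nhds_unique h1 (h5.congr fun N => ?_)
  rw [prod_thetaFactor_mul]; rfl

end CrankProduct

/-! ### The theta coefficients, Gaussian binomials and the finite triple product. -/

section TripleProduct

/-- The exponent `k (k - 1) / 2`. -/
def thetaExp (k : ℤ) : ℕ := (k * (k - 1) / 2).toNat

theorem two_mul_thetaExp (k : ℤ) : 2 * (thetaExp k : ℤ) = k * (k - 1) := by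
  have h0 : 0 ≤ k * (k - 1) := by
    rcases le_or_gt k 0 with h | h <;> nlinarith
  have h1 : Even (k * (k - 1)) := by
    have := Int.even_mul_succ_self (k - 1)
    rwa [sub_add_cancel, mul_comm] at this
  rw [thetaExp, Int.toNat_of_nonneg (by omega)]
  exact Int.mul_ediv_cancel' h1.two_dvd

/-- This linear bound on the quadratic exponent is all that the summability and decay estimates use.
-/
theorem abs_le_thetaExp (k : ℤ) : |k| ≤ thetaExp k + 1 := by
  have := two_mul_thetaExp k
  rcases le_or_gt k 0 with h | h
  · rw [abs_of_nonpos h]; nlinarith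
  · rw [abs_of_pos h]
    rcases le_or_gt k 2 with h2 | h2 <;> nlinarith

theorem finite_thetaExp_le (N : ℕ) : {k : ℤ | thetaExp k ≤ N}.Finite := by
  refine (Set.finite_Icc (-(N + 1 : ℤ)) (N + 1)).subset fun k (hk : thetaExp k ≤ N) => ?_
  have := abs_le_thetaExp k
  have h2 : (thetaExp k : ℤ) ≤ N := by exact_mod_cast hk
  exact abs_le.mp (by omega)

variable (R : Type*) [CommRing R]

/-- The coefficients `(-1) ^ k q ^ (k (k - 1) / 2)` of the theta series. -/
noncomputable def thetaCoeff (k : ℤ) : R⟦X⟧ := ((k.negOnePow : ℤ) : R⟦X⟧) * X ^ thetaExp k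

theorem negOnePow_sub_one (k : ℤ) : (((k - 1).negOnePow : ℤ) : R⟦X⟧) = -((k.negOnePow : ℤ) : R⟦X⟧) := by
  rw [Int.negOnePow_sub, Int.negOnePow_one]
  simp

/-- The exponents of consecutive theta coefficients differ by k - 1, which may be negative; the pair
`m`, `n` with m - n = k - 1 keeps all powers of q natural. -/
theorem thetaCoeff_mul_X_pow {k : ℤ} {m n : ℕ} (h : (n : ℤ) + k = m + 1) :
    thetaCoeff R k * X ^ n = -(X ^ m * thetaCoeff R (k - 1)) := by
  have h1 := two_mul_thetaExp k
  have h2 := two_mul_thetaExp (k - 1)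
  have h3 : thetaExp k + n = m + thetaExp (k - 1) := by
    have : (2 * (thetaExp k + n) : ℤ) = 2 * (m + thetaExp (k - 1)) := by
      rw [mul_add, mul_add, h1, h2]; linarith
    omega
  rw [thetaCoeff, thetaCoeff, negOnePow_sub_one, mul_assoc, ← pow_add, h3, pow_add]
  ring

/-- The Gaussian binomial coefficients, extended by zero. -/
noncomputable def gauss (n : ℕ) (r : ℤ) : R⟦X⟧ :=
  if 0 ≤ r ∧ r ≤ n then eulerFin R n * eulerInv R r.toNat * eulerInv R (n - r).toNat else 0

theorem gauss_of_le {n r s : ℕ} (h : r + s = n) :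
    gauss R n r = eulerFin R n * eulerInv R r * eulerInv R s := by
  rw [gauss, if_pos (by omega), Int.toNat_natCast, show ((n : ℤ) - r).toNat = s by omega]

theorem gauss_eq_zero {n : ℕ} {r : ℤ} (h : ¬ (0 ≤ r ∧ r ≤ n)) : gauss R n r = 0 := if_neg h

/-- The q-Pascal rule. The ends r = 0 and r = n + 1 are separate because one neighbour there is zero
by extension rather than by the formula. -/
theorem gauss_succ_right (n : ℕ) (r : ℤ) :
    gauss R (n + 1) r = gauss R n r + X ^ (n + 1 - r).toNat * gauss R n (r - 1) := by
  rcases lt_or_ge r 0 with h | h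
  · rw [gauss_eq_zero, gauss_eq_zero, gauss_eq_zero, mul_zero, add_zero] <;> omega
  lift r to ℕ using h
  rcases lt_or_ge (n + 1) r with h | h
  · rw [gauss_eq_zero, gauss_eq_zero, gauss_eq_zero, mul_zero, add_zero] <;> omega
  obtain ⟨s, hs⟩ := Nat.exists_eq_add_of_le h
  rw [show ((n : ℤ) + 1 - r).toNat = s by omega, gauss_of_le R (s := s) (by omega)]
  cases r with
  | zero =>
    have hs' : s = n + 1 := by omega
    subst hs'
    rw [gauss_eq_zero R (r := ((0 : ℕ) : ℤ) - 1) (by omega), gauss_of_le R (s := n) (zero_add n),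
      eulerInv_zero]
    linear_combination eulerFin_mul_inv R (n + 1) - eulerFin_mul_inv R n
  | succ r =>
    rw [show (((r + 1 : ℕ) : ℤ) - 1) = r by push_cast; ring, gauss_of_le R (s := s) (r := r) (by omega)]
    cases s with
    | zero =>
      have : n = r := by omega
      subst this
      rw [gauss_eq_zero R (by push_cast; omega), pow_zero, one_mul, zero_add, eulerInv_zero]
      linear_combination eulerFin_mul_inv R (n + 1) - eulerFin_mul_inv R n
    | succ s =>
      rw [gauss_of_le R (n := n) (s := s) (by omega), ← eulerInv_succ R r, ← eulerInv_succ R s,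
        eulerFin_succ, show n = r + s + 1 by omega]
      ring

theorem gauss_symm (n : ℕ) (r : ℤ) : gauss R n r = gauss R n (n - r) := by
  by_cases h : 0 ≤ r ∧ r ≤ n
  · rw [gauss, if_pos h, gauss, if_pos (by omega), sub_sub_cancel]
    ring
  · rw [gauss_eq_zero R h, gauss_eq_zero R (by omega)]

theorem gauss_succ_left (n : ℕ) (r : ℤ) :
    gauss R (n + 1) r = gauss R n (r - 1) + X ^ r.toNat * gauss R n r := by
  have h := gauss_succ_right R n (n + 1 - r)
  rw [gauss_symm R (n + 1) r, gauss_symm R n r, gauss_symm R n (r - 1)]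
  rw [sub_sub_cancel, show (n : ℤ) + 1 - r - 1 = n - r by ring] at h
  rw [show ((n + 1 : ℕ) : ℤ) - r = n + 1 - r by push_cast; ring,
    show (n : ℤ) - (r - 1) = n + 1 - r by ring, h]

variable {R}

theorem summable_thetaCoeff_mul [TopologicalSpace R] (a : ℤ → R⟦X⟧) :
    Summable fun k => thetaCoeff R k * a k :=
  summable_of_X_pow_dvd thetaExp finite_thetaExp_le fun _ =>
    Dvd.dvd.mul_right (Dvd.intro_left _ rfl) _

theorem thetaCoeff_zero : thetaCoeff R 0 = 1 := by
  simp [thetaCoeff, thetaExp]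

theorem summable_thetaCoeff_mul_shift [TopologicalSpace R] (a : ℤ → R⟦X⟧) (l : ℤ) :
    Summable fun k => thetaCoeff R (k + l) * a (k + l) :=
  (Equiv.addRight l).summable_iff.mpr (summable_thetaCoeff_mul a)

variable [TopologicalSpace R]

theorem tsum_thetaCoeff_mul_shift (a : ℤ → R⟦X⟧) (l : ℤ) :
    ∑' k, thetaCoeff R (k + l) * a (k + l) = ∑' k, thetaCoeff R k * a k :=
  (Equiv.addRight l).tsum_eq fun k => thetaCoeff R k * a k

variable [IsTopologicalRing R] [T2Space R]

/-- Realigning the copy multiplied by `y` through a shift `l` lets an identity of series be proved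
term by term. -/
theorem one_sub_mul_tsum_thetaCoeff (y : R⟦X⟧) (a : ℤ → R⟦X⟧) (l : ℤ) :
    (1 - y) * ∑' k, thetaCoeff R k * a k =
      ∑' k, (thetaCoeff R k * a k - thetaCoeff R (k + l) * (y * a (k + l))) := by
  rw [(summable_thetaCoeff_mul a).tsum_sub
    (summable_thetaCoeff_mul_shift (fun k => y * a k) l),
    tsum_thetaCoeff_mul_shift (fun k => y * a k) l, sub_mul, one_mul,
    ← (summable_thetaCoeff_mul a).tsum_mul_left]
  congr 1
  exact tsum_congr fun k => by ring

/-- The finite Jacobi triple product. -/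
theorem finite_triple_product (z : Rˣ) (a b : ℕ) :
    (∏ i ∈ Finset.range a, (1 - zC z 1 * X ^ i)) *
      ∏ i ∈ Finset.range b, (1 - zC z (-1) * X ^ (i + 1)) =
    ∑' k : ℤ, thetaCoeff R k * (zC z k * gauss R (a + b) (k + b)) := by
  induction a with
  | zero =>
    rw [Finset.prod_range_zero, one_mul]
    induction b with
    | zero =>
      rw [tsum_eq_single 0]
      · simp [thetaCoeff_zero, zC_zero, gauss, eulerFin_zero, eulerInv_zero]
      · intro k hk
        rw [gauss_eq_zero, mul_zero, mul_zero]
        simp; omega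
    | succ b ih =>
      rw [Finset.prod_range_succ, ih, mul_comm, one_sub_mul_tsum_thetaCoeff _ _ 1]
      refine tsum_congr fun k => ?_
      rw [show 0 + (b + 1) = (0 + b) + 1 by ring, gauss_succ_left,
        show k + ((b + 1 : ℕ) : ℤ) - 1 = k + b by push_cast; ring,
        show k + ((b + 1 : ℕ) : ℤ) = k + 1 + b by push_cast; ring]
      -- Below this range the truncated exponent of the q-Pascal rule is meaningless, but the
      -- Gaussian coefficient it multiplies is zero.
      by_cases h : 0 ≤ k + 1 + b
      · have h1 := thetaCoeff_mul_X_pow R (k := k + 1) (m := (k + 1 + b).toNat) (n := b + 1)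
          (by omega)
        rw [add_sub_cancel_right] at h1
        rw [zC_add]
        linear_combination (-zC z k * gauss R (0 + b) (k + 1 + b)) * h1 -
          (thetaCoeff R (k + 1) * X ^ (b + 1) * zC z k * gauss R (0 + b) (k + 1 + b)) *
            zC_mul_neg z 1
      · rw [gauss_eq_zero R (r := k + 1 + b) (by omega)]
        ring
  | succ a ih =>
    rw [Finset.prod_range_succ, mul_right_comm, ih, mul_comm, one_sub_mul_tsum_thetaCoeff _ _ (-1)]
    refine tsum_congr fun k => ?_
    rw [show a + 1 + b = (a + b) + 1 by ring, gauss_succ_right,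
      show k + -1 + (b : ℤ) = k + b - 1 by ring]
    by_cases h : k + b ≤ (a + b) + 1
    · have h1 := thetaCoeff_mul_X_pow R (k := k) (m := a)
        (n := (((a + b : ℕ) : ℤ) + 1 - (k + b)).toNat) (by omega)
      rw [zC_add, ← sub_eq_add_neg]
      linear_combination (-zC z k * gauss R (a + b) (k + b - 1)) * h1 -
        (thetaCoeff R (k - 1) * X ^ a * zC z k * gauss R (a + b) (k + b - 1)) * zC_mul_neg z 1
    · rw [gauss_eq_zero R (r := k + b - 1) (by push_cast; omega)]
      ring

end TripleProduct

/-! ### The limit to the Jacobi triple product. -/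

section TripleProductLimit

variable {R : Type*} [CommRing R] [TopologicalSpace R]

theorem X_pow_dvd_of_tendsto [T2Space R] {a : ℕ → R⟦X⟧} {b c : R⟦X⟧} {N : ℕ}
    (h : Filter.Tendsto a Filter.atTop (nhds b)) (hd : ∀ᶠ M in Filter.atTop, X ^ N ∣ a M - c) :
    X ^ N ∣ b - c := by
  rw [X_pow_dvd_iff]
  intro m hm
  rw [map_sub, sub_eq_zero]
  refine tendsto_nhds_unique (((WithPiTopology.continuous_coeff R m).tendsto b).comp h)
    (tendsto_const_nhds.congr' ?_)
  filter_upwards [hd] with M hM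
  have := X_pow_dvd_iff.mp hM m hm
  rw [map_sub, sub_eq_zero] at this
  exact this.symm

omit [TopologicalSpace R] in
theorem X_pow_dvd_eulerFin_sub (n d : ℕ) : X ^ (n + 1) ∣ eulerFin R (n + d) - eulerFin R n := by
  induction d with
  | zero => simp
  | succ d ih =>
    rw [← add_assoc, eulerFin_succ, show eulerFin R (n + d) * (1 - X ^ (n + d + 1)) - eulerFin R n =
      (eulerFin R (n + d) - eulerFin R n) - X ^ (n + 1) * (X ^ d * eulerFin R (n + d)) by ring]
    exact ih.sub (Dvd.intro _ rfl)

omit [TopologicalSpace R] in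
theorem X_pow_dvd_eulerFin_mul_inv (n d : ℕ) :
    X ^ (n + 1) ∣ eulerFin R (n + d) * eulerInv R n - 1 := by
  rw [← eulerFin_mul_inv R n, ← sub_mul]
  exact (X_pow_dvd_eulerFin_sub n d).mul_right _

theorem X_pow_dvd_euler_mul_inv [T2Space R] (n : ℕ) : X ^ (n + 1) ∣ euler R * eulerInv R n - 1 := by
  rw [← eulerFin_mul_inv R n, ← sub_mul]
  refine (X_pow_dvd_of_tendsto tendsto_eulerFin ?_).mul_right _
  filter_upwards [Filter.eventually_ge_atTop n] with M hM
  obtain ⟨d, rfl⟩ := Nat.exists_eq_add_of_le hM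
  exact X_pow_dvd_eulerFin_sub n d

omit [TopologicalSpace R] in
theorem X_pow_dvd_mul_sub_one {a b : R⟦X⟧} {N : ℕ} (ha : X ^ N ∣ a - 1) (hb : X ^ N ∣ b - 1) :
    X ^ N ∣ a * b - 1 := by
  rw [show a * b - 1 = (a - 1) * b + (b - 1) by ring]
  exact (ha.mul_right b).add hb

variable [T2Space R]

/-- With r = k + N and s = N + 1 - k the Gaussian coefficient agrees with 1/(q)_∞ up to order min(r,
s) + 1. This is poor for k near ±N, and there the exponent of the theta coefficient makes up for the
loss. -/
theorem X_pow_dvd_thetaCoeff_mul_gauss (N : ℕ) (k : ℤ) :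
    X ^ N ∣ thetaCoeff R k * (euler R * gauss R (N + 1 + N) (k + N) - 1) := by
  have habs := abs_le_thetaExp k
  by_cases h : 0 ≤ k + N ∧ k ≤ N + 1
  · obtain ⟨r, hr⟩ := Int.eq_ofNat_of_zero_le h.1
    obtain ⟨s, hs⟩ := Int.eq_ofNat_of_zero_le (sub_nonneg.mpr h.2)
    rw [hr, gauss_of_le R (r := r) (s := s) (by omega),
      show euler R * (eulerFin R (N + 1 + N) * eulerInv R r * eulerInv R s) =
        (euler R * eulerInv R r) * (eulerFin R (N + 1 + N) * eulerInv R s) by ring]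
    have h1 := X_pow_dvd_euler_mul_inv (R := R) r
    have h2 := X_pow_dvd_eulerFin_mul_inv (R := R) s r
    rw [show s + r = N + 1 + N by omega] at h2
    have h3 := X_pow_dvd_mul_sub_one ((pow_dvd_pow _ (Nat.min_le_left (r + 1) (s + 1))).trans h1)
      ((pow_dvd_pow _ (Nat.min_le_right (r + 1) (s + 1))).trans h2)
    refine (pow_dvd_pow (X : R⟦X⟧) (n := thetaExp k + min (r + 1) (s + 1)) ?_).trans ?_
    · rcases le_total k 0 with hk | hk
      · rw [abs_of_nonpos hk] at habs; omega
      · rw [abs_of_nonneg hk] at habs; omega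
    · rw [pow_add]
      exact mul_dvd_mul (Dvd.intro_left _ rfl) h3
  · refine ((pow_dvd_pow (X : R⟦X⟧) (n := thetaExp k) ?_).trans (Dvd.intro_left _ rfl)).mul_right _
    rcases le_total k 0 with hk | hk
    · rw [abs_of_nonpos hk] at habs; omega
    · rw [abs_of_nonneg hk] at habs; omega

/-- The theta series `∑ (-1) ^ k q ^ (k (k - 1) / 2) z ^ k`. -/
noncomputable def theta (z : Rˣ) : R⟦X⟧ := ∑' k, thetaCoeff R k * zC z k

omit [TopologicalSpace R] [T2Space R] in
theorem prod_one_sub_mul_prod (z : Rˣ) (N : ℕ) :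
    (∏ i ∈ Finset.range (N + 1), (1 - zC z 1 * X ^ i)) *
      ∏ i ∈ Finset.range N, (1 - zC z (-1) * X ^ (i + 1)) =
      (1 - zC z 1) * ∏ i ∈ Finset.range N, thetaFactor z i := by
  rw [Finset.prod_range_succ', pow_zero, mul_one]
  simp only [thetaFactor, Finset.prod_mul_distrib]
  ring

variable [IsTopologicalRing R]

theorem euler_mul_tsum_sub_theta (z : Rˣ) (g : ℤ → R⟦X⟧) :
    euler R * (∑' k, thetaCoeff R k * (zC z k * g k)) - theta z =
      ∑' k, zC z k * (thetaCoeff R k * (euler R * g k - 1)) := by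
  have hs := summable_thetaCoeff_mul (R := R) fun k => zC z k * g k
  have ht := summable_thetaCoeff_mul (R := R) (zC z)
  rw [theta, ← hs.tsum_mul_left, ← (hs.mul_left (euler R)).tsum_sub ht]
  exact tsum_congr fun k => by ring

/-- The Jacobi triple product identity. -/
theorem theta_eq (z : Rˣ) : theta z = (1 - zC z 1) * euler R * thetaProd z := by
  have h1 := (tendsto_prod_range (X_pow_dvd_thetaFactor z)).const_mul ((1 - zC z 1) * euler R)
  refine tendsto_nhds_unique (tendsto_of_X_pow_dvd fun N => ?_) h1
  have h2 : (1 - zC z 1) * euler R * ∏ i ∈ Finset.range N, thetaFactor z i =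
      euler R * ∑' k : ℤ, thetaCoeff R k * (zC z k * gauss R (N + 1 + N) (k + N)) := by
    rw [← finite_triple_product, prod_one_sub_mul_prod]
    ring
  rw [h2, euler_mul_tsum_sub_theta]
  exact X_pow_dvd_tsum N fun k => (X_pow_dvd_thetaCoeff_mul_gauss N k).mul_left _

end TripleProductLimit

/-! ### Laurent series in z and convolution with the theta coefficients. -/

section LaurentTransform

variable {R : Type*} [CommRing R]

/-- A bi-infinite sequence of power series whose terms tend to zero at least linearly. -/
def Decays (a : ℤ → R⟦X⟧) : Prop := ∃ d : ℕ, ∀ l : ℤ, X ^ (l.natAbs - d) ∣ a l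

theorem Decays.sub {a b : ℤ → R⟦X⟧} (ha : Decays a) (hb : Decays b) :
    Decays fun m => a m - b m := by
  obtain ⟨d, hd⟩ := ha
  obtain ⟨e, he⟩ := hb
  exact ⟨d + e, fun l => ((pow_dvd_pow _ (by omega)).trans (hd l)).sub
    ((pow_dvd_pow _ (by omega)).trans (he l))⟩

theorem Decays.add {a b : ℤ → R⟦X⟧} (ha : Decays a) (hb : Decays b) :
    Decays fun m => a m + b m := by
  obtain ⟨d, hd⟩ := ha
  obtain ⟨e, he⟩ := hb
  exact ⟨d + e, fun l => ((pow_dvd_pow _ (by omega)).trans (hd l)).add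
    ((pow_dvd_pow _ (by omega)).trans (he l))⟩

theorem Decays.const_mul {a : ℤ → R⟦X⟧} (ha : Decays a) (c : R⟦X⟧) :
    Decays fun m => c * a m := by
  obtain ⟨d, hd⟩ := ha
  exact ⟨d, fun l => (hd l).mul_left c⟩

theorem Decays.shift {a : ℤ → R⟦X⟧} (ha : Decays a) : Decays fun m => a (m - 1) := by
  obtain ⟨d, hd⟩ := ha
  exact ⟨d + 1, fun l => (pow_dvd_pow _ (by omega)).trans (hd (l - 1))⟩

theorem decays_single (n : ℤ) (c : R⟦X⟧) : Decays fun m => if m = n then c else 0 := by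
  refine ⟨n.natAbs, fun l => ?_⟩
  beta_reduce
  split_ifs with h
  · rw [h, Nat.sub_self, pow_zero]; exact one_dvd c
  · exact dvd_zero _

theorem finite_natAbs_sub_le (d N : ℕ) : {l : ℤ | l.natAbs - d ≤ N}.Finite :=
  (Set.finite_Icc (-(N + d : ℤ)) (N + d)).subset fun l (hl : l.natAbs - d ≤ N) => by
    simp only [Set.mem_Icc]; omega

variable [TopologicalSpace R]

theorem Decays.summable {a : ℤ → R⟦X⟧} (ha : Decays a) (z : Rˣ) :
    Summable fun m => zC z m * a m := by
  obtain ⟨d, hd⟩ := ha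
  exact summable_of_X_pow_dvd _ (finite_natAbs_sub_le d) fun l => (hd l).mul_left _

/-- The Laurent series `∑ a_m z ^ m`. -/
noncomputable def hat (z : Rˣ) (a : ℤ → R⟦X⟧) : R⟦X⟧ := ∑' m, zC z m * a m

/-- Convolution with the coefficients of the theta series. -/
noncomputable def thetaConv (a : ℤ → R⟦X⟧) (m : ℤ) : R⟦X⟧ := ∑' k, thetaCoeff R k * a (m - k)

variable [IsTopologicalRing R] [T2Space R]

theorem hat_sub (z : Rˣ) {a b : ℤ → R⟦X⟧} (ha : Decays a) (hb : Decays b) :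
    hat z (fun m => a m - b m) = hat z a - hat z b := by
  rw [hat, hat, hat, ← (ha.summable z).tsum_sub (hb.summable z)]
  exact tsum_congr fun m => mul_sub _ _ _

theorem hat_add (z : Rˣ) {a b : ℤ → R⟦X⟧} (ha : Decays a) (hb : Decays b) :
    hat z (fun m => a m + b m) = hat z a + hat z b := by
  rw [hat, hat, hat, ← (ha.summable z).tsum_add (hb.summable z)]
  exact tsum_congr fun m => mul_add _ _ _

theorem hat_const_mul (z : Rˣ) {a : ℤ → R⟦X⟧} (ha : Decays a) (c : R⟦X⟧) :
    hat z (fun m => c * a m) = c * hat z a := by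
  rw [hat, hat, ← (ha.summable z).tsum_mul_left]
  exact tsum_congr fun m => by ring

theorem hat_shift (z : Rˣ) {a : ℤ → R⟦X⟧} (ha : Decays a) :
    hat z (fun m => a (m - 1)) = zC z 1 * hat z a := by
  rw [hat, hat, ← (ha.summable z).tsum_mul_left,
    ← (Equiv.subRight (1 : ℤ)).tsum_eq fun m => zC z 1 * (zC z m * a m)]
  refine tsum_congr fun m => ?_
  rw [Equiv.subRight_apply, ← mul_assoc, ← zC_add, add_sub_cancel]

omit [IsTopologicalRing R] [T2Space R] in
theorem hat_single (z : Rˣ) (n : ℤ) (c : R⟦X⟧) :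
    hat z (fun m => if m = n then c else 0) = zC z n * c := by
  rw [hat, tsum_eq_single n fun m hm => by rw [if_neg hm, mul_zero], if_pos rfl]

omit [IsTopologicalRing R] [T2Space R] in
theorem summable_thetaConv (a : ℤ → R⟦X⟧) (m : ℤ) :
    Summable fun k => thetaCoeff R k * a (m - k) := summable_thetaCoeff_mul _

omit [IsTopologicalRing R] in
theorem Decays.thetaConv {a : ℤ → R⟦X⟧} (ha : Decays a) : Decays (thetaConv a) := by
  obtain ⟨d, hd⟩ := ha
  refine ⟨d + 1, fun l => X_pow_dvd_tsum _ fun k => ?_⟩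
  have h := abs_le_thetaExp k
  refine (pow_dvd_pow (X : R⟦X⟧) (n := thetaExp k + ((l - k).natAbs - d)) ?_).trans ?_
  · rcases le_total k 0 with hk | hk
    · rw [abs_of_nonpos hk] at h; omega
    · rw [abs_of_nonneg hk] at h; omega
  · rw [pow_add]
    exact mul_dvd_mul (Dvd.intro_left _ rfl) (hd _)

theorem thetaConv_sub (a b : ℤ → R⟦X⟧) (m : ℤ) :
    thetaConv (fun m => a m - b m) m = thetaConv a m - thetaConv b m := by
  rw [thetaConv, thetaConv, thetaConv, ← (summable_thetaConv a m).tsum_sub (summable_thetaConv b m)]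
  exact tsum_congr fun k => mul_sub _ _ _

omit [IsTopologicalRing R] [T2Space R] in
theorem thetaConv_shift (a : ℤ → R⟦X⟧) (m : ℤ) :
    thetaConv (fun m => a (m - 1)) m = thetaConv a (m - 1) :=
  tsum_congr fun k => by rw [sub_right_comm]

/-- The change of variables `(m, k) ↦ (k, m - k)`. -/
def convEquiv : ℤ × ℤ ≃ ℤ × ℤ where
  toFun p := (p.2, p.1 - p.2)
  invFun p := (p.1 + p.2, p.1)
  left_inv p := by simp
  right_inv p := by simp

omit [IsTopologicalRing R] [T2Space R] in
theorem Decays.summable_thetaCoeff_prod {a : ℤ → R⟦X⟧} (ha : Decays a) (z : Rˣ) :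
    Summable fun p : ℤ × ℤ => (thetaCoeff R p.1 * zC z p.1) * (zC z p.2 * a p.2) := by
  obtain ⟨d, hd⟩ := ha
  refine summable_of_X_pow_dvd (fun p => thetaExp p.1 + (p.2.natAbs - d)) (fun N => ?_) fun p => ?_
  · exact ((finite_thetaExp_le N).prod (finite_natAbs_sub_le d N)).subset fun p hp => by
      have hp' : thetaExp p.1 + (p.2.natAbs - d) ≤ N := hp
      exact ⟨show thetaExp p.1 ≤ N by omega, show p.2.natAbs - d ≤ N by omega⟩
  · rw [pow_add]
    exact mul_dvd_mul ((Dvd.intro_left _ rfl).mul_right _) ((hd _).mul_left _)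

omit [TopologicalSpace R] [IsTopologicalRing R] [T2Space R] in
theorem convTerm_eq (z : Rˣ) (a : ℤ → R⟦X⟧) (m k : ℤ) :
    (thetaCoeff R k * zC z k) * (zC z (m - k) * a (m - k)) =
      zC z m * (thetaCoeff R k * a (m - k)) := by
  have h : zC z m = zC z k * zC z (m - k) := by rw [← zC_add, add_sub_cancel]
  rw [h]
  ring

/-- The Cauchy product of two Laurent series, with the double sum grouped by total degree in z;
decay of the sequence makes the double family summable. -/
theorem hat_thetaConv (z : Rˣ) {a : ℤ → R⟦X⟧} (ha : Decays a) :
    hat z (thetaConv a) = theta z * hat z a := by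
  have hs := ha.summable_thetaCoeff_prod z
  have h1 : theta z * hat z a =
      ∑' p : ℤ × ℤ, (thetaCoeff R p.1 * zC z p.1) * (zC z p.2 * a p.2) :=
    Summable.tsum_mul_tsum (summable_thetaCoeff_mul (zC z)) (ha.summable z) hs
  have hs' := convEquiv.summable_iff.mpr hs
  have hfib : ∀ m : ℤ, Summable fun k : ℤ =>
      (thetaCoeff R k * zC z k) * (zC z (m - k) * a (m - k)) := fun m =>
    ((summable_thetaConv a m).mul_left (zC z m)).congr fun k => (convTerm_eq z a m k).symm
  rw [h1, ← convEquiv.tsum_eq]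
  refine Eq.trans ?_ (hs'.tsum_prod' hfib).symm
  refine tsum_congr fun m => ?_
  rw [thetaConv, ← (summable_thetaConv a m).tsum_mul_left]
  exact tsum_congr fun k => (convTerm_eq z a m k).symm

end LaurentTransform

/-! ### How a q-recurrence behaves under convolution with theta. -/

section ConvolutionStep

variable {R : Type*} [CommRing R] [TopologicalSpace R] [IsTopologicalRing R] [T2Space R]

/-- A first order recurrence for a bi-infinite sequence is inherited by its convolution with the
theta series. The hypothesis reads `q ^ (-j - e) (A j - p j) = B j`, without negative exponents. -/
theorem thetaConv_step {A B p : ℤ → R⟦X⟧} {e : ℤ}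
    (h : ∀ (j : ℤ) (a b : ℕ), (a : ℤ) = b + j + e → X ^ b * (A j - p j) = X ^ a * B j)
    (m : ℤ) {a b : ℕ} (hab : (a : ℤ) = b + m + e - 1) :
    X ^ b * (thetaConv A m - thetaConv p m) = -(X ^ a * thetaConv B (m - 1)) := by
  rw [← thetaConv_sub, thetaConv, thetaConv,
    ← tsum_thetaCoeff_mul_shift (fun k => B (m - 1 - k)) (-1),
    ← (summable_thetaConv (fun m => A m - p m) m).tsum_mul_left,
    ← (summable_thetaCoeff_mul_shift (fun k => B (m - 1 - k)) (-1)).tsum_mul_left, ← tsum_neg]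
  refine tsum_congr fun k => ?_
  rw [← sub_eq_add_neg, show m - 1 - (k - 1) = m - k by ring]
  -- The hypothesis is used with `b = 0` or `a = 0` according to this sign, so that no negative
  -- power of q occurs; `thetaCoeff_mul_X_pow` then trades that power for a shift of the theta
  -- index.
  rcases le_or_gt 0 (m - k + e) with hj | hj
  · obtain ⟨n, hn⟩ := Int.eq_ofNat_of_zero_le hj
    have h1 := h (m - k) n 0 (by push_cast; omega)
    have h2 := thetaCoeff_mul_X_pow R (k := k) (m := a) (n := b + n) (by push_cast; omega)
    rw [pow_zero, one_mul] at h1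
    rw [h1]
    linear_combination B (m - k) * h2
  · obtain ⟨n, hn⟩ := Int.eq_ofNat_of_zero_le (neg_nonneg.mpr hj.le)
    have h1 := h (m - k) 0 n (by push_cast; omega)
    have h2 := thetaCoeff_mul_X_pow R (k := k) (m := a + n) (n := b) (by push_cast; omega)
    rw [pow_zero, one_mul] at h1
    rw [← h1]
    linear_combination (A (m - k) - p (m - k)) * h2

end ConvolutionStep

/-! ### The Appell-Lerch coefficients under the heat operator. -/

section AppellSequence

variable {R : Type*} [CommRing R] [TopologicalSpace R]

/-- The summands of `appellTail`. -/
noncomputable def appellTerm (c : R⟦X⟧) (m n : ℕ) : R⟦X⟧ :=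
  X ^ ((n + 1) ^ 2 + (n + 1) * m) * ((-1) ^ (n + 1) * ((2 * ((n : R⟦X⟧) + 1) + (m : R⟦X⟧)) ^ 2 + c))

/-- The series `∑_{n ≥ 1} (-1) ^ n ((2 n + m) ^ 2 + c) q ^ (n ^ 2 + n m)`. -/
noncomputable def appellTail (c : R⟦X⟧) (m : ℕ) : R⟦X⟧ := ∑' n, appellTerm c m n

theorem summable_appellTerm (c : R⟦X⟧) (m : ℕ) : Summable (appellTerm c m) :=
  summable_of_X_pow_dvd (fun n => (n + 1) ^ 2 + (n + 1) * m)
    (fun N => (Set.finite_Iic N).subset fun n (hn : (n + 1) ^ 2 + (n + 1) * m ≤ N) => by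
      simp only [Set.mem_Iic]; nlinarith [Nat.zero_le ((n + 1) * m)])
    fun _ => Dvd.intro _ rfl

variable [IsTopologicalRing R] [T2Space R]

/-- Putting n = ν + 1 turns n² + nm into ν² + ν(m + 2) + m + 1 and 2n + m into 2ν + (m + 2), so the
tail reproduces the series at m + 2. -/
theorem appellTail_eq (c : R⟦X⟧) (m : ℕ) :
    appellTail c m = -(X ^ (m + 1) * (((m : R⟦X⟧) + 2) ^ 2 + c + appellTail c (m + 2))) := by
  rw [appellTail, (summable_appellTerm c m).tsum_eq_zero_add, appellTail, mul_add,
    ← (summable_appellTerm c (m + 2)).tsum_mul_left, neg_add, ← tsum_neg]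
  congr 1
  · simp only [appellTerm]; push_cast; ring
  · refine tsum_congr fun n => ?_
    simp only [appellTerm]
    push_cast
    ring

/-- The coefficient sequence of the Appell-Lerch sum under the heat operator. -/
noncomputable def appellSeq (c : R⟦X⟧) (j : ℤ) : R⟦X⟧ :=
  if 0 ≤ j then (j : R⟦X⟧) ^ 2 + c + appellTail c j.toNat else -appellTail c (-j).toNat

omit [IsTopologicalRing R] [T2Space R] in
theorem appellSeq_natCast (c : R⟦X⟧) (j : ℕ) :
    appellSeq c j = (j : R⟦X⟧) ^ 2 + c + appellTail c j := by
  rw [appellSeq, if_pos (by omega), Int.toNat_natCast, Int.cast_natCast]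

-- The normalisation of `c` says precisely that the two branches of the sequence agree at 0.
omit [IsTopologicalRing R] [T2Space R] in
theorem appellSeq_neg {c : R⟦X⟧} (hc : c = -2 * appellTail c 0) (j : ℕ) :
    appellSeq c (-j) = -appellTail c j := by
  cases j with
  | zero =>
    rw [Nat.cast_zero, neg_zero, ← Nat.cast_zero, appellSeq_natCast]
    push_cast
    linear_combination hc
  | succ j => rw [appellSeq, if_neg (by omega), neg_neg, Int.toNat_natCast]

/-- The recurrence q^{-j-1}(A_j - j² - c) = -A_{j+2} holds across 0 as well: for j ≤ -2 it is the
recurrence of the tail read backwards, and at j = -1 it is a symmetry of the sequence. -/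
theorem appellSeq_step {c : R⟦X⟧} (hc : c = -2 * appellTail c 0) (j : ℤ) (a b : ℕ)
    (h : (a : ℤ) = b + j + 1) :
    X ^ b * (appellSeq c j - ((j : R⟦X⟧) ^ 2 + c)) = X ^ a * -appellSeq c (j + 2) := by
  rcases le_or_gt 0 j with hj | hj
  · lift j to ℕ using hj
    have ha : a = b + j + 1 := by omega
    have h2 := appellSeq_natCast c (j + 2)
    rw [Nat.cast_add] at h2
    rw [ha, appellSeq_natCast, show ((2 : ℤ)) = ((2 : ℕ) : ℤ) by rfl, h2, appellTail_eq c j]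
    push_cast
    ring
  · obtain ⟨i, hi⟩ := Int.eq_ofNat_of_zero_le (show 0 ≤ -j - 1 by omega)
    cases i with
    | zero =>
      have hj1 : j = -((1 : ℕ) : ℤ) := by omega
      subst hj1
      have ha : a = b := by omega
      rw [appellSeq_neg hc, show (-((1 : ℕ) : ℤ) + 2) = ((1 : ℕ) : ℤ) by norm_num,
        appellSeq_natCast, ha]
      push_cast
      ring
    | succ i =>
      have hj1 : j = -((i + 2 : ℕ) : ℤ) := by omega
      subst hj1
      have hb : b = a + i + 1 := by omega
      rw [appellSeq_neg hc, show (-((i + 2 : ℕ) : ℤ) + 2) = -((i : ℕ) : ℤ) by push_cast; ring,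
        appellSeq_neg hc, appellTail_eq c i, hb]
      push_cast
      ring

end AppellSequence

/-! ### Moments of the theta series and the double convolution. -/

section ThetaMoments

variable (R : Type*) [CommRing R] [TopologicalSpace R]

/-- The first moment `∑ k (-1) ^ k q ^ (k (k - 1) / 2)` of the theta series. -/
noncomputable def thetaMoment : R⟦X⟧ := ∑' k, thetaCoeff R k * (k : R⟦X⟧)

variable {R}

omit [TopologicalSpace R] in
theorem eq_zero_of_eq_neg [Algebra ℚ R] {x : R⟦X⟧} (h : x = -x) : x = 0 := by
  have h2 : C (algebraMap ℚ R (1 / 2)) * (2 * x) = 0 := by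
    rw [two_mul]; nth_rewrite 1 [h]; simp
  rwa [← mul_assoc, show (2 : R⟦X⟧) = C (algebraMap ℚ R 2) by rw [map_ofNat, map_ofNat], ← map_mul, ← map_mul,
    show (1 / 2 * 2 : ℚ) = 1 by norm_num, map_one, map_one, one_mul] at h2

omit [TopologicalSpace R] in
theorem thetaCoeff_reflect (k : ℤ) : thetaCoeff R (1 - k) = -thetaCoeff R k := by
  have h1 := two_mul_thetaExp k
  have h2 := two_mul_thetaExp (1 - k)
  have h3 : thetaExp (1 - k) = thetaExp k := by
    have : (2 * thetaExp (1 - k) : ℤ) = 2 * thetaExp k := by rw [h1, h2]; ring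
    omega
  rw [thetaCoeff, thetaCoeff, h3, Int.negOnePow_sub, Int.negOnePow_one]
  simp

variable [IsTopologicalRing R] [T2Space R] [Algebra ℚ R]

/-- The reflection k ↦ 1 - k changes the sign of every theta coefficient, so the sum equals its own
negative. -/
theorem tsum_thetaCoeff_mul_eq_zero {a : ℤ → R⟦X⟧} (ha : ∀ k, a (1 - k) = a k) :
    ∑' k, thetaCoeff R k * a k = 0 := by
  refine eq_zero_of_eq_neg ?_
  nth_rewrite 1 [← (Equiv.subLeft (1 : ℤ)).tsum_eq fun k => thetaCoeff R k * a k]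
  rw [← tsum_neg]
  refine tsum_congr fun k => ?_
  rw [Equiv.subLeft_apply, thetaCoeff_reflect, ha, neg_mul]

theorem tsum_thetaCoeff : ∑' k, thetaCoeff R k = 0 := by
  have := tsum_thetaCoeff_mul_eq_zero (R := R) (a := fun _ => 1) fun _ => rfl
  simpa using this

theorem thetaConv_linear (u v : R⟦X⟧) (m : ℤ) :
    thetaConv (fun j => u + v * (j : R⟦X⟧)) m = -(v * thetaMoment R) := by
  have hs1 : Summable fun k => thetaCoeff R k * (u + v * m) := summable_thetaCoeff_mul _
  have hs2 : Summable fun k : ℤ => thetaCoeff R k * (k : R⟦X⟧) := summable_thetaCoeff_mul _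
  have h : ∀ k : ℤ, thetaCoeff R k * (u + v * ((m - k : ℤ) : R⟦X⟧)) =
      thetaCoeff R k * (u + v * m) - v * (thetaCoeff R k * (k : R⟦X⟧)) := fun k => by
    push_cast; ring
  have h0 : Summable (thetaCoeff R) := by
    have := summable_thetaCoeff_mul (R := R) fun _ => 1
    simpa using this
  rw [thetaConv, tsum_congr h, hs1.tsum_sub (hs2.mul_left v), hs2.tsum_mul_left,
    h0.tsum_mul_right, tsum_thetaCoeff, thetaMoment]
  ring

/-- Both 1 and k² - k are invariant under k ↦ 1 - k, so only the first theta moment survives: a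
quadratic becomes linear in `m`, and `c` disappears. -/
theorem thetaConv_quadratic (c : R⟦X⟧) (m : ℤ) :
    thetaConv (fun j => (j : R⟦X⟧) ^ 2 + c) m = (1 - 2 * (m : R⟦X⟧)) * thetaMoment R := by
  have hs1 : Summable fun k : ℤ => thetaCoeff R k * ((k : R⟦X⟧) ^ 2 - (k : R⟦X⟧)) :=
    summable_thetaCoeff_mul _
  have hs2 : Summable fun k : ℤ => thetaCoeff R k * (k : R⟦X⟧) := summable_thetaCoeff_mul _
  have hs3 : Summable (thetaCoeff R) := by
    have := summable_thetaCoeff_mul (R := R) fun _ => 1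
    simpa using this
  have h0 : ∑' k : ℤ, thetaCoeff R k * ((k : R⟦X⟧) ^ 2 - (k : R⟦X⟧)) = 0 :=
    tsum_thetaCoeff_mul_eq_zero fun k => by push_cast; ring
  have h : ∀ k : ℤ, thetaCoeff R k * (((m - k : ℤ) : R⟦X⟧) ^ 2 + c) =
      thetaCoeff R k * ((m : R⟦X⟧) ^ 2 + c) + (1 - 2 * (m : R⟦X⟧)) * (thetaCoeff R k * (k : R⟦X⟧)) +
        thetaCoeff R k * ((k : R⟦X⟧) ^ 2 - (k : R⟦X⟧)) := fun k => by
    push_cast; ring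
  rw [thetaConv, tsum_congr h, ((hs3.mul_right _).add (hs2.mul_left _)).tsum_add hs1,
    (hs3.mul_right _).tsum_add (hs2.mul_left _), hs2.tsum_mul_left, hs3.tsum_mul_right,
    tsum_thetaCoeff, h0, thetaMoment]
  ring

/-- Two convolutions with the theta series turn the Appell sequence into a Lambert series. -/
theorem thetaConv_thetaConv_appellSeq {c : R⟦X⟧} (hc : c = -2 * appellTail c 0) (m : ℤ) {a b : ℕ}
    (hab : (a : ℤ) = b + m - 1) :
    (X ^ b + X ^ a) * thetaConv (thetaConv (appellSeq c)) m = 2 * thetaMoment R ^ 2 * X ^ b := by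
  -- First convolution: the inhomogeneous term drops from degree two to degree one.
  have h1 : ∀ (j : ℤ) (a b : ℕ), (a : ℤ) = b + j + 0 →
      X ^ b * (thetaConv (appellSeq c) j - (thetaMoment R + -2 * thetaMoment R * (j : R⟦X⟧))) =
        X ^ a * thetaConv (appellSeq c) (j + 1) := by
    intro j a b h
    have h2 := thetaConv_step (appellSeq_step hc) j (a := a) (b := b) (by omega)
    rw [thetaConv_quadratic] at h2
    have h3 : thetaConv (fun j => -appellSeq c (j + 2)) (j - 1) =
        -thetaConv (appellSeq c) (j + 1) := by
      rw [thetaConv, thetaConv, ← tsum_neg]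
      refine tsum_congr fun k => ?_
      rw [show j - 1 - k + 2 = j + 1 - k by ring]
      ring
    rw [h3] at h2
    linear_combination h2
  -- Second convolution: the inhomogeneous term becomes constant and the shift disappears, so both
  -- sides contain the same unknown and the recurrence is an algebraic equation.
  have h2 := thetaConv_step h1 m (a := a) (b := b) (by omega)
  have h3 : thetaConv (fun j => thetaConv (appellSeq c) (j + 1)) (m - 1) =
      thetaConv (thetaConv (appellSeq c)) m :=
    tsum_congr fun k => by beta_reduce; rw [show m - 1 - k + 1 = m - k by ring]
  rw [h3, thetaConv_linear] at h2
  linear_combination h2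

end ThetaMoments

/-! ### Odd extensions and backward differences. -/

section OddExtension

variable {R : Type*} [CommRing R]

/-- The odd bi-infinite sequence extending a sequence indexed by the positive integers. -/
def oddExt (a : ℕ → R⟦X⟧) (j : ℤ) : R⟦X⟧ :=
  if 0 < j then a j.toNat else if j < 0 then -a (-j).toNat else 0

theorem oddExt_natCast (a : ℕ → R⟦X⟧) {j : ℕ} (hj : 0 < j) : oddExt a j = a j := by
  rw [oddExt, if_pos (by omega), Int.toNat_natCast]

theorem oddExt_neg (a : ℕ → R⟦X⟧) {j : ℕ} (hj : 0 < j) : oddExt a (-j) = -a j := by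
  rw [oddExt, if_neg (by omega), if_pos (by omega), neg_neg, Int.toNat_natCast]

theorem oddExt_zero (a : ℕ → R⟦X⟧) : oddExt a 0 = 0 := by simp [oddExt]

theorem decays_oddExt {a : ℕ → R⟦X⟧} (ha : ∀ m, X ^ m ∣ a m) : Decays (oddExt a) := by
  refine ⟨0, fun l => ?_⟩
  rcases lt_trichotomy l 0 with h | h | h
  · obtain ⟨j, hj⟩ := Int.eq_ofNat_of_zero_le (show 0 ≤ -l by omega)
    rw [show l = -(j : ℤ) by omega, oddExt_neg a (by omega)]
    exact (by simpa using (ha j))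
  · rw [h, oddExt_zero]; exact dvd_zero _
  · obtain ⟨j, rfl⟩ := Int.eq_ofNat_of_zero_le h.le
    rw [oddExt_natCast a (by omega)]
    exact ha j

/-- The backward difference of a bi-infinite sequence. -/
def bdiff (a : ℤ → R⟦X⟧) (m : ℤ) : R⟦X⟧ := a m - a (m - 1)

theorem Decays.bdiff {a : ℤ → R⟦X⟧} (ha : Decays a) : Decays (bdiff a) := ha.sub ha.shift

end OddExtension

/-! ### Making the sequences decay, and the elementary form of θ² times the Appell-Lerch sum. -/

section Differences

variable {R : Type*} [CommRing R] [TopologicalSpace R] [IsTopologicalRing R] [T2Space R]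

theorem hat_bdiff (z : Rˣ) {a : ℤ → R⟦X⟧} (ha : Decays a) :
    hat z (bdiff a) = (1 - zC z 1) * hat z a := by
  rw [show bdiff a = fun m => a m - a (m - 1) from rfl, hat_sub z ha ha.shift, hat_shift z ha]
  ring

theorem thetaConv_bdiff (a : ℤ → R⟦X⟧) : thetaConv (bdiff a) = bdiff (thetaConv a) := by
  funext m
  rw [show bdiff a = fun m => a m - a (m - 1) from rfl, thetaConv_sub, thetaConv_shift, bdiff]

omit [IsTopologicalRing R] in
theorem X_pow_dvd_appellTail (c : R⟦X⟧) (m : ℕ) : X ^ m ∣ appellTail c m :=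
  X_pow_dvd_tsum m fun n => Dvd.dvd.mul_right (pow_dvd_pow _ (by nlinarith)) _

-- For j > 0 the sequence contains j² + c, which does not decay. The third difference annihilates
-- it, up to boundary terms at 0, 1, 2, 3; `c'` is the value of the sequence at 0.
omit [IsTopologicalRing R] [T2Space R] in
theorem bdiff3_appellSeq {c : R⟦X⟧} {c' : R⟦X⟧} (hc : c = 2 * c') (hc' : c' = -appellTail c 0)
    (m : ℤ) :
    bdiff (bdiff (bdiff (appellSeq c))) m =
      bdiff (bdiff (bdiff (oddExt (appellTail c)))) m +
        ((if m = 0 then c' else 0) + (if m = 1 then 1 - c' else 0) +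
          (if m = 2 then 1 - c' else 0) + (if m = 3 then c' else 0)) := by
  have hA : ∀ j, appellSeq c j = oddExt (appellTail c) j +
      (if 0 < j then (j : R⟦X⟧) ^ 2 + c else if j = 0 then c' else 0) := by
    intro j
    rcases lt_trichotomy j 0 with h | h | h
    · simp [appellSeq, oddExt, h, h.not_ge, h.not_gt, h.ne]
    · subst h
      simp [appellSeq, oddExt]
      linear_combination hc + hc'
    · simp [appellSeq, oddExt, h, h.le]; ring
  simp only [bdiff, hA]
  rcases lt_or_ge m 0 with h | h
  · simp only [show ¬ 0 < m by omega, show ¬ 0 < m - 1 by omega, show ¬ 0 < m - 1 - 1 by omega,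
      show ¬ 0 < m - 1 - 1 - 1 by omega, show ¬ m = 0 by omega, show ¬ m - 1 = 0 by omega,
      show ¬ m - 1 - 1 = 0 by omega, show ¬ m - 1 - 1 - 1 = 0 by omega, show ¬ m = 1 by omega,
      show ¬ m = 2 by omega, show ¬ m = 3 by omega, if_false]
    ring
  · rcases lt_or_ge m 4 with h4 | h4
    · interval_cases m <;> simp <;> rw [hc] <;> ring
    · simp only [show 0 < m by omega, show 0 < m - 1 by omega, show 0 < m - 1 - 1 by omega,
        show 0 < m - 1 - 1 - 1 by omega, show ¬ m = 0 by omega, show ¬ m = 1 by omega,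
        show ¬ m = 2 by omega, show ¬ m = 3 by omega, if_false, if_true]
      push_cast
      ring

/-- The Lambert series `q ^ j / (1 + q ^ j)`. -/
noncomputable def lambertW (j : ℕ) : R⟦X⟧ := -∑' n : ℕ, (-X ^ j) ^ (n + 1)

theorem one_add_mul_lambertW {j : ℕ} (hj : 0 < j) :
    (1 + X ^ j) * (lambertW j : R⟦X⟧) = X ^ j := by
  have := geom_tsum (R := R) (y := -X ^ j) (by simp [hj.ne'])
  rw [lambertW]
  linear_combination -this

omit [IsTopologicalRing R] in
theorem X_pow_dvd_lambertW (j : ℕ) : X ^ j ∣ (lambertW j : R⟦X⟧) := by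
  rw [lambertW, dvd_neg]
  refine X_pow_dvd_tsum j fun n => ?_
  rw [pow_succ]
  exact Dvd.dvd.mul_left ((dvd_refl _).neg_right) _

/-- Twice the Lambert sequence `1 / (1 + q ^ (m - 1))`. -/
noncomputable def lambertSeq (m : ℤ) : R⟦X⟧ :=
  -2 * oddExt lambertW (m - 1) + if 0 < m - 1 then 2 else if m - 1 = 0 then 1 else 0

theorem mul_lambertSeq (m : ℤ) {a b : ℕ} (hab : (a : ℤ) = b + m - 1) (h0 : a = 0 ∨ b = 0) :
    (X ^ b + X ^ a) * (lambertSeq m : R⟦X⟧) = 2 * X ^ b := by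
  rcases lt_trichotomy (m - 1) 0 with h | h | h
  · have ha : a = 0 := by omega
    have hm : m - 1 = -(b : ℤ) := by omega
    rw [lambertSeq, hm, oddExt_neg _ (by omega), if_neg (by omega), if_neg (by omega), ha]
    linear_combination 2 * one_add_mul_lambertW (R := R) (show 0 < b by omega)
  · have ha : a = 0 := by omega
    have hb : b = 0 := by omega
    rw [lambertSeq, h, oddExt_zero, ha, hb]
    simp; ring
  · have hb : b = 0 := by omega
    have hm : m - 1 = (a : ℤ) := by omega
    rw [lambertSeq, hm, oddExt_natCast _ (by omega), if_pos (by omega), hb]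
    linear_combination -2 * one_add_mul_lambertW (R := R) (show 0 < a by omega)

theorem thetaConv2_appellSeq [Algebra ℚ R] {c : R⟦X⟧} (hc : c = -2 * appellTail c 0) (m : ℤ) :
    thetaConv (thetaConv (appellSeq c)) m = thetaMoment R ^ 2 * lambertSeq m := by
  obtain ⟨a, b, hab, h0⟩ : ∃ a b : ℕ, (a : ℤ) = b + m - 1 ∧ (a = 0 ∨ b = 0) := by
    rcases le_total 0 (m - 1) with h | h
    · exact ⟨(m - 1).toNat, 0, by omega, Or.inr rfl⟩
    · exact ⟨0, (-(m - 1)).toNat, by omega, Or.inl rfl⟩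
  have h1 := thetaConv_thetaConv_appellSeq hc m hab
  have h2 := mul_lambertSeq (R := R) m hab h0
  -- When a = b = 0 the constant term is 2, which is invertible because `R` is a ℚ-algebra.
  have h3 : IsUnit (X ^ b + X ^ a : R⟦X⟧) := by
    rw [isUnit_iff_constantCoeff, map_add, map_pow, map_pow, constantCoeff_X]
    rcases Nat.eq_zero_or_pos a with ha | ha <;> rcases Nat.eq_zero_or_pos b with hb | hb
    · rw [ha, hb, pow_zero, one_add_one_eq_two, show (2 : R) = algebraMap ℚ R 2 by rw [map_ofNat]]
      exact (IsUnit.mk0 (2 : ℚ) two_ne_zero).map _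
    · rw [ha, zero_pow hb.ne', pow_zero, zero_add]; exact isUnit_one
    · rw [hb, zero_pow ha.ne', pow_zero, add_zero]; exact isUnit_one
    · omega
  refine h3.mul_left_cancel ?_
  linear_combination h1 - thetaMoment R ^ 2 * h2

omit [IsTopologicalRing R] [T2Space R] in
theorem bdiff_lambertSeq (m : ℤ) :
    bdiff (lambertSeq (R := R)) m = -2 * bdiff (fun m => oddExt (lambertW (R := R)) (m - 1)) m +
      ((if m = 1 then 1 else 0) + (if m = 2 then 1 else 0)) := by
  simp only [bdiff, lambertSeq]
  rcases lt_or_ge m 1 with h | h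
  · simp only [show ¬ 0 < m - 1 by omega, show ¬ 0 < m - 1 - 1 by omega, show ¬ m - 1 = 0 by omega,
      show ¬ m - 1 - 1 = 0 by omega, show ¬ m = 1 by omega, show ¬ m = 2 by omega, if_false]
    ring
  · rcases lt_or_ge m 3 with h4 | h4
    · interval_cases m <;> simp <;> ring
    · simp only [show 0 < m - 1 by omega, show 0 < m - 1 - 1 by omega, show ¬ m = 1 by omega,
        show ¬ m = 2 by omega, if_false, if_true]
      ring

/-- The heat operator applied to the Appell-Lerch sum, times the square of the theta function, is
an elementary Lambert series. -/
theorem theta_sq_mul_hat [Algebra ℚ R] (z : Rˣ) {c c' : R⟦X⟧} (hc : c = 2 * c')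
    (hc' : c' = -appellTail c 0) :
    theta z ^ 2 * ((1 - zC z 1) ^ 3 * hat z (oddExt (appellTail c)) + c' + zC z 1 * (1 - c') +
        zC z 2 * (1 - c') + zC z 3 * c') =
      thetaMoment R ^ 2 * (1 - zC z 1) ^ 2 *
        (zC z 1 + zC z 2 - 2 * zC z 1 * (1 - zC z 1) * hat z (oddExt lambertW)) := by
  have hd := decays_oddExt (X_pow_dvd_appellTail c)
  have hw := decays_oddExt (X_pow_dvd_lambertW (R := R))
  have hf := (((decays_single 0 c').add (decays_single 1 (1 - c'))).add
    (decays_single 2 (1 - c'))).add (decays_single 3 c')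
  have hD : Decays (bdiff (bdiff (bdiff (appellSeq c)))) := by
    rw [funext (bdiff3_appellSeq hc hc')]
    exact hd.bdiff.bdiff.bdiff.add hf
  have h1 : hat z (bdiff (bdiff (bdiff (appellSeq c)))) =
      (1 - zC z 1) ^ 3 * hat z (oddExt (appellTail c)) + c' + zC z 1 * (1 - c') +
        zC z 2 * (1 - c') + zC z 3 * c' := by
    rw [funext (bdiff3_appellSeq hc hc'), hat_add z hd.bdiff.bdiff.bdiff hf,
      hat_bdiff z hd.bdiff.bdiff, hat_bdiff z hd.bdiff, hat_bdiff z hd,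
      hat_add z (((decays_single 0 c').add (decays_single 1 (1 - c'))).add
        (decays_single 2 (1 - c'))) (decays_single 3 c'),
      hat_add z ((decays_single 0 c').add (decays_single 1 (1 - c'))) (decays_single 2 (1 - c')),
      hat_add z (decays_single 0 c') (decays_single 1 (1 - c')), hat_single, hat_single, hat_single,
      hat_single, zC_zero]
    ring
  -- Differences commute with the convolutions. The innermost one is kept on the Lambert sequence,
  -- which needs it to decay; the outer two yield (1 - z)².
  have h2 : thetaConv (thetaConv (bdiff (bdiff (bdiff (appellSeq c))))) =
      bdiff (bdiff fun m => thetaMoment R ^ 2 * bdiff lambertSeq m) := by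
    rw [thetaConv_bdiff, thetaConv_bdiff, thetaConv_bdiff, thetaConv_bdiff, thetaConv_bdiff,
      thetaConv_bdiff]
    congr 2
    funext m
    rw [bdiff, thetaConv2_appellSeq (by linear_combination hc + 2 * hc'), thetaConv2_appellSeq
      (by linear_combination hc + 2 * hc'), bdiff]
    ring
  have hg := (decays_single (R := R) 1 1).add (decays_single 2 1)
  have hL : Decays (bdiff (lambertSeq (R := R))) := by
    rw [funext bdiff_lambertSeq]
    exact (hw.shift.bdiff.const_mul _).add hg
  have h3 : hat z (bdiff lambertSeq) =
      zC z 1 + zC z 2 - 2 * zC z 1 * (1 - zC z 1) * hat z (oddExt lambertW) := by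
    rw [funext bdiff_lambertSeq, hat_add z (hw.shift.bdiff.const_mul _) hg,
      hat_const_mul z hw.shift.bdiff, hat_bdiff z hw.shift, hat_shift z hw,
      hat_add z (decays_single 1 1) (decays_single 2 1), hat_single, hat_single]
    ring
  rw [← h1, ← h3, sq, mul_assoc, ← hat_thetaConv z hD, ← hat_thetaConv z hD.thetaConv, h2,
    hat_bdiff z (hL.const_mul _).bdiff, hat_bdiff z (hL.const_mul _), hat_const_mul z hL]
  ring

end Differences

/-! ### Double Lambert series. -/

section Lambert

variable {R : Type*} [CommRing R]

/-- The Lambert series `∑_{a, b ≥ 1} c(a, b) q ^ (a b)`. -/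
def lambert (c : ℕ → ℕ → R) : R⟦X⟧ := mk fun n => ∑ x ∈ n.divisorsAntidiagonal, c x.1 x.2

theorem coeff_lambert (c : ℕ → ℕ → R) (n : ℕ) :
    coeff n (lambert c) = ∑ x ∈ n.divisorsAntidiagonal, c x.1 x.2 := coeff_mk _ _

theorem lambert_sub (c c' : ℕ → ℕ → R) :
    lambert (fun a b => c a b - c' a b) = lambert c - lambert c' := by
  ext n; simp [coeff_lambert, Finset.sum_sub_distrib]

theorem lambert_const_mul (r : R) (c : ℕ → ℕ → R) :
    lambert (fun a b => r * c a b) = C r * lambert c := by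
  ext n; simp [coeff_lambert, Finset.mul_sum]

theorem lambert_swap (c : ℕ → ℕ → R) : lambert (fun a b => c b a) = lambert c := by
  ext n
  rw [coeff_lambert, coeff_lambert]
  exact Finset.sum_equiv (Equiv.prodComm ℕ ℕ) (fun x => by
    simp [Nat.mem_divisorsAntidiagonal]) fun x _ => rfl

theorem qD_lambert (c : ℕ → ℕ → R) : qD (lambert c) = lambert fun a b => a * b * c a b := by
  ext n
  rw [coeff_qD, coeff_lambert, coeff_lambert, Finset.mul_sum]
  refine Finset.sum_congr rfl fun x hx => ?_
  rw [← (Nat.mem_divisorsAntidiagonal.mp hx).1]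
  push_cast
  ring

theorem constantCoeff_lambert (c : ℕ → ℕ → R) : constantCoeff (lambert c) = 0 := by
  rw [← coeff_zero_eq_constantCoeff_apply, coeff_lambert]; simp

variable [TopologicalSpace R]

theorem summable_lambert (c : ℕ → ℕ → R) :
    Summable fun p : ℕ × ℕ => C (c (p.1 + 1) (p.2 + 1)) * X ^ ((p.1 + 1) * (p.2 + 1)) :=
  summable_of_X_pow_dvd (fun p => (p.1 + 1) * (p.2 + 1))
    (fun N => (Set.finite_Iic ((N, N) : ℕ × ℕ)).subset fun p (hp : (p.1 + 1) * (p.2 + 1) ≤ N) => by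
      constructor <;> simp <;> nlinarith [Nat.zero_le (p.1 * p.2)])
    fun _ => Dvd.intro_left _ rfl

variable [T2Space R]

theorem tsum_lambert (c : ℕ → ℕ → R) :
    ∑' p : ℕ × ℕ, C (c (p.1 + 1) (p.2 + 1)) * X ^ ((p.1 + 1) * (p.2 + 1)) = lambert c := by
  ext n
  rw [coeff_tsum (summable_lambert c), coeff_lambert]
  let s : Finset (ℕ × ℕ) := (Finset.range (n + 1)) ×ˢ (Finset.range (n + 1))
  rw [tsum_eq_sum (s := s)]
  · have h : ∀ p : ℕ × ℕ, coeff n (C (c (p.1 + 1) (p.2 + 1)) * X ^ ((p.1 + 1) * (p.2 + 1))) =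
        if (p.1 + 1) * (p.2 + 1) = n then c (p.1 + 1) (p.2 + 1) else 0 := by
      intro p
      rw [coeff_C_mul, coeff_X_pow]
      split_ifs with h1 h2 h2
      · rw [mul_one]
      · exact absurd h1.symm h2
      · exact absurd h2.symm h1
      · rw [mul_zero]
    simp only [h]
    rw [← Finset.sum_filter]
    refine Finset.sum_bij (fun p _ => (p.1 + 1, p.2 + 1)) ?_ ?_ ?_ ?_
    · intro p hp
      rw [Finset.mem_filter] at hp
      rw [Nat.mem_divisorsAntidiagonal]
      refine ⟨hp.2, ?_⟩
      rw [← hp.2]; positivity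
    · rintro ⟨a, b⟩ _ ⟨a', b'⟩ _ h
      simpa using h
    · rintro ⟨a, b⟩ hx
      have h1 := Nat.left_ne_zero_of_mem_divisorsAntidiagonal hx
      have h2 := Nat.right_ne_zero_of_mem_divisorsAntidiagonal hx
      have h3 := (Nat.mem_divisorsAntidiagonal.mp hx).1
      obtain ⟨a, rfl⟩ := Nat.exists_eq_succ_of_ne_zero h1
      obtain ⟨b, rfl⟩ := Nat.exists_eq_succ_of_ne_zero h2
      refine ⟨(a, b), ?_, rfl⟩
      simp only [Nat.succ_eq_add_one] at h3
      simp only [Finset.mem_filter, s, Finset.mem_product, Finset.mem_range]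
      refine ⟨⟨?_, ?_⟩, h3⟩ <;> nlinarith [Nat.zero_le (a * b)]
    · intro p _; rfl
  · intro p hp
    rw [coeff_C_mul, coeff_X_pow, if_neg, mul_zero]
    intro h
    apply hp
    simp only [s, Finset.mem_product, Finset.mem_range]
    constructor <;> nlinarith [Nat.zero_le (p.1 * p.2)]

variable [IsTopologicalRing R]

theorem tsum_tsum_lambert (c : ℕ → ℕ → R) :
    ∑' a : ℕ, ∑' b : ℕ, C (c (a + 1) (b + 1)) * X ^ ((a + 1) * (b + 1)) = lambert c := by
  rw [← tsum_lambert, (summable_lambert c).tsum_prod' fun a => ?_]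
  exact summable_of_X_pow_dvd (fun b => (a + 1) * (b + 1))
    (fun N => (Set.finite_Iic N).subset fun b (hb : (a + 1) * (b + 1) ≤ N) => by
      simp only [Set.mem_Iic]; nlinarith [Nat.zero_le (a * b)])
    fun _ => Dvd.intro_left _ rfl

end Lambert

/-! ### Derivations acting on the coefficients. -/

section CoefficientDerivation

variable {R : Type*} [CommRing R]

/-- The coefficientwise application of a derivation to formal power series. -/
noncomputable def coeffDerFun (d : Derivation ℤ R R) (f : R⟦X⟧) : R⟦X⟧ := mk fun n => d (coeff n f)

theorem coeff_coeffDerFun (d : Derivation ℤ R R) (f : R⟦X⟧) (n : ℕ) :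
    coeff n (coeffDerFun d f) = d (coeff n f) := coeff_mk _ _

theorem coeffDerFun_mul (d : Derivation ℤ R R) (f g : R⟦X⟧) :
    coeffDerFun d (f * g) = f * coeffDerFun d g + g * coeffDerFun d f := by
  ext n
  rw [map_add, mul_comm g, coeff_coeffDerFun, coeff_mul, coeff_mul, coeff_mul, map_sum,
    ← Finset.sum_add_distrib]
  refine Finset.sum_congr rfl fun p _ => ?_
  rw [coeff_coeffDerFun, coeff_coeffDerFun, Derivation.leibniz, smul_eq_mul, smul_eq_mul,
    mul_comm (coeff p.2 g)]

/-- The extension of a derivation of the coefficient ring to formal power series. -/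
noncomputable def coeffDer (d : Derivation ℤ R R) : Derivation ℤ R⟦X⟧ R⟦X⟧ :=
  Derivation.mk' (AddMonoidHom.toIntLinearMap
    { toFun := coeffDerFun d
      map_zero' := by ext n; simp [coeff_coeffDerFun]
      map_add' := fun f g => by ext n; simp [coeff_coeffDerFun] }) (coeffDerFun_mul d)

theorem coeff_coeffDer (d : Derivation ℤ R R) (f : R⟦X⟧) (n : ℕ) :
    coeff n (coeffDer d f) = d (coeff n f) := coeff_coeffDerFun d f n

theorem coeffDer_C (d : Derivation ℤ R R) (r : R) : coeffDer d (C r) = C (d r) := by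
  ext n
  rw [coeff_coeffDer, coeff_C, coeff_C]
  split_ifs <;> simp

theorem coeffDer_X_pow (d : Derivation ℤ R R) (n : ℕ) : coeffDer d ((X : R⟦X⟧) ^ n) = 0 := by
  ext m
  rw [coeff_coeffDer, coeff_X_pow]
  split_ifs <;> simp

theorem continuous_coeffDer [TopologicalSpace R] {d : Derivation ℤ R R} (hd : Continuous d) :
    Continuous (coeffDer d) := by
  refine continuous_iff_continuousAt.mpr fun f => ?_
  rw [ContinuousAt, WithPiTopology.tendsto_iff_coeff_tendsto]
  intro n
  simp_rw [coeff_coeffDer]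
  exact (hd.comp (WithPiTopology.continuous_coeff R n)).tendsto f

theorem derivation_unit_zpow {d : Derivation ℤ R R} {z : Rˣ} (hz : d z = z) (k : ℤ) :
    d ((z ^ k : Rˣ) : R) = k * ((z ^ k : Rˣ) : R) := by
  have hnat : ∀ n : ℕ, d ((z ^ n : Rˣ) : R) = n * ((z ^ n : Rˣ) : R) := by
    intro n
    rw [Units.val_pow_eq_pow_val, Derivation.leibniz_pow, hz]
    cases n with
    | zero => simp
    | succ n => simp only [Nat.add_sub_cancel, smul_eq_mul, nsmul_eq_mul]; ring
  obtain ⟨n, rfl | rfl⟩ := k.eq_nat_or_neg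
  · rw [zpow_natCast, hnat]; simp
  · have h1 : ((z ^ n : Rˣ) : R) * ((z ^ (-(n : ℤ)) : Rˣ) : R) = 1 := by
      rw [← Units.val_mul, ← zpow_natCast, ← zpow_add, add_neg_cancel, zpow_zero, Units.val_one]
    -- Differentiating z^n z^{-n} = 1 determines the derivative of the negative power.
    have h2 := congrArg d h1
    rw [Derivation.leibniz, hnat, d.map_one_eq_zero] at h2
    simp only [smul_eq_mul] at h2
    refine (Units.isUnit (z ^ n)).mul_left_cancel ?_
    push_cast at h1 h2 ⊢
    linear_combination h2

theorem coeffDer_zC {d : Derivation ℤ R R} {z : Rˣ} (hz : d z = z) (k : ℤ) :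
    coeffDer d (zC z k) = k * zC z k := by
  rw [zC, coeffDer_C, derivation_unit_zpow hz, map_mul]
  simp

theorem qD_zC (z : Rˣ) (k : ℤ) : qD (zC z k) = 0 := qD_C _

end CoefficientDerivation

/-! ### Logarithmic derivatives of the theta product and the heat equation. -/

section LogDerivative

variable {R : Type*} [CommRing R]

/-- The power `z ^ k` in the coefficient ring. -/
def zpw (z : Rˣ) (k : ℤ) : R := ((z ^ k : Rˣ) : R)

theorem C_zpw (z : Rˣ) (k : ℤ) : C (zpw z k) = zC z k := rfl

theorem zC_pow (z : Rˣ) (k : ℤ) (n : ℕ) : zC z k ^ n = zC z (k * n) := by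
  rw [zC, zC, ← map_pow, ← Units.val_pow_eq_pow_val, zpow_mul, zpow_natCast]

/-- The Lambert series `∑ (z ^ b - z ^ (-b)) q ^ (a b)`. -/
noncomputable def lam (z : Rˣ) : R⟦X⟧ := lambert fun _ b => zpw z b - zpw z (-b)

/-- The Lambert series `∑ b (z ^ b + z ^ (-b)) q ^ (a b)`. -/
noncomputable def lamDeriv (z : Rˣ) : R⟦X⟧ := lambert fun _ b => b * (zpw z b + zpw z (-b))

/-- The Lambert series `∑ a (z ^ b + z ^ (-b)) q ^ (a b)`. -/
noncomputable def lamQ (z : Rˣ) : R⟦X⟧ := lambert fun a b => a * (zpw z b + zpw z (-b))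

variable (R) in
/-- The Eisenstein type series `∑ b ^ k q ^ (a b)`. -/
def eis (k : ℕ) : R⟦X⟧ := lambert fun _ b => (b : R) ^ k

theorem coeffDer_lam {d : Derivation ℤ R R} {z : Rˣ} (hz : d z = z) :
    coeffDer d (lam z) = lamDeriv z := by
  ext n
  rw [coeff_coeffDer, lam, lamDeriv, coeff_lambert, coeff_lambert, map_sum]
  refine Finset.sum_congr rfl fun x _ => ?_
  rw [map_sub, zpw, zpw, derivation_unit_zpow hz, derivation_unit_zpow hz]
  push_cast
  ring

variable [TopologicalSpace R] [T2Space R]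

omit [T2Space R] in
theorem geom_zC (z : Rˣ) (s : ℤ) (i : ℕ) :
    ∑' j : ℕ, (zC z s * X ^ (i + 1)) ^ (j + 1) =
      ∑' j : ℕ, C (zpw z (s * (j + 1 : ℕ))) * X ^ ((i + 1) * (j + 1)) :=
  tsum_congr fun j => by rw [mul_pow, zC_pow, ← pow_mul, C_zpw]

omit [T2Space R] in
theorem summable_geom_zC (z : Rˣ) (s : ℤ) (i : ℕ) :
    Summable fun j : ℕ => C (zpw z (s * (j + 1 : ℕ))) * X ^ ((i + 1) * (j + 1)) :=
  summable_of_X_pow_dvd (fun j => (i + 1) * (j + 1))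
    (fun N => (Set.finite_Iic N).subset fun j (hj : (i + 1) * (j + 1) ≤ N) => by
      simp only [Set.mem_Iic]; nlinarith [Nat.zero_le (i * j)])
    fun _ => Dvd.intro_left _ rfl

theorem X_pow_dvd_geom (y : R⟦X⟧) {i : ℕ} (h : X ^ (i + 1) ∣ y) :
    X ^ (i + 1) ∣ ∑' j : ℕ, y ^ (j + 1) :=
  X_pow_dvd_tsum _ fun j => by rw [pow_succ]; exact h.mul_left _

variable [IsTopologicalRing R]

theorem derivation_thetaFactor (δ : Derivation ℤ R⟦X⟧ R⟦X⟧) (z : Rˣ) (i : ℕ) {u v : R⟦X⟧}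
    (hu : δ (zC z 1 * X ^ (i + 1)) = u * (zC z 1 * X ^ (i + 1)))
    (hv : δ (zC z (-1) * X ^ (i + 1)) = v * (zC z (-1) * X ^ (i + 1))) :
    δ (thetaFactor z i) = thetaFactor z i *
      (-(u * ∑' j : ℕ, (zC z 1 * X ^ (i + 1)) ^ (j + 1) +
        v * ∑' j : ℕ, (zC z (-1) * X ^ (i + 1)) ^ (j + 1))) := by
  have h1 := geom_tsum (R := R) (y := zC z 1 * X ^ (i + 1)) (by simp)
  have h2 := geom_tsum (R := R) (y := zC z (-1) * X ^ (i + 1)) (by simp)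
  rw [thetaFactor, Derivation.leibniz, map_sub, map_sub, δ.map_one_eq_zero, hu, hv, smul_eq_mul,
    smul_eq_mul]
  linear_combination (1 - zC z (-1) * X ^ (i + 1)) * u * h1 + (1 - zC z 1 * X ^ (i + 1)) * v * h2

theorem qD_thetaProd (z : Rˣ) : qD (thetaProd z) = -(thetaProd z * lamQ z) := by
  have h := derivation_tprod (δ := (qD (R := R)).restrictScalars ℤ) continuous_qD
    (X_pow_dvd_thetaFactor z) (g := fun i =>
      -(((i + 1 : ℕ) : R⟦X⟧) * ∑' j : ℕ, (zC z 1 * X ^ (i + 1)) ^ (j + 1) +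
        ((i + 1 : ℕ) : R⟦X⟧) * ∑' j : ℕ, (zC z (-1) * X ^ (i + 1)) ^ (j + 1)))
    (fun i => (((X_pow_dvd_geom _ (Dvd.intro_left _ rfl)).mul_left _).add
        ((X_pow_dvd_geom _ (Dvd.intro_left _ rfl)).mul_left _)).neg_right)
    (fun i => derivation_thetaFactor _ z i
      (by change qD _ = _; rw [Derivation.leibniz, qD_zC, qD_X_pow]; simp only [smul_eq_mul]; ring)
      (by change qD _ = _; rw [Derivation.leibniz, qD_zC, qD_X_pow]; simp only [smul_eq_mul]; ring))
  change qD (thetaProd z) = thetaProd z * _ at h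
  rw [h, tsum_neg, mul_neg, lamQ, ← tsum_tsum_lambert]
  congr 2
  refine tsum_congr fun i => ?_
  rw [geom_zC, geom_zC, ← (summable_geom_zC z 1 i).tsum_mul_left,
    ← (summable_geom_zC z (-1) i).tsum_mul_left,
    ← ((summable_geom_zC z 1 i).mul_left _).tsum_add ((summable_geom_zC z (-1) i).mul_left _)]
  refine tsum_congr fun j => ?_
  rw [map_mul, map_add, map_natCast, one_mul, neg_one_mul]
  ring

theorem coeffDer_thetaProd {d : Derivation ℤ R R} (hd : Continuous d) {z : Rˣ} (hz : d z = z) :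
    coeffDer d (thetaProd z) = -(thetaProd z * lam z) := by
  have h := derivation_tprod (δ := coeffDer d) (continuous_coeffDer hd)
    (X_pow_dvd_thetaFactor z) (g := fun i =>
      -(1 * ∑' j : ℕ, (zC z 1 * X ^ (i + 1)) ^ (j + 1) +
        -1 * ∑' j : ℕ, (zC z (-1) * X ^ (i + 1)) ^ (j + 1)))
    (fun i => (((X_pow_dvd_geom _ (Dvd.intro_left _ rfl)).mul_left _).add
        ((X_pow_dvd_geom _ (Dvd.intro_left _ rfl)).mul_left _)).neg_right)
    (fun i => derivation_thetaFactor _ z i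
      (by rw [Derivation.leibniz, coeffDer_zC hz, coeffDer_X_pow]; simp only [smul_eq_mul]; push_cast; ring)
      (by rw [Derivation.leibniz, coeffDer_zC hz, coeffDer_X_pow]; simp only [smul_eq_mul]; push_cast; ring))
  change coeffDer d (thetaProd z) = thetaProd z * _ at h
  rw [h, tsum_neg, mul_neg, lam, ← tsum_tsum_lambert]
  congr 2
  refine tsum_congr fun i => ?_
  rw [geom_zC, geom_zC, ← (summable_geom_zC z 1 i).tsum_mul_left,
    ← (summable_geom_zC z (-1) i).tsum_mul_left,
    ← ((summable_geom_zC z 1 i).mul_left _).tsum_add ((summable_geom_zC z (-1) i).mul_left _)]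
  refine tsum_congr fun j => ?_
  simp only [map_sub, one_mul, neg_one_mul]
  ring

theorem qD_euler : qD (euler R) = -(euler R * eis R 1) := by
  have h := derivation_tprod (δ := (qD (R := R)).restrictScalars ℤ) continuous_qD
    X_pow_dvd_eulerFactor (g := fun i =>
      -(((i + 1 : ℕ) : R⟦X⟧) * ∑' j : ℕ, (X ^ (i + 1)) ^ (j + 1)))
    (fun i => ((X_pow_dvd_geom _ (dvd_refl _)).mul_left _).neg_right)
    (fun i => by
      have h1 := geom_tsum (R := R) (y := X ^ (i + 1)) (by simp)
      change qD _ = _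
      rw [map_sub, Derivation.map_one_eq_zero, qD_X_pow]
      linear_combination ((i + 1 : ℕ) : R⟦X⟧) * h1)
  change qD (euler R) = euler R * _ at h
  rw [h, tsum_neg, mul_neg, eis, ← lambert_swap, ← tsum_tsum_lambert]
  congr 2
  refine tsum_congr fun i => ?_
  have hs : Summable fun j : ℕ => ((X : R⟦X⟧) ^ (i + 1)) ^ (j + 1) := by
    have := summable_geom_zC (1 : Rˣ) 1 i
    refine this.congr fun j => ?_
    rw [C_zpw, zC, one_zpow, Units.val_one, map_one, one_mul, pow_mul]
  rw [← hs.tsum_mul_left]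
  refine tsum_congr fun j => ?_
  rw [pow_one, map_natCast, ← pow_mul]

theorem qD_theta (z : Rˣ) :
    qD (theta z) = ∑' k : ℤ, thetaCoeff R k * ((thetaExp k : R⟦X⟧) * zC z k) := by
  have hs := summable_thetaCoeff_mul (R := R) (zC z)
  have h := hs.hasSum.map (qD (R := R)).toLinearMap.toAddMonoidHom continuous_qD
  refine h.tsum_eq.symm.trans (tsum_congr fun k => ?_)
  change qD (thetaCoeff R k * zC z k) = _
  rw [Derivation.leibniz, qD_zC, thetaCoeff, Derivation.leibniz, qD_X_pow,
    ← map_intCast (C (R := R)), qD_C]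
  simp only [smul_eq_mul]
  ring

omit [IsTopologicalRing R] in
theorem coeffDer_tsum_thetaCoeff {d : Derivation ℤ R R} (hd : Continuous d) (a : ℤ → R⟦X⟧) :
    coeffDer d (∑' k : ℤ, thetaCoeff R k * a k) = ∑' k : ℤ, thetaCoeff R k * coeffDer d (a k) := by
  have hs := summable_thetaCoeff_mul (R := R) a
  have h := hs.hasSum.map (coeffDer d).toLinearMap.toAddMonoidHom (continuous_coeffDer hd)
  refine h.tsum_eq.symm.trans (tsum_congr fun k => ?_)
  change coeffDer d (thetaCoeff R k * a k) = _
  rw [Derivation.leibniz, thetaCoeff, Derivation.leibniz, coeffDer_X_pow,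
    ← map_intCast (C (R := R)), coeffDer_C]
  simp

/-- The heat equation for the theta series. -/
theorem two_mul_qD_theta {d : Derivation ℤ R R} (hd : Continuous d) {z : Rˣ} (hz : d z = z) :
    2 * qD (theta z) = coeffDer d (coeffDer d (theta z)) - coeffDer d (theta z) := by
  have h1 : coeffDer d (theta z) = ∑' k : ℤ, thetaCoeff R k * ((k : R⟦X⟧) * zC z k) := by
    rw [theta, coeffDer_tsum_thetaCoeff hd]
    exact tsum_congr fun k => by rw [coeffDer_zC hz]
  have h2 : coeffDer d (coeffDer d (theta z)) =
      ∑' k : ℤ, thetaCoeff R k * ((k : R⟦X⟧) * ((k : R⟦X⟧) * zC z k)) := by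
    rw [h1, coeffDer_tsum_thetaCoeff hd]
    refine tsum_congr fun k => ?_
    rw [Derivation.leibniz, coeffDer_zC hz, ← map_intCast (C (R := R)), coeffDer_C]
    simp
  have hs0 := summable_thetaCoeff_mul (R := R) fun k => (thetaExp k : R⟦X⟧) * zC z k
  have hs1 := summable_thetaCoeff_mul (R := R) fun k => (k : R⟦X⟧) * zC z k
  have hs2 := summable_thetaCoeff_mul (R := R) fun k => (k : R⟦X⟧) * ((k : R⟦X⟧) * zC z k)
  rw [h2, h1, qD_theta, ← hs0.tsum_mul_left, ← hs2.tsum_sub hs1]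
  refine tsum_congr fun k => ?_
  have h3 := congrArg (Int.cast (R := R⟦X⟧)) (two_mul_thetaExp k)
  push_cast at h3
  linear_combination thetaCoeff R k * zC z k * h3

omit [IsTopologicalRing R] in
theorem constantCoeff_euler : constantCoeff (euler R) = 1 :=
  constantCoeff_tprod X_pow_dvd_eulerFactor

omit [IsTopologicalRing R] in
theorem constantCoeff_thetaProd (z : Rˣ) : constantCoeff (thetaProd z) = 1 :=
  constantCoeff_tprod (X_pow_dvd_thetaFactor z)

omit [TopologicalSpace R] [T2Space R] [IsTopologicalRing R] in
theorem isUnit_of_constantCoeff_eq_one {f : R⟦X⟧} (h : constantCoeff f = 1) : IsUnit f := by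
  rw [isUnit_iff_constantCoeff, h]; exact isUnit_one

/-- The quasi-Jacobi form of the heat equation, in terms of Lambert series. -/
theorem heat_lambert {d : Derivation ℤ R R} (hd : Continuous d) {z : Rˣ} (hz : d z = z)
    (he : coeffDer d (euler R) = 0) :
    (1 - zC z 1) * (lam z ^ 2 - lamDeriv z + 2 * eis R 1 + 2 * lamQ z) +
      (1 + zC z 1) * lam z = 0 := by
  have hu : IsUnit (euler R * thetaProd z) := (isUnit_of_constantCoeff_eq_one constantCoeff_euler).mul
    (isUnit_of_constantCoeff_eq_one (constantCoeff_thetaProd z))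
  have hz1 : coeffDer d (zC z 1) = zC z 1 := by rw [coeffDer_zC hz]; simp
  -- The triple product is inserted into the heat equation; every term then carries the unit (q)_∞
  -- times the theta product, which is cancelled.
  have h := two_mul_qD_theta hd hz
  simp only [theta_eq, Derivation.leibniz, smul_eq_mul, map_sub, map_add, Derivation.map_one_eq_zero,
    qD_zC, qD_euler, qD_thetaProd, coeffDer_thetaProd hd hz, hz1, he, coeffDer_lam hz, map_neg,
    mul_zero, zero_add, add_zero, zero_sub, mul_neg] at h
  refine hu.mul_left_cancel ?_
  linear_combination -h

end LogDerivative

/-! ### The crank function and the Appell-Lerch sum. -/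

section CrankFunction

variable {R : Type*} [CommRing R] [TopologicalSpace R] [T2Space R] [IsTopologicalRing R]

/-- The normalized crank generating function `∏ (1 - q ^ i) ^ 2 / ((1 - z q ^ i) (1 - q ^ i / z))`. -/
noncomputable def crankC (z : Rˣ) : R⟦X⟧ := euler R * ((1 - X) * crankSeries z 1 1)

theorem thetaProd_mul_crankC (z : Rˣ) : thetaProd z * crankC z = euler R ^ 2 := by
  rw [crankC]
  linear_combination euler R * thetaProd_mul_crankSeries z

theorem coeffDer_crankC {d : Derivation ℤ R R} (hd : Continuous d) {z : Rˣ} (hz : d z = z)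
    (he : coeffDer d (euler R) = 0) : coeffDer d (crankC z) = crankC z * lam z := by
  have h := congrArg (coeffDer d) (thetaProd_mul_crankC z)
  rw [Derivation.leibniz, coeffDer_thetaProd hd hz, sq, Derivation.leibniz, he] at h
  simp only [smul_eq_mul, mul_zero, add_zero] at h
  refine (isUnit_of_constantCoeff_eq_one (constantCoeff_thetaProd z)).mul_left_cancel ?_
  linear_combination h

theorem qD_crankC (z : Rˣ) : qD (crankC z) = crankC z * (lamQ z - 2 * eis R 1) := by
  have h := congrArg qD (thetaProd_mul_crankC z)
  rw [Derivation.leibniz, qD_thetaProd, sq, Derivation.leibniz, qD_euler] at h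
  simp only [smul_eq_mul] at h
  refine (isUnit_of_constantCoeff_eq_one (constantCoeff_thetaProd z)).mul_left_cancel ?_
  linear_combination h + 2 * eis R 1 * thetaProd_mul_crankC z

theorem constantCoeff_crankC (z : Rˣ) : constantCoeff (crankC z) = 1 := by
  have h := congrArg constantCoeff (thetaProd_mul_crankC z)
  rwa [map_mul, constantCoeff_thetaProd, map_pow, constantCoeff_euler, one_mul, one_pow] at h

/-- The heat operator applied to the Appell-Lerch sum, in terms of the crank function. -/
theorem appell_crank_identity [Algebra ℚ R] [IsDomain R] (z : Rˣ) (hz : (z : R) ≠ 1) {c c' : R⟦X⟧}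
    (hc : c = 2 * c') (hc' : c' = -appellTail c 0) :
    euler R ^ 6 * ((1 - zC z 1) ^ 3 * hat z (oddExt (appellTail c)) + c' + zC z 1 * (1 - c') +
        zC z 2 * (1 - c') + zC z 3 * c') =
      thetaMoment R ^ 2 * crankC z ^ 2 *
        (zC z 1 + zC z 2 - 2 * zC z 1 * (1 - zC z 1) * hat z (oddExt lambertW)) := by
  have h := theta_sq_mul_hat z hc hc'
  have hz1 : (1 - zC z 1) ^ 2 ≠ 0 := by
    refine pow_ne_zero 2 fun h0 => hz ?_
    have := congrArg constantCoeff h0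
    rw [map_sub, zC, constantCoeff_C, map_one, map_zero, zpow_one] at this
    exact (sub_eq_zero.mp this).symm
  have ht := thetaProd_mul_crankC z
  rw [theta_eq] at h
  set W1 := (1 - zC z 1) ^ 3 * hat z (oddExt (appellTail c)) + c' + zC z 1 * (1 - c') +
        zC z 2 * (1 - c') + zC z 3 * c'
  set W2 := zC z 1 + zC z 2 - 2 * zC z 1 * (1 - zC z 1) * hat z (oddExt lambertW)
  -- The triple product puts (1 - z)² into θ², matching the same factor on the other side;
  -- cancelling it is where z ≠ 1 and the domain hypothesis enter. Multiplying by the crank function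
  -- squared removes the theta product.
  refine mul_left_cancel₀ hz1 ?_
  linear_combination crankC z ^ 2 * h - (1 - zC z 1) ^ 2 * euler R ^ 2 * W1 *
    (thetaProd z * crankC z + euler R ^ 2) * ht

end CrankFunction

/-! ### Power series in u and q. -/

section TwoVariables

/-- Multiplication by constants in `u`: a series in `q` regarded as a series in `u` and `q`. -/
noncomputable def lift : ℚ⟦X⟧ →+* ℚ⟦X⟧⟦X⟧ := PowerSeries.map (C (R := ℚ))

theorem coeff_lift (f : ℚ⟦X⟧) (n : ℕ) : coeff n (lift f) = C (coeff n f) := coeff_map _ _ _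

theorem lift_X : lift X = X := by
  rw [lift, map_X]

theorem continuous_lift : Continuous lift := by
  refine continuous_iff_continuousAt.mpr fun f => ?_
  rw [ContinuousAt, WithPiTopology.tendsto_iff_coeff_tendsto]
  intro n
  simp_rw [coeff_lift]
  exact (WithPiTopology.continuous_C.comp (WithPiTopology.continuous_coeff ℚ n)).tendsto f

/-- The coefficient of `u ^ k` of a series in `u` and `q`. -/
noncomputable def ucoeff (k : ℕ) : ℚ⟦X⟧⟦X⟧ →+ ℚ⟦X⟧ where
  toFun f := mk fun n => coeff k (coeff n f)
  map_zero' := by ext n; simp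
  map_add' f g := by ext n; simp

theorem coeff_ucoeff (k n : ℕ) (f : ℚ⟦X⟧⟦X⟧) : coeff n (ucoeff k f) = coeff k (coeff n f) :=
  by
  change coeff n (mk fun n => coeff k (coeff n f)) = _
  rw [coeff_mk]

theorem continuous_ucoeff (k : ℕ) : Continuous (ucoeff k) := by
  refine continuous_iff_continuousAt.mpr fun f => ?_
  rw [ContinuousAt, WithPiTopology.tendsto_iff_coeff_tendsto]
  intro n
  simp_rw [coeff_ucoeff]
  exact ((WithPiTopology.continuous_coeff ℚ k).comp
    (WithPiTopology.continuous_coeff ℚ⟦X⟧ n)).tendsto f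

theorem ucoeff_mul (k : ℕ) (f g : ℚ⟦X⟧⟦X⟧) :
    ucoeff k (f * g) = ∑ p ∈ Finset.HasAntidiagonal.antidiagonal k, ucoeff p.1 f * ucoeff p.2 g := by
  ext n
  rw [coeff_ucoeff, coeff_mul, map_sum, map_sum]
  simp only [coeff_mul, coeff_ucoeff]
  exact Finset.sum_comm

theorem ucoeff_lift (k : ℕ) (f : ℚ⟦X⟧) : ucoeff k (lift f) = if k = 0 then f else 0 := by
  ext n
  rw [coeff_ucoeff, coeff_lift, coeff_C]
  split_ifs <;> simp

theorem ucoeff_lift_mul (k : ℕ) (f : ℚ⟦X⟧) (g : ℚ⟦X⟧⟦X⟧) : ucoeff k (lift f * g) = f * ucoeff k g := by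
  rw [ucoeff_mul, Finset.sum_eq_single (0, k)]
  · simp [ucoeff_lift]
  · rintro ⟨a, b⟩ h hne
    have h' : a + b = k := Finset.HasAntidiagonal.mem_antidiagonal.mp h
    rw [ucoeff_lift, if_neg, zero_mul]
    rintro rfl
    exact hne (by simpa using h')
  · intro h
    exact absurd (Finset.HasAntidiagonal.mem_antidiagonal.mpr (zero_add k)) h

theorem lift_tsum {ι : Type*} {f : ι → ℚ⟦X⟧} (hf : Summable f) :
    lift (∑' i, f i) = ∑' i, lift (f i) :=
  ((hf.hasSum.map lift continuous_lift).tsum_eq).symm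

theorem ucoeff_qD (k : ℕ) (f : ℚ⟦X⟧⟦X⟧) : ucoeff k (qD f) = qD (ucoeff k f) := by
  ext n
  rw [coeff_ucoeff, coeff_qD, coeff_qD, coeff_ucoeff, ← map_natCast (C (R := ℚ)), coeff_C_mul]

/-- The type of derivations of a commutative ring, with the instances found for a variable ring. -/
abbrev IntDerivation (R : Type*) [CommRing R] := Derivation ℤ R R

/-- An additive map satisfying the Leibniz rule, as a derivation. -/
def intDerivation {R : Type*} [CommRing R] (f : R →+ R) (h : ∀ a b, f (a * b) = a * f b + b * f a) :
    IntDerivation R := Derivation.mk' f.toIntLinearMap fun a b => by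
  simpa [smul_eq_mul] using h a b

/-- The derivation `d/du` on power series in `u`. -/
noncomputable def dU : IntDerivation ℚ⟦X⟧ :=
  intDerivation (AddMonoidHom.mk' (derivative ℚ) (map_add _)) fun a b => by
    simp [smul_eq_mul]

theorem dU_apply (f : ℚ⟦X⟧) : dU f = derivative ℚ f := rfl

theorem continuous_dU : Continuous dU := by
  refine continuous_iff_continuousAt.mpr fun f => ?_
  rw [ContinuousAt, WithPiTopology.tendsto_iff_coeff_tendsto]
  intro n
  simp_rw [dU_apply, coeff_derivative]
  exact ((WithPiTopology.continuous_coeff ℚ (n + 1)).mul_const _).tendsto f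

theorem ucoeff_coeffDer (k : ℕ) (f : ℚ⟦X⟧⟦X⟧) :
    ucoeff k (coeffDer dU f) = (k + 1) * ucoeff (k + 1) f := by
  ext n
  rw [coeff_ucoeff, coeff_coeffDer, dU_apply, coeff_derivative,
    show ((k : ℚ⟦X⟧) + 1) = C (k + 1 : ℚ) by simp, coeff_C_mul, coeff_ucoeff]
  ring

theorem coeffDer_lift (f : ℚ⟦X⟧) : coeffDer dU (lift f) = 0 := by
  ext n
  rw [coeff_coeffDer, coeff_lift, dU_apply, derivative_C]
  simp

theorem lift_euler : lift (euler ℚ) = euler ℚ⟦X⟧ := by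
  have h1 := (continuous_lift.tendsto _).comp (tendsto_eulerFin (R := ℚ))
  refine tendsto_nhds_unique h1 ((tendsto_eulerFin (R := ℚ⟦X⟧)).congr fun N => ?_)
  simp [eulerFin, map_prod, lift_X]

theorem coeffDer_euler : coeffDer dU (euler ℚ⟦X⟧) = 0 := by
  rw [← lift_euler, coeffDer_lift]

theorem lift_thetaCoeff (k : ℤ) : lift (thetaCoeff ℚ k) = thetaCoeff ℚ⟦X⟧ k := by
  simp [thetaCoeff, lift_X]

theorem lift_thetaMoment : lift (thetaMoment ℚ) = thetaMoment ℚ⟦X⟧ := by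
  rw [thetaMoment, lift_tsum (summable_thetaCoeff_mul _)]
  exact tsum_congr fun k => by rw [map_mul, lift_thetaCoeff, map_intCast]

theorem lift_appellTail (c : ℚ⟦X⟧) (m : ℕ) : lift (appellTail c m) = appellTail (lift c) m := by
  rw [appellTail, lift_tsum (summable_appellTerm c m)]
  refine tsum_congr fun n => ?_
  have h2 : lift 2 = 2 := map_ofNat lift 2
  simp [appellTerm, lift_X, h2]

theorem summable_lambertW {R : Type*} [CommRing R] [TopologicalSpace R] {j : ℕ} (hj : 0 < j) :
    Summable fun n : ℕ => (-X ^ j : R⟦X⟧) ^ (n + 1) :=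
  summable_of_X_pow_dvd (fun n => j * (n + 1))
    (fun N => (Set.finite_Iic N).subset fun n (hn : j * (n + 1) ≤ N) => by
      simp only [Set.mem_Iic]; nlinarith)
    fun n => by rw [pow_mul]; exact pow_dvd_pow_of_dvd ((dvd_refl _).neg_right) _

theorem lift_lambertW {j : ℕ} (hj : 0 < j) : lift (lambertW j) = lambertW j := by
  rw [lambertW, map_neg, lift_tsum (summable_lambertW hj), lambertW]
  congr 1
  exact tsum_congr fun n => by simp [lift_X]

end TwoVariables

/-! ### Derivatives at u = 0. -/

section Moments

/-- The `k`-th derivative at `u = 0` of a series in `u` and `q`. -/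
noncomputable def umom (k : ℕ) : ℚ⟦X⟧⟦X⟧ →+ ℚ⟦X⟧ :=
  (AddMonoidHom.mulLeft (k.factorial : ℚ⟦X⟧)).comp (ucoeff k)

theorem umom_eq (k : ℕ) (f : ℚ⟦X⟧⟦X⟧) : umom k f = (k.factorial : ℚ⟦X⟧) * ucoeff k f := rfl

theorem umom_mul (k : ℕ) (f g : ℚ⟦X⟧⟦X⟧) :
    umom k (f * g) = ∑ p ∈ Finset.HasAntidiagonal.antidiagonal k,
      (k.choose p.1 : ℚ⟦X⟧) * (umom p.1 f * umom p.2 g) := by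
  rw [umom_eq, ucoeff_mul, Finset.mul_sum]
  refine Finset.sum_congr rfl fun p hp => ?_
  rw [← Finset.HasAntidiagonal.mem_antidiagonal.mp hp, ← Nat.add_choose_mul_factorial_mul_factorial,
    ← Nat.choose_symm_add,
    umom_eq, umom_eq]
  push_cast
  ring

theorem umom_lift (k : ℕ) (f : ℚ⟦X⟧) : umom k (lift f) = if k = 0 then f else 0 := by
  rw [umom_eq, ucoeff_lift]
  split_ifs with h <;> simp [h]

theorem umom_one (k : ℕ) : umom k 1 = if k = 0 then 1 else 0 := by
  rw [← map_one lift, umom_lift]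

theorem umom_lift_mul (k : ℕ) (f : ℚ⟦X⟧) (g : ℚ⟦X⟧⟦X⟧) : umom k (lift f * g) = f * umom k g := by
  rw [umom_eq, ucoeff_lift_mul, umom_eq, mul_left_comm]

theorem umom_two_mul (k : ℕ) (g : ℚ⟦X⟧⟦X⟧) : umom k (2 * g) = 2 * umom k g := by
  rw [two_mul, two_mul, map_add]

theorem umom_tsum {ι : Type*} {f : ι → ℚ⟦X⟧⟦X⟧} (hf : Summable f) (k : ℕ) :
    umom k (∑' i, f i) = ∑' i, umom k (f i) :=
  ((hf.hasSum.map (umom k) ((continuous_const_mul _).comp (continuous_ucoeff k))).tsum_eq).symm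

theorem umom_qD (k : ℕ) (f : ℚ⟦X⟧⟦X⟧) : umom k (qD f) = qD (umom k f) := by
  rw [umom_eq, ucoeff_qD, umom_eq, Derivation.leibniz, Derivation.map_natCast]
  simp

theorem umom_coeffDer (k : ℕ) (f : ℚ⟦X⟧⟦X⟧) : umom k (coeffDer dU f) = umom (k + 1) f := by
  rw [umom_eq, ucoeff_coeffDer, umom_eq, Nat.factorial_succ]
  push_cast
  ring

theorem umom_lambert (k : ℕ) (c : ℕ → ℕ → ℚ⟦X⟧) :
    umom k (lambert c) = lambert fun a b => (k.factorial : ℚ) * coeff k (c a b) := by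
  ext n
  rw [umom_eq, ← map_natCast (C (R := ℚ)), coeff_C_mul, coeff_ucoeff, coeff_lambert, coeff_lambert, map_sum,
    Finset.mul_sum]

end Moments

/-! ### The specialisation z = ±exp u and Eisenstein series of level two. -/

section Exponentials

/-- The series `exp u` as a unit. -/
noncomputable def expU : ℚ⟦X⟧ˣ where
  val := exp ℚ
  inv := evalNegHom (exp ℚ)
  val_inv := exp_mul_exp_neg_eq_one
  inv_val := by rw [mul_comm, exp_mul_exp_neg_eq_one]

theorem expU_zpow (k : ℤ) : ((expU ^ k : ℚ⟦X⟧ˣ) : ℚ⟦X⟧) = rescale (k : ℚ) (exp ℚ) := by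
  induction k using Int.induction_on with
  | zero => simp
  | succ n ih =>
    rw [zpow_add_one, Units.val_mul, ih]
    push_cast
    rw [← exp_mul_exp_eq_exp_add, rescale_one]
    rfl
  | pred n ih =>
    rw [zpow_sub_one, Units.val_mul, ih]
    push_cast
    rw [sub_eq_add_neg, ← exp_mul_exp_eq_exp_add]
    rfl

/-- The unit `±exp u`. -/
noncomputable def sgnExp (ε : ℤˣ) : ℚ⟦X⟧ˣ :=
  Units.map (Int.castRingHom ℚ⟦X⟧).toMonoidHom ε * expU

theorem zpw_sgnExp (ε : ℤˣ) (k : ℤ) :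
    zpw (sgnExp ε) k = (((ε ^ k : ℤˣ) : ℤ) : ℚ⟦X⟧) * rescale (k : ℚ) (exp ℚ) := by
  rw [zpw, sgnExp, mul_zpow, Units.val_mul, expU_zpow, ← map_zpow]
  rfl

theorem coeff_zpw (ε : ℤˣ) (k : ℤ) (n : ℕ) :
    (n.factorial : ℚ) * coeff n (zpw (sgnExp ε) k) = ((ε ^ k : ℤˣ) : ℤ) * (k : ℚ) ^ n := by
  rw [zpw_sgnExp, ← map_intCast (C (R := ℚ)), coeff_C_mul, coeff_rescale, coeff_exp]
  have := Nat.factorial_ne_zero n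
  simp
  field_simp

theorem dU_sgnExp (ε : ℤˣ) : dU (sgnExp ε) = sgnExp ε := by
  have h : (sgnExp ε : ℚ⟦X⟧) = C (((ε : ℤ) : ℚ)) * exp ℚ := by
    rw [sgnExp, Units.val_mul, map_intCast]
    rfl
  rw [dU_apply, h, ← smul_eq_C_mul, Derivation.map_smul]
  congr 1
  ext n
  rw [coeff_derivative, coeff_exp, coeff_exp, Nat.factorial_succ]
  have := Nat.factorial_ne_zero n
  push_cast
  simp
  field_simp

theorem umom_zC (ε : ℤˣ) (m : ℤ) (k : ℕ) :
    umom k (zC (sgnExp ε) m) = ((((ε ^ m : ℤˣ) : ℤ) * m ^ k : ℤ) : ℚ⟦X⟧) := by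
  ext n
  rw [umom_eq, ← map_natCast (C (R := ℚ)), coeff_C_mul, coeff_ucoeff, ← C_zpw, coeff_C,
    ← map_intCast (C (R := ℚ)), coeff_C]
  split_ifs
  · rw [coeff_zpw]; push_cast; rfl
  · simp

/-- The Eisenstein type series `∑ ε ^ b b ^ k q ^ (a b)`. -/
noncomputable def eisSgn (ε : ℤˣ) (k : ℕ) : ℚ⟦X⟧ :=
  lambert fun _ b => (((ε ^ b : ℤˣ) : ℤ) : ℚ) * (b : ℚ) ^ k

theorem zpow_neg_sgn (ε : ℤˣ) (b : ℕ) : ε ^ (-(b : ℤ)) = ε ^ b := by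
  rw [zpow_neg, zpow_natCast, ← inv_pow, Int.units_inv_eq_self]

theorem umom_lam (ε : ℤˣ) (k : ℕ) :
    umom k (lam (sgnExp ε)) = if Even k then 0 else 2 * eisSgn ε k := by
  have h : umom k (lam (sgnExp ε)) = lambert fun _ b : ℕ => (1 - (-1) ^ k) *
      ((((ε ^ b : ℤˣ) : ℤ) : ℚ) * (b : ℚ) ^ k) := by
    rw [lam, umom_lambert]
    congr 1
    ext a b
    rw [map_sub, mul_sub, coeff_zpw, coeff_zpw, zpow_neg_sgn, zpow_natCast]
    push_cast
    rw [neg_pow]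
    ring
  rw [h, lambert_const_mul, ← eisSgn]
  split_ifs with hk
  · simp [hk.neg_one_pow]
  · rw [(Nat.not_even_iff_odd.mp hk).neg_one_pow, show (1 - -1 : ℚ) = 2 by norm_num]
    rw [show (C (2 : ℚ)) = (2 : ℚ⟦X⟧) from map_ofNat C 2]

/-- The series `∑ a ε ^ b q ^ (a b)`. -/
noncomputable def eisDual (ε : ℤˣ) : ℚ⟦X⟧ := lambert fun a b => (a : ℚ) * ((ε ^ b : ℤˣ) : ℤ)

/-- Odd orders cancel between z^b and z^{-b}. For even k > 0 one writes a b^k = (ab) b^{k-1} and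
absorbs ab into `qD`; for k = 0 no such factor is available, whence the dual series. -/
theorem umom_lamQ (ε : ℤˣ) (k : ℕ) :
    umom k (lamQ (sgnExp ε)) = if k = 0 then 2 * eisDual ε else if Even k then
      2 * qD (eisSgn ε (k - 1)) else 0 := by
  have h : umom k (lamQ (sgnExp ε)) = lambert fun a b : ℕ => (1 + (-1) ^ k) *
      (a * ((((ε ^ b : ℤˣ) : ℤ) : ℚ) * (b : ℚ) ^ k)) := by
    rw [lamQ, umom_lambert]
    congr 1
    ext a b
    have ha : (a : ℚ⟦X⟧) = C (a : ℚ) := by simp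
    rw [ha, coeff_C_mul, map_add, mul_left_comm, mul_add, coeff_zpw, coeff_zpw, zpow_neg_sgn, zpow_natCast]
    push_cast
    rw [neg_pow]
    ring
  rw [h, lambert_const_mul]
  have h2 : (C (2 : ℚ)) = (2 : ℚ⟦X⟧) := map_ofNat C 2
  split_ifs with h0 hk
  · subst h0
    simp only [pow_zero, mul_one, eisDual]
    norm_num [h2]
  · rw [hk.neg_one_pow, show (1 + 1 : ℚ) = 2 by norm_num, h2, eisSgn, qD_lambert]
    congr 2
    ext a b
    obtain ⟨j, rfl⟩ := Nat.exists_eq_succ_of_ne_zero h0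
    rw [Nat.succ_sub_one, pow_succ]
    ring
  · rw [(Nat.not_even_iff_odd.mp hk).neg_one_pow]
    simp

theorem eisSgn_one (k : ℕ) : eisSgn 1 k = eis ℚ k := by simp [eisSgn, eis]

theorem eisDual_one : eisDual 1 = eis ℚ 1 := by
  rw [eis, ← lambert_swap, eisDual]
  simp

/-- The Eisenstein type series in `q ^ 2`. -/
noncomputable def eisTwo (k : ℕ) : ℚ⟦X⟧ := expand 2 two_ne_zero (eis ℚ k)

theorem qD_expand (f : ℚ⟦X⟧) :
    qD (expand 2 two_ne_zero f) = 2 * expand 2 two_ne_zero (qD f) := by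
  ext n
  rw [coeff_qD, show (2 : ℚ⟦X⟧) = C (2 : ℚ) from (map_ofNat C 2).symm, coeff_C_mul]
  rcases Nat.even_or_odd' n with ⟨k, rfl | rfl⟩
  · rw [coeff_expand_mul, coeff_expand_mul, coeff_qD]
    push_cast
    ring
  · rw [coeff_expand_of_not_dvd _ _ _ (by omega), coeff_expand_of_not_dvd _ _ _ (by omega)]
    simp

theorem expand_lambert (g : ℕ → ℕ → ℚ) :
    expand 2 two_ne_zero (lambert g) = lambert fun a b => if Even b then g a (b / 2) else 0 := by
  ext n
  rw [coeff_lambert, ← Finset.sum_filter]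
  rcases Nat.even_or_odd' n with ⟨k, rfl | rfl⟩
  · rw [coeff_expand_mul, coeff_lambert]
    refine Finset.sum_bij' (fun x _ => (x.1, 2 * x.2)) (fun x _ => (x.1, x.2 / 2)) ?_ ?_ ?_ ?_ ?_
    · intro x hx
      rw [Nat.mem_divisorsAntidiagonal] at hx
      rw [Finset.mem_filter, Nat.mem_divisorsAntidiagonal]
      refine ⟨⟨by rw [← hx.1]; ring, by have := hx.2; omega⟩, even_two_mul _⟩
    · intro x hx
      rw [Finset.mem_filter, Nat.mem_divisorsAntidiagonal] at hx
      obtain ⟨⟨h1, h2⟩, j, hj⟩ := hx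
      rw [Nat.mem_divisorsAntidiagonal]
      refine ⟨?_, by omega⟩
      rw [hj, ← two_mul] at h1
      have : 2 * (x.1 * j) = 2 * k := by rw [← h1]; ring
      simp only [hj, ← two_mul, Nat.mul_div_cancel_left j two_pos]
      omega
    · intro x _; simp
    · intro x hx
      obtain ⟨-, j, hj⟩ := Finset.mem_filter.mp hx
      ext <;> simp; omega
    · intro x _; simp
  · rw [coeff_expand_of_not_dvd _ _ _ (by omega), Finset.sum_eq_zero]
    intro x hx
    obtain ⟨h1, h2⟩ := Finset.mem_filter.mp hx
    rw [Nat.mem_divisorsAntidiagonal] at h1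
    exact absurd (h1.1 ▸ h2.mul_left x.1) (by simp)

/-- The sign (-1)^b is twice the indicator of even b, minus 1, and b = 2j contributes 2^k j^k
q^{2aj}. -/
theorem eisSgn_neg_one (k : ℕ) : eisSgn (-1) k = 2 ^ (k + 1) * eisTwo k - eis ℚ k := by
  rw [eisTwo, eis, expand_lambert, show (2 : ℚ⟦X⟧) = C (2 : ℚ) from (map_ofNat C 2).symm, ← map_pow,
    ← lambert_const_mul, ← lambert_sub, eisSgn]
  congr 1
  ext a b
  rcases Nat.even_or_odd b with hb | hb
  · rw [if_pos hb, hb.neg_one_pow]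
    obtain ⟨j, rfl⟩ := hb
    rw [← two_mul, Nat.mul_div_cancel_left j two_pos]
    push_cast
    rw [mul_pow, pow_succ]
    ring
  · rw [if_neg (Nat.not_even_iff_odd.mpr hb), hb.neg_one_pow]
    simp

theorem eisDual_neg_one : eisDual (-1) = 2 * eisTwo 1 - eis ℚ 1 := by
  have he : eis ℚ 1 = lambert fun a _ => (a : ℚ) := by
    rw [eis, ← lambert_swap]; simp
  rw [eisTwo, he, expand_lambert, show (2 : ℚ⟦X⟧) = C (2 : ℚ) from (map_ofNat C 2).symm,
    ← lambert_const_mul, ← lambert_sub, eisDual]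
  congr 1
  ext a b
  rcases Nat.even_or_odd b with hb | hb
  · rw [if_pos hb, hb.neg_one_pow]; push_cast; ring
  · rw [if_neg (Nat.not_even_iff_odd.mpr hb), hb.neg_one_pow]; simp

end Exponentials

/-! ### Ramanujan's equations and the relations of level two. -/

section EisensteinRelations

theorem umom_mul_range (k : ℕ) (f g : ℚ⟦X⟧⟦X⟧) :
    umom k (f * g) = ∑ i ∈ Finset.range (k + 1),
      (k.choose i : ℚ⟦X⟧) * (umom i f * umom (k - i) g) := by
  rw [umom_mul]
  exact Finset.Nat.sum_antidiagonal_eq_sum_range_succ_mk _ _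

theorem lift_lambert (c : ℕ → ℕ → ℚ) : lift (lambert c) = lambert fun a b => C (c a b) := by
  ext1 n
  rw [coeff_lift, coeff_lambert, coeff_lambert, map_sum]

theorem lift_eis (k : ℕ) : lift (eis ℚ k) = eis ℚ⟦X⟧ k := by
  rw [eis, lift_lambert, eis]
  simp

theorem umom_zC_one_mul (ε : ℤˣ) (k : ℕ) (f : ℚ⟦X⟧⟦X⟧) :
    umom k (zC (sgnExp ε) 1 * f) = ((ε : ℤ) : ℚ⟦X⟧) * ∑ i ∈ Finset.range (k + 1),
      (k.choose i : ℚ⟦X⟧) * umom (k - i) f := by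
  rw [umom_mul_range, Finset.mul_sum]
  refine Finset.sum_congr rfl fun i _ => ?_
  rw [umom_zC]
  simp
  ring

/-- The moments of the heat operator expression, in terms of those of the Lambert series. -/
noncomputable def heatMoment (ε : ℤˣ) (k : ℕ) : ℚ⟦X⟧ :=
  ∑ i ∈ Finset.range (k + 1), (k.choose i : ℚ⟦X⟧) * (umom i (lam (sgnExp ε)) *
    umom (k - i) (lam (sgnExp ε))) - umom (k + 1) (lam (sgnExp ε)) +
    2 * (if k = 0 then eis ℚ 1 else 0) + 2 * umom k (lamQ (sgnExp ε))

/-- The u^k coefficient of `heat_lambert` at z = ε exp u. The case ε = 1 gives differential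
equations of level one, ε = -1 gives relations between series in q and in q². -/
theorem heat_umom (ε : ℤˣ) (k : ℕ) :
    heatMoment ε k + umom k (lam (sgnExp ε)) + ((ε : ℤ) : ℚ⟦X⟧) *
      ∑ i ∈ Finset.range (k + 1), (k.choose i : ℚ⟦X⟧) *
        (umom (k - i) (lam (sgnExp ε)) - heatMoment ε (k - i)) = 0 := by
  have hY : ∀ j, umom j (lam (sgnExp ε) ^ 2 - lamDeriv (sgnExp ε) + 2 * eis ℚ⟦X⟧ 1 +
      2 * lamQ (sgnExp ε)) = heatMoment ε j := by
    intro j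
    rw [map_add, map_add, map_sub, sq, umom_mul_range, ← coeffDer_lam (dU_sgnExp ε), umom_coeffDer,
      umom_two_mul, umom_two_mul, ← lift_eis, umom_lift, heatMoment]
  have h := congrArg (umom k) (heat_lambert continuous_dU (dU_sgnExp ε) coeffDer_euler)
  rw [map_zero] at h
  rw [← h]
  set Y := lam (sgnExp ε) ^ 2 - lamDeriv (sgnExp ε) + 2 * eis ℚ⟦X⟧ 1 + 2 * lamQ (sgnExp ε)
  rw [show (1 - zC (sgnExp ε) 1) * Y + (1 + zC (sgnExp ε) 1) * lam (sgnExp ε) =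
    Y + lam (sgnExp ε) + zC (sgnExp ε) 1 * (lam (sgnExp ε) - Y) by ring, map_add, map_add,
    umom_zC_one_mul, hY]
  simp only [map_sub, hY]

local notation "e₁" => eis ℚ 1
local notation "e₃" => eis ℚ 3
local notation "e₅" => eis ℚ 5
local notation "e₇" => eis ℚ 7
local notation "f₁" => eisTwo 1
local notation "f₃" => eisTwo 3
local notation "f₅" => eisTwo 5
local notation "f₇" => eisTwo 7

/-- Ramanujan's equation for E₂ = 1 - 24e₁, from order 3 at z = exp u. Orders 5 and 7 give those for
e₃ and e₅. -/
theorem qD_eis_one : qD e₁ = (-2 : ℚ) • (e₁ ^ 2) + (1 / 6 : ℚ) • e₁ + (5 / 6 : ℚ) • e₃ := by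
  have h := heat_umom 1 3
  simp [heatMoment, Finset.sum_range_succ, umom_lam, umom_lamQ, eisSgn_one, eisDual_one, Nat.choose,
    Nat.even_iff] at h
  linear_combination (norm := algebra with ℚ) (-1 / 12 : ℚ) • h

theorem qD_eis_three : qD e₃ = (-8 : ℚ) • (e₁ * e₃) + (-1 / 30 : ℚ) • e₁ + (1 / 3 : ℚ) • e₃ + (7 / 10 : ℚ) • e₅ := by
  have h := heat_umom 1 5
  simp [heatMoment, Finset.sum_range_succ, umom_lam, umom_lamQ, eisSgn_one, eisDual_one, Nat.choose,
    Nat.even_iff, qD_eis_one] at h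
  linear_combination (norm := algebra with ℚ) (-1 / 20 : ℚ) • h

theorem qD_eis_five : qD e₅ = (-12 : ℚ) • (e₁ * e₅) + (1 / 42 : ℚ) • e₁ + (-20 : ℚ) • (e₃ ^ 2) + (-1 / 6 : ℚ) • e₃ +
    (1 / 2 : ℚ) • e₅ + (9 / 14 : ℚ) • e₇ := by
  have h := heat_umom 1 7
  simp [heatMoment, Finset.sum_range_succ, umom_lam, umom_lamQ, eisSgn_one, eisDual_one, Nat.choose,
    Nat.even_iff, qD_eis_one, qD_eis_three] at h
  linear_combination (norm := algebra with ℚ) (-1 / 28 : ℚ) • h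

theorem qD_eisTwo_one : qD f₁ = (-4 : ℚ) • (f₁ ^ 2) + (1 / 3 : ℚ) • f₁ + (5 / 3 : ℚ) • f₃ := by
  rw [eisTwo, qD_expand, qD_eis_one]
  simp only [map_add, map_smul, map_pow, eisTwo]
  algebra with ℚ

theorem qD_eisTwo_three : qD f₃ = (-16 : ℚ) • (f₁ * f₃) + (-1 / 15 : ℚ) • f₁ + (2 / 3 : ℚ) • f₃ + (7 / 5 : ℚ) • f₅ := by
  rw [eisTwo, qD_expand, qD_eis_three]
  simp only [map_add, map_smul, map_mul, eisTwo]
  algebra with ℚ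

theorem qD_eisTwo_five : qD f₅ = (-24 : ℚ) • (f₁ * f₅) + (1 / 21 : ℚ) • f₁ + (-40 : ℚ) • (f₃ ^ 2) + (-1 / 3 : ℚ) • f₃ +
    (1 : ℚ) • f₅ + (9 / 7 : ℚ) • f₇ := by
  rw [eisTwo, qD_expand, qD_eis_five]
  simp only [map_add, map_smul, map_mul, map_pow, eisTwo]
  algebra with ℚ

theorem qD_two : qD (2 : ℚ⟦X⟧) = 0 := by
  rw [← map_ofNat (C (R := ℚ)) 2, qD_C]

/-- Order 2 at z = -exp u: the relation in weight four, which eliminates f₃. -/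
theorem eisTwo_three : f₃ = (3 : ℚ) • (e₁ ^ 2) + (-12 : ℚ) • (e₁ * f₁) + (1 / 4 : ℚ) • e₁ + (12 : ℚ) • (f₁ ^ 2) +
    (-1 / 2 : ℚ) • f₁ + (-1 / 4 : ℚ) • e₃ := by
  have h := heat_umom (-1) 2
  simp [heatMoment, Finset.sum_range_succ, umom_lam, umom_lamQ, eisSgn_neg_one, eisDual_neg_one, Nat.choose,
    Nat.even_iff, qD_two, qD_eis_one, qD_eisTwo_one] at h
  linear_combination (norm := algebra with ℚ) (-3 / 32 : ℚ) • h

/-- Order 4 at z = -exp u and the q-derivative of the relation for f₃ are two linear equations in e₅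
and f₅. This combination isolates e₅, the next lemma f₅. -/
theorem eis_five : e₅ = (-768 / 7 : ℚ) • (e₁ ^ 3) + (4608 / 7 : ℚ) • (e₁ ^ 2 * f₁) + (-96 / 7 : ℚ) • (e₁ ^ 2) +
    (-9216 / 7 : ℚ) • (e₁ * f₁ ^ 2) + (384 / 7 : ℚ) • (e₁ * f₁) + (240 / 7 : ℚ) • (e₁ * e₃) +
    (-3 / 7 : ℚ) • e₁ + (6144 / 7 : ℚ) • (f₁ ^ 3) + (-384 / 7 : ℚ) • (f₁ ^ 2) +
    (-480 / 7 : ℚ) • (f₁ * e₃) + (6 / 7 : ℚ) • f₁ + (10 / 7 : ℚ) • e₃ := by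
  have h := heat_umom (-1) 4
  simp [heatMoment, Finset.sum_range_succ, umom_lam, umom_lamQ, eisSgn_neg_one, eisDual_neg_one, Nat.choose,
    Nat.even_iff, qD_two, qD_eis_one, qD_eisTwo_one, qD_eis_three, qD_eisTwo_three] at h
  simp only [eisTwo_three] at h
  have hd := congrArg qD eisTwo_three
  rw [qD_eisTwo_three] at hd
  simp [qD_eis_one, qD_eisTwo_one, qD_eis_three, eisTwo_three] at hd
  linear_combination (norm := algebra with ℚ) (1 / 8 : ℚ) • h + (48 / 7 : ℚ) • hd

theorem eisTwo_five : f₅ = (-264 / 7 : ℚ) • (e₁ ^ 3) + (1584 / 7 : ℚ) • (e₁ ^ 2 * f₁) + (-33 / 7 : ℚ) • (e₁ ^ 2) +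
    (-3168 / 7 : ℚ) • (e₁ * f₁ ^ 2) + (132 / 7 : ℚ) • (e₁ * f₁) + (30 / 7 : ℚ) • (e₁ * e₃) +
    (-5 / 28 : ℚ) • e₁ + (2112 / 7 : ℚ) • (f₁ ^ 3) + (-132 / 7 : ℚ) • (f₁ ^ 2) +
    (-60 / 7 : ℚ) • (f₁ * e₃) + (5 / 14 : ℚ) • f₁ + (5 / 28 : ℚ) • e₃ := by
  have h := heat_umom (-1) 4
  simp [heatMoment, Finset.sum_range_succ, umom_lam, umom_lamQ, eisSgn_neg_one, eisDual_neg_one, Nat.choose,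
    Nat.even_iff, qD_two, qD_eis_one, qD_eisTwo_one, qD_eis_three, qD_eisTwo_three] at h
  simp only [eisTwo_three] at h
  have hd := congrArg qD eisTwo_three
  rw [qD_eisTwo_three] at hd
  simp [qD_eis_one, qD_eisTwo_one, qD_eis_three, eisTwo_three] at hd
  linear_combination (norm := algebra with ℚ) (-1 / 64 : ℚ) • h + (-1 / 7 : ℚ) • hd

/-- The classical E₈ = E₄², obtained by comparing the q-derivative of the formula for e₅ with
Ramanujan's equation, in which e₇ occurs. The formula for f₇ follows from f₅ in the same way. -/
theorem eis_seven : e₇ = (120 : ℚ) • (e₃ ^ 2) + (1 : ℚ) • e₃ := by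
  have hd := congrArg qD eis_five
  rw [qD_eis_five] at hd
  simp [qD_eis_one, qD_eisTwo_one, qD_eis_three, eisTwo_three, eis_five] at hd
  linear_combination (norm := algebra with ℚ) (14 / 9 : ℚ) • hd

theorem eisTwo_seven : f₇ = (1080 : ℚ) • (e₁ ^ 4) + (-8640 : ℚ) • (e₁ ^ 3 * f₁) + (180 : ℚ) • (e₁ ^ 3) +
    (25920 : ℚ) • (e₁ ^ 2 * f₁ ^ 2) + (-1080 : ℚ) • (e₁ ^ 2 * f₁) +
    (-180 : ℚ) • (e₁ ^ 2 * e₃) + (21 / 2 : ℚ) • (e₁ ^ 2) + (-34560 : ℚ) • (e₁ * f₁ ^ 3) +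
    (2160 : ℚ) • (e₁ * f₁ ^ 2) + (720 : ℚ) • (e₁ * f₁ * e₃) + (-42 : ℚ) • (e₁ * f₁) +
    (-15 : ℚ) • (e₁ * e₃) + (1 / 4 : ℚ) • e₁ + (17280 : ℚ) • (f₁ ^ 4) +
    (-1440 : ℚ) • (f₁ ^ 3) + (-720 : ℚ) • (f₁ ^ 2 * e₃) + (42 : ℚ) • (f₁ ^ 2) +
    (30 : ℚ) • (f₁ * e₃) + (-1 / 2 : ℚ) • f₁ + (15 / 2 : ℚ) • (e₃ ^ 2) + (-1 / 4 : ℚ) • e₃ := by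
  have hd := congrArg qD eisTwo_five
  rw [qD_eisTwo_five] at hd
  simp [qD_eis_one, qD_eisTwo_one, qD_eis_three, eisTwo_three, eis_five, eisTwo_five] at hd
  linear_combination (norm := algebra with ℚ) (7 / 9 : ℚ) • hd

end EisensteinRelations

/-! ### Crank moments as polynomials in Eisenstein series. -/

section CrankMoments

/-- The moments of the normalized crank generating function at `z = exp u`. -/
noncomputable def crankMom (k : ℕ) : ℚ⟦X⟧ := umom k (crankC (sgnExp 1))

/-- Leibniz's rule for dC/du = C · `lam`, where the moments of `lam` are Eisenstein series. -/
theorem crankMom_succ (k : ℕ) : crankMom (k + 1) = ∑ i ∈ Finset.range (k + 1),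
    (k.choose i : ℚ⟦X⟧) * (crankMom i * umom (k - i) (lam (sgnExp 1))) := by
  rw [crankMom, ← umom_coeffDer, coeffDer_crankC continuous_dU (dU_sgnExp 1) coeffDer_euler,
    umom_mul_range]
  rfl

theorem constantCoeff_umom_zero (f : ℚ⟦X⟧⟦X⟧) :
    constantCoeff (umom 0 f) = constantCoeff (constantCoeff f) := by
  rw [umom_eq, Nat.factorial_zero, Nat.cast_one, one_mul, ← coeff_zero_eq_constantCoeff_apply,
    coeff_ucoeff]
  simp

/-- At z = 1 the crank function is 1. This is read off its logarithmic q-derivative, in which 2e₁ -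
2e₁ vanishes, instead of evaluating the product. -/
theorem crankMom_zero : crankMom 0 = 1 := by
  have h1 : constantCoeff (crankMom 0) = 1 := by
    rw [crankMom, constantCoeff_umom_zero, constantCoeff_crankC, map_one]
  have h2 : qD (crankMom 0) = crankMom 0 * 0 := by
    rw [crankMom, ← umom_qD, qD_crankC, umom_mul_range, ← lift_eis]
    simp [umom_two_mul, umom_lift, umom_lamQ, eisDual_one]
  exact eq_of_qD_eq_mul (map_zero _) (h1.trans (map_one _).symm) h2
    (by rw [mul_zero, Derivation.map_one_eq_zero])

local notation "e₁" => eis ℚ 1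
local notation "e₃" => eis ℚ 3
local notation "e₅" => eis ℚ 5
local notation "e₇" => eis ℚ 7

theorem crankMom_one : crankMom 1 = 0 := by
  rw [crankMom_succ]; simp [umom_lam]

theorem crankMom_two : crankMom 2 = 2 * e₁ := by
  rw [crankMom_succ]
  simp [Finset.sum_range_succ, umom_lam, eisSgn_one, crankMom_zero]

theorem crankMom_three : crankMom 3 = 0 := by
  rw [crankMom_succ]
  simp [Finset.sum_range_succ, umom_lam, eisSgn_one, crankMom_one]

theorem crankMom_four : crankMom 4 = 12 * e₁ ^ 2 + 2 * e₃ := by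
  rw [crankMom_succ]
  simp [Finset.sum_range_succ, umom_lam, eisSgn_one, crankMom_zero, crankMom_two,
    Nat.choose, Nat.even_iff]
  ring

theorem crankMom_five : crankMom 5 = 0 := by
  rw [crankMom_succ]
  simp [Finset.sum_range_succ, umom_lam, eisSgn_one, crankMom_one, crankMom_three, Nat.even_iff]

theorem crankMom_six : crankMom 6 = 120 * e₁ ^ 3 + 60 * e₁ * e₃ + 2 * e₅ := by
  rw [crankMom_succ]
  simp [Finset.sum_range_succ, umom_lam, eisSgn_one, crankMom_zero, crankMom_two,
    crankMom_four, Nat.choose, Nat.even_iff]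
  ring

theorem crankMom_seven : crankMom 7 = 0 := by
  rw [crankMom_succ]
  simp [Finset.sum_range_succ, umom_lam, eisSgn_one, crankMom_one, crankMom_three, crankMom_five,
    Nat.even_iff]

theorem crankMom_eight : crankMom 8 = 1680 * e₁ ^ 4 + 1680 * e₁ ^ 2 * e₃ + 112 * e₁ * e₅ +
    140 * e₃ ^ 2 + 2 * e₇ := by
  rw [crankMom_succ]
  simp [Finset.sum_range_succ, umom_lam, eisSgn_one, crankMom_zero, crankMom_two,
    crankMom_four, crankMom_six, Nat.choose, Nat.even_iff]
  ring

end CrankMoments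

/-! ### Partial theta series and the heat operator. -/

section AppellSums

variable {R : Type*} [CommRing R] [TopologicalSpace R]

/-- The term of the partial theta series of a given rank. -/
noncomputable def partialTerm (m n : ℕ) : R⟦X⟧ := (-1) ^ (n + 1) * X ^ ((n + 1) ^ 2 + (n + 1) * m)

/-- The partial theta series `∑_{n ≥ 1} (-1) ^ n q ^ (n ^ 2 + n m)`. -/
noncomputable def partialTheta (m : ℕ) : R⟦X⟧ := ∑' n, partialTerm m n

theorem summable_partialTerm (m : ℕ) : Summable (partialTerm m : ℕ → R⟦X⟧) :=
  summable_of_X_pow_dvd (fun n => (n + 1) ^ 2 + (n + 1) * m)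
    (fun N => (Set.finite_Iic N).subset fun n (hn : (n + 1) ^ 2 + (n + 1) * m ≤ N) => by
      simp only [Set.mem_Iic]; nlinarith [Nat.zero_le ((n + 1) * m)])
    fun _ => Dvd.intro_left _ rfl

variable [IsTopologicalRing R] [T2Space R]

theorem X_pow_dvd_partialTheta (m : ℕ) : X ^ (m + 1) ∣ (partialTheta m : R⟦X⟧) :=
  X_pow_dvd_tsum _ fun n => Dvd.dvd.mul_left (pow_dvd_pow _ (by nlinarith)) _

theorem qD_tsum {ι : Type*} {f : ι → R⟦X⟧} (hf : Summable f) :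
    qD (∑' i, f i) = ∑' i, qD (f i) :=
  ((hf.hasSum.map qD continuous_qD).tsum_eq).symm

/-- From (2n + m)² = 4(n² + nm) + m²: the weight in `appellTail` is the operator 4q d/dq + m² + c
applied to the partial theta series. -/
theorem appellTail_eq_partialTheta (c : R⟦X⟧) (m : ℕ) :
    appellTail c m = 4 * qD (partialTheta m) + ((m : R⟦X⟧) ^ 2 + c) * partialTheta m := by
  have hs := summable_partialTerm (R := R) m
  have hq : Summable fun n => qD (partialTerm m n : R⟦X⟧) := (hs.hasSum.map qD continuous_qD).summable
  rw [appellTail, partialTheta, qD_tsum hs, ← hq.tsum_mul_left, ← hs.tsum_mul_left,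
    ← (hq.mul_left 4).tsum_add (hs.mul_left _)]
  refine tsum_congr fun n => ?_
  have h1 : qD ((-1 : R⟦X⟧) ^ (n + 1)) = 0 := by
    rw [show (-1 : R⟦X⟧) = C (-1 : R) by simp, ← map_pow, qD_C]
  rw [appellTerm, partialTerm, Derivation.leibniz, h1, qD_X_pow]
  push_cast
  simp only [smul_eq_mul]
  ring

end AppellSums

/-! ### Moments over m of the partial theta and Lambert sequences. -/

section AppellMoments

/-- The weighted sum `∑_{m ≥ 1} m ^ k a m`. -/
noncomputable def momentSum (a : ℕ → ℚ⟦X⟧) (k : ℕ) : ℚ⟦X⟧ := ∑' m : ℕ, ((m : ℚ⟦X⟧) + 1) ^ k * a (m + 1)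

theorem summable_momentSum {a : ℕ → ℚ⟦X⟧} (ha : ∀ m, X ^ m ∣ a m) (k : ℕ) :
    Summable fun m : ℕ => ((m : ℚ⟦X⟧) + 1) ^ k * a (m + 1) :=
  summable_of_X_pow_dvd (fun m => m + 1)
    (fun N => (Set.finite_Iic N).subset fun n (hn : n + 1 ≤ N) => by
      simp only [Set.mem_Iic]; omega)
    fun m => (ha (m + 1)).mul_left _

theorem momentSum_appellTail (c : ℚ⟦X⟧) (k : ℕ) :
    momentSum (appellTail c) k = momentSum partialTheta (k + 2) +
      (4 * qD (momentSum partialTheta k) + c * momentSum partialTheta k) := by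
  have hp : ∀ m, X ^ m ∣ (partialTheta m : ℚ⟦X⟧) := fun m =>
    (pow_dvd_pow _ m.le_succ).trans (X_pow_dvd_partialTheta m)
  have hs := summable_momentSum hp k
  have hs2 := summable_momentSum hp (k + 2)
  have hq : Summable fun m : ℕ => qD (((m : ℚ⟦X⟧) + 1) ^ k * partialTheta (m + 1)) :=
    (hs.hasSum.map qD continuous_qD).summable
  rw [momentSum, momentSum, momentSum, qD_tsum hs, ← hq.tsum_mul_left, ← hs.tsum_mul_left,
    ← (hq.mul_left 4).tsum_add (hs.mul_left c), ← hs2.tsum_add ((hq.mul_left 4).add (hs.mul_left c))]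
  refine tsum_congr fun m => ?_
  rw [appellTail_eq_partialTheta, Derivation.leibniz, Derivation.leibniz_pow, map_add,
    Derivation.map_natCast, Derivation.map_one_eq_zero]
  push_cast
  simp only [smul_eq_mul, add_zero, smul_zero, mul_zero]
  ring

/-- Under the odd extension, the terms of index ±m cancel in even moments and double in odd ones. -/
theorem umom_hat {a : ℕ → ℚ⟦X⟧⟦X⟧} {b : ℕ → ℚ⟦X⟧} (hab : ∀ m, a (m + 1) = lift (b (m + 1)))
    (ha : ∀ m, X ^ m ∣ a m) (hb : ∀ m, X ^ m ∣ b m) (k : ℕ) :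
    umom k (hat (sgnExp 1) (oddExt a)) = if Even k then 0 else 2 * momentSum b k := by
  have hs := (decays_oddExt ha).summable (sgnExp 1)
  have hterm : ∀ m : ℤ, umom k (zC (sgnExp 1) m * oddExt a m) = (m : ℚ⟦X⟧) ^ k * oddExt b m := by
    intro m
    have hl : oddExt a m = lift (oddExt b m) := by
      rcases lt_trichotomy m 0 with h | h | h
      · obtain ⟨j, rfl⟩ : ∃ j : ℕ, m = -((j + 1 : ℕ) : ℤ) := ⟨(-m - 1).toNat, by omega⟩
        rw [oddExt_neg a (by omega), oddExt_neg b (by omega), hab, map_neg]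
      · rw [h, oddExt_zero, oddExt_zero, map_zero]
      · obtain ⟨j, rfl⟩ : ∃ j : ℕ, m = ((j + 1 : ℕ) : ℤ) := ⟨(m - 1).toNat, by omega⟩
        rw [oddExt_natCast a (by omega), oddExt_natCast b (by omega), hab]
    rw [hl, mul_comm, umom_lift_mul, umom_zC]
    push_cast
    rw [one_zpow]
    push_cast
    ring
  have h1 : HasSum (fun m : ℕ => ((m : ℚ⟦X⟧) + 1) ^ k * b (m + 1)) (momentSum b k) :=
    (summable_momentSum hb k).hasSum
  have hpos : HasSum (fun n : ℕ => (((n : ℤ) + 1 : ℤ) : ℚ⟦X⟧) ^ k * oddExt b ((n : ℤ) + 1))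
      (momentSum b k) := by
    convert h1 using 1
    funext n
    rw [show ((n : ℤ) + 1) = ((n + 1 : ℕ) : ℤ) by push_cast; rfl, oddExt_natCast b (by omega)]
    push_cast
    rfl
  have hneg : HasSum (fun n : ℕ => ((-((n : ℤ) + 1) : ℤ) : ℚ⟦X⟧) ^ k * oddExt b (-((n : ℤ) + 1)))
      (-(-1) ^ k * momentSum b k) := by
    have h1n : HasSum (fun m : ℕ => -(-1) ^ k * (((m : ℚ⟦X⟧) + 1) ^ k * b (m + 1)))
        (-(-1) ^ k * momentSum b k) := h1.mul_left _
    convert h1n using 1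
    funext n
    rw [show ((n : ℤ) + 1) = ((n + 1 : ℕ) : ℤ) by push_cast; rfl, oddExt_neg b (by omega)]
    push_cast
    rw [neg_pow]
    ring
  have hz : HasSum (fun m : ℤ => (m : ℚ⟦X⟧) ^ k * oddExt b m)
      (momentSum b k + ((0 : ℤ) : ℚ⟦X⟧) ^ k * oddExt b 0 + -(-1) ^ k * momentSum b k) :=
    HasSum.of_add_one_of_neg_add_one (f := fun m : ℤ => (m : ℚ⟦X⟧) ^ k * oddExt b m) hpos hneg
  rw [hat, umom_tsum hs, tsum_congr hterm, hz.tsum_eq, oddExt_zero]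
  split_ifs with hk
  · rw [hk.neg_one_pow]; ring
  · rw [(Nat.not_even_iff_odd.mp hk).neg_one_pow]; ring

theorem momentSum_lambertW (k : ℕ) : momentSum lambertW k = eis ℚ k - 2 * eisTwo k := by
  have h1 : momentSum lambertW k = ∑' b : ℕ, ∑' a : ℕ,
      C ((((b + 1 : ℕ) : ℚ)) ^ k * (-1) ^ (a + 1 + 1)) * X ^ ((b + 1) * (a + 1)) := by
    refine tsum_congr fun b => ?_
    have hs : Summable fun n : ℕ => (-X ^ (b + 1) : ℚ⟦X⟧) ^ (n + 1) := summable_lambertW b.succ_pos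
    rw [lambertW, ← tsum_neg, ← hs.neg.tsum_mul_left]
    refine tsum_congr fun a => ?_
    rw [neg_pow, ← pow_mul]
    simp only [map_mul, map_pow, map_neg, map_one, map_natCast]
    push_cast
    ring
  rw [h1, tsum_tsum_lambert (fun b a => (b : ℚ) ^ k * (-1) ^ (a + 1)), eisTwo]
  rw [show eis ℚ k = lambert fun b _ => (b : ℚ) ^ k by rw [eis, ← lambert_swap], expand_lambert,
    show (2 : ℚ⟦X⟧) = C (2 : ℚ) from (map_ofNat C 2).symm, ← lambert_const_mul, ← lambert_sub]
  congr 1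
  ext b a
  rcases Nat.even_or_odd a with ha | ha
  · rw [if_pos ha, ha.add_one.neg_one_pow]; ring
  · rw [if_neg (Nat.not_even_iff_odd.mpr ha), ha.add_one.neg_one_pow]; ring

/-- The constant in the Appell sum is determined by antisymmetry. -/
theorem exists_appell_constant : ∃ c : ℚ⟦X⟧, c = -appellTail (2 * c) 0 := by
  -- By `appellTail_eq_partialTheta` the condition is linear in c, namely c (1 + 2 `partialTheta 0`)
  -- = -4 `qD (partialTheta 0)`.
  have hu : IsUnit (1 + 2 * partialTheta 0 : ℚ⟦X⟧) := by
    refine isUnit_of_constantCoeff_eq_one ?_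
    have h0 : constantCoeff (partialTheta 0 : ℚ⟦X⟧) = 0 :=
      X_dvd_iff.mp ((dvd_of_eq (pow_one X).symm).trans (X_pow_dvd_partialTheta 0))
    rw [map_add, map_mul, h0, mul_zero, map_one, add_zero]
  obtain ⟨v, hv⟩ := hu.exists_right_inv
  refine ⟨v * (-4 * qD (partialTheta 0)), ?_⟩
  rw [appellTail_eq_partialTheta]
  push_cast
  linear_combination (-4 * qD (partialTheta 0)) * hv

end AppellMoments

/-! ### Moments of the transformed Appell-Lerch sum as quasimodular polynomials. -/

section AppellCrank

theorem sgnExp_ne_one : ((sgnExp 1 : ℚ⟦X⟧ˣ) : ℚ⟦X⟧) ≠ 1 := by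
  intro h
  have h1 := coeff_zpw 1 1 1
  rw [zpw, zpow_one, h, coeff_one] at h1
  norm_num at h1

theorem umom_zC_mul (m k : ℕ) (f : ℚ⟦X⟧⟦X⟧) :
    umom k (zC (sgnExp 1) m * f) = ∑ i ∈ Finset.range (k + 1),
      ((k.choose i : ℚ⟦X⟧) * (m : ℚ⟦X⟧) ^ i) * umom (k - i) f := by
  rw [umom_mul_range]
  refine Finset.sum_congr rfl fun i _ => ?_
  rw [umom_zC]
  push_cast
  rw [one_zpow]
  push_cast
  ring

theorem umom_hat_appellTail (c : ℚ⟦X⟧) (k : ℕ) :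
    umom k (hat (sgnExp 1) (oddExt (appellTail (lift c)))) =
      if Even k then 0 else 2 * momentSum (appellTail c) k :=
  umom_hat (fun _ => (lift_appellTail c _).symm) (X_pow_dvd_appellTail _) (X_pow_dvd_appellTail _) k

theorem umom_hat_lambertW (k : ℕ) :
    umom k (hat (sgnExp 1) (oddExt lambertW)) =
      if Even k then 0 else 2 * (eis ℚ k - 2 * eisTwo k) := by
  rw [← momentSum_lambertW]
  exact umom_hat (fun m => (lift_lambertW m.succ_pos).symm) X_pow_dvd_lambertW X_pow_dvd_lambertW k

/-- The square of Jacobi's formula for (q)_∞³. It comes out of `appell_crank_identity` at u = 0,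
where both sides reduce to twice the two series; only the square is needed. -/
theorem thetaMoment_sq : thetaMoment ℚ ^ 2 = euler ℚ ^ 6 := by
  obtain ⟨c, hc⟩ := exists_appell_constant
  have hc' : lift c = -appellTail (2 * lift c) 0 := by
    conv_lhs => rw [hc]
    rw [map_neg, lift_appellTail, map_mul, map_ofNat]
  have h := congrArg (umom 0) (appell_crank_identity (sgnExp 1) sgnExp_ne_one rfl hc')
  rw [← lift_euler, ← lift_thetaMoment, ← map_pow, ← map_pow, umom_lift_mul, mul_assoc, umom_lift_mul] at h
  have h0 : umom 0 (crankC (sgnExp 1)) = 1 := crankMom_zero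
  have hm : ∀ f g, umom 0 (f * g) = umom 0 f * umom 0 g := fun f g => by
    rw [umom_mul_range]; simp
  have h1 : umom 0 1 = 1 := umom_one 0
  have hz : ∀ m, umom 0 (zC (sgnExp 1) m) = 1 := fun m => by rw [umom_zC]; simp
  simp only [map_add, map_sub, hm, h0, h1, hz, umom_lift, if_true, pow_succ, pow_zero, sub_self, mul_zero] at h
  have : CharZero ℚ⟦X⟧ := algebraRat.charZero _
  refine mul_left_cancel₀ (two_ne_zero' ℚ⟦X⟧) ?_
  linear_combination -h

theorem appell_eq_crank {c : ℚ⟦X⟧} (hc : c = -appellTail (2 * c) 0) :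
    (1 - zC (sgnExp 1) 1) ^ 3 * hat (sgnExp 1) (oddExt (appellTail (lift (2 * c)))) + lift c +
        zC (sgnExp 1) 1 * (1 - lift c) + zC (sgnExp 1) 2 * (1 - lift c) + zC (sgnExp 1) 3 * lift c =
      crankC (sgnExp 1) ^ 2 * (zC (sgnExp 1) 1 + zC (sgnExp 1) 2 -
        2 * zC (sgnExp 1) 1 * (1 - zC (sgnExp 1) 1) * hat (sgnExp 1) (oddExt lambertW)) := by
  have hc' : lift c = -appellTail (lift (2 * c)) 0 := by
    conv_lhs => rw [hc]
    rw [map_neg, lift_appellTail]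
  have h := appell_crank_identity (sgnExp 1) sgnExp_ne_one (by rw [map_mul, map_ofNat]) hc'
  rw [← lift_thetaMoment, ← map_pow, thetaMoment_sq, map_pow, lift_euler, mul_assoc] at h
  have he : IsUnit (euler ℚ⟦X⟧) := isUnit_of_constantCoeff_eq_one constantCoeff_euler
  exact (he.pow 6).mul_left_cancel h

/-- The moments of the square of the crank function. -/
noncomputable def crankSqMom (k : ℕ) : ℚ⟦X⟧ :=
  ∑ i ∈ Finset.range (k + 1), (k.choose i : ℚ⟦X⟧) * (crankMom i * crankMom (k - i))

/-- The moments of the square of the crank function times the Lambert series. -/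
noncomputable def crankSqLambertMom (k : ℕ) : ℚ⟦X⟧ :=
  ∑ i ∈ Finset.range (k + 1), (k.choose i : ℚ⟦X⟧) * (crankSqMom i *
    if Even (k - i) then 0 else 2 * (eis ℚ (k - i) - 2 * eisTwo (k - i)))

/-- The weights 0^i - 3 + 3·2^i - 3^i are the moments of (1 - exp u)³; the other powers of 2 and 3
come from z² and z³. -/
theorem appell_eq_crank_moments {c : ℚ⟦X⟧} (hc : c = -appellTail (2 * c) 0) (k : ℕ) :
    (∑ i ∈ Finset.range (k + 1), ((k.choose i : ℚ⟦X⟧) * (0 ^ i - 3 + 3 * 2 ^ i - 3 ^ i)) *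
        (if Even (k - i) then 0 else 2 * momentSum (appellTail (2 * c)) (k - i))) +
      ((0 ^ k * c + (1 - c)) + (2 ^ k * (1 - c) + 3 ^ k * c)) =
    ∑ i ∈ Finset.range (k + 1), (k.choose i : ℚ⟦X⟧) *
      ((crankSqMom (k - i) - 2 * crankSqLambertMom (k - i)) +
        2 ^ i * (crankSqMom (k - i) + 2 * crankSqLambertMom (k - i))) := by
  have h := congrArg (umom k) (appell_eq_crank hc)
  set G := crankC (sgnExp 1) ^ 2 with hG
  set Φ := hat (sgnExp 1) (oddExt lambertW) with hΦ
  set Z := hat (sgnExp 1) (oddExt (appellTail (lift (2 * c)))) with hZ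
  have hg : ∀ j, umom j G = crankSqMom j := fun j => by
    rw [hG, sq, umom_mul_range]; rfl
  have hgp : ∀ j, umom j (G * Φ) = crankSqLambertMom j := fun j => by
    rw [umom_mul_range, crankSqLambertMom]
    simp only [hg, hΦ, umom_hat_lambertW]
  have hl : ∀ m : ℕ, ∀ f, umom k (zC (sgnExp 1) m * lift f) = (m : ℚ⟦X⟧) ^ k * f := fun m f => by
    rw [mul_comm, umom_lift_mul, umom_zC]
    push_cast
    rw [one_zpow]
    push_cast
    ring
  have h2 : zC (sgnExp 1) 2 = zC (sgnExp 1) 1 * zC (sgnExp 1) 1 := by rw [← zC_add]; rfl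
  have h3 : zC (sgnExp 1) 3 = zC (sgnExp 1) 1 * zC (sgnExp 1) 1 * zC (sgnExp 1) 1 := by
    rw [← zC_add, ← zC_add]; rfl
  have h0 : zC (sgnExp 1) 0 = 1 := zC_zero _
  have e1 : (1 - zC (sgnExp 1) 1) ^ 3 * Z = zC (sgnExp 1) (0 : ℕ) * Z - zC (sgnExp 1) (1 : ℕ) * (Z + Z + Z) +
      zC (sgnExp 1) (2 : ℕ) * (Z + Z + Z) - zC (sgnExp 1) (3 : ℕ) * Z := by
    push_cast
    rw [h2, h3, h0]
    ring
  have e2 : G * (zC (sgnExp 1) 1 + zC (sgnExp 1) 2 - 2 * zC (sgnExp 1) 1 * (1 - zC (sgnExp 1) 1) * Φ) =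
      zC (sgnExp 1) (1 : ℕ) * (G - (G * Φ + G * Φ)) + zC (sgnExp 1) (2 : ℕ) * (G + (G * Φ + G * Φ)) := by
    push_cast
    rw [h2]
    ring
  have e3 : lift c = zC (sgnExp 1) (0 : ℕ) * lift c := by push_cast; rw [h0, one_mul]
  obtain ⟨d, hd⟩ : ∃ d, d = 1 - c := ⟨_, rfl⟩
  have e4 : zC (sgnExp 1) 1 * (1 - lift c) = zC (sgnExp 1) (1 : ℕ) * lift d := by simp [hd]
  have e5 : zC (sgnExp 1) 2 * (1 - lift c) = zC (sgnExp 1) (2 : ℕ) * lift d := by simp [hd]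
  have e6 : zC (sgnExp 1) 3 * lift c = zC (sgnExp 1) (3 : ℕ) * lift c := by simp
  rw [e1, e2, e4, e5, e6] at h
  nth_rewrite 1 [e3] at h
  simp only [map_add, map_sub, hl] at h
  simp only [umom_zC_mul, map_add, map_sub, hg, hgp] at h
  simp only [hZ, umom_hat_appellTail] at h
  have hs : ∀ F : ℕ → ℚ⟦X⟧, (∑ i ∈ Finset.range (k + 1),
      ((k.choose i : ℚ⟦X⟧) * (0 ^ i - 3 + 3 * 2 ^ i - 3 ^ i)) * F i) =
      (∑ i ∈ Finset.range (k + 1), (k.choose i : ℚ⟦X⟧) * ((0 : ℕ) : ℚ⟦X⟧) ^ i * F i) -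
      (∑ i ∈ Finset.range (k + 1), (k.choose i : ℚ⟦X⟧) * ((1 : ℕ) : ℚ⟦X⟧) ^ i * (F i + F i + F i)) +
      (∑ i ∈ Finset.range (k + 1), (k.choose i : ℚ⟦X⟧) * ((2 : ℕ) : ℚ⟦X⟧) ^ i * (F i + F i + F i)) -
      ∑ i ∈ Finset.range (k + 1), (k.choose i : ℚ⟦X⟧) * ((3 : ℕ) : ℚ⟦X⟧) ^ i * F i := by
    intro F
    rw [← Finset.sum_sub_distrib, ← Finset.sum_add_distrib, ← Finset.sum_sub_distrib]
    refine Finset.sum_congr rfl fun i _ => ?_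
    push_cast
    rw [one_pow]
    ring
  have ht : (∑ i ∈ Finset.range (k + 1), (k.choose i : ℚ⟦X⟧) *
      ((crankSqMom (k - i) - 2 * crankSqLambertMom (k - i)) +
        2 ^ i * (crankSqMom (k - i) + 2 * crankSqLambertMom (k - i)))) =
      (∑ i ∈ Finset.range (k + 1), (k.choose i : ℚ⟦X⟧) * ((1 : ℕ) : ℚ⟦X⟧) ^ i *
        (crankSqMom (k - i) - (crankSqLambertMom (k - i) + crankSqLambertMom (k - i)))) +
      ∑ i ∈ Finset.range (k + 1), (k.choose i : ℚ⟦X⟧) * ((2 : ℕ) : ℚ⟦X⟧) ^ i *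
        (crankSqMom (k - i) + (crankSqLambertMom (k - i) + crankSqLambertMom (k - i))) := by
    rw [← Finset.sum_add_distrib]
    refine Finset.sum_congr rfl fun i _ => ?_
    push_cast
    rw [one_pow]
    ring
  rw [hs, ht, ← h, hd]
  push_cast
  simp only [one_pow, one_mul]
  ring

local notation "e₁" => eis ℚ 1
local notation "e₃" => eis ℚ 3
local notation "e₅" => eis ℚ 5
local notation "e₇" => eis ℚ 7
local notation "f₁" => eisTwo 1

theorem crankSqMom_one : crankSqMom 1 = 0 := by
  simp [crankSqMom, Finset.sum_range_succ, crankMom_one]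

theorem crankSqMom_three : crankSqMom 3 = 0 := by
  simp [crankSqMom, Finset.sum_range_succ, crankMom_one, crankMom_three]

theorem crankSqMom_five : crankSqMom 5 = 0 := by
  simp [crankSqMom, Finset.sum_range_succ, crankMom_one, crankMom_three, crankMom_five]

theorem crankSqMom_seven : crankSqMom 7 = 0 := by
  simp [crankSqMom, Finset.sum_range_succ, crankMom_one, crankMom_three, crankMom_five, crankMom_seven]

theorem crankSqMom_zero : crankSqMom 0 = 1 := by
  simp [crankSqMom, Nat.choose, crankMom_zero]

theorem crankSqMom_two : crankSqMom 2 = 4 * e₁ := by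
  simp [crankSqMom, Finset.sum_range_succ, Nat.choose, crankMom_zero, crankMom_one, crankMom_two]
  ring

theorem crankSqMom_four : crankSqMom 4 = 48 * e₁ ^ 2 + 4 * e₃ := by
  simp [crankSqMom, Finset.sum_range_succ, Nat.choose, crankMom_zero, crankMom_one, crankMom_two, crankMom_three, crankMom_four]
  ring

theorem crankSqMom_six : crankSqMom 6 = 960 * e₁ ^ 3 + 240 * e₁ * e₃ + 4 * e₅ := by
  simp [crankSqMom, Finset.sum_range_succ, Nat.choose, crankMom_zero, crankMom_one, crankMom_two, crankMom_three, crankMom_four, crankMom_five, crankMom_six]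
  ring

theorem crankSqMom_eight : crankSqMom 8 = 26880 * e₁ ^ 4 + 13440 * e₁ ^ 2 * e₃ + 448 * e₁ * e₅ + 560 * e₃ ^ 2 + 4 * e₇ := by
  simp [crankSqMom, Finset.sum_range_succ, Nat.choose, crankMom_zero, crankMom_one, crankMom_two, crankMom_three, crankMom_four, crankMom_five, crankMom_six, crankMom_seven, crankMom_eight]
  ring

/-- Since (1 - exp u)³ = O(u³), order 2 involves only `c`. Orders 4, 6, 8 then determine the moments
1, 3, 5 one after the other, each new one entering through the u³ term. -/
theorem appell_constant_eq {c : ℚ⟦X⟧} (hc : c = -appellTail (2 * c) 0) : c = 4 * e₁ - 4 * f₁ := by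
  have h := appell_eq_crank_moments hc 2
  simp [crankSqLambertMom, Finset.sum_range_succ, Nat.choose, Nat.even_iff, crankSqMom_zero, crankSqMom_one, crankSqMom_two] at h
  linear_combination (norm := algebra with ℚ) (1 / 4 : ℚ) • h

theorem momentSum_appellTail_one {c : ℚ⟦X⟧} (hc : c = -appellTail (2 * c) 0) :
    momentSum (appellTail (2 * c)) 1 = (-4 : ℚ) • (e₁ ^ 2) + (2 / 3 : ℚ) • e₁ + (8 : ℚ) • (f₁ ^ 2) + (-1 : ℚ) • f₁ +
    (-2 / 3 : ℚ) • e₃ := by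
  have h := appell_eq_crank_moments hc 4
  have hc' := appell_constant_eq hc
  simp [crankSqLambertMom, Finset.sum_range_succ, Nat.choose, Nat.even_iff,
    crankSqMom_zero, crankSqMom_one, crankSqMom_two, crankSqMom_three, crankSqMom_four] at h
  simp only [hc', eisTwo_three] at h ⊢
  linear_combination (norm := algebra with ℚ) (1 / -48 : ℚ) • h

theorem momentSum_appellTail_three {c : ℚ⟦X⟧} (hc : c = -appellTail (2 * c) 0) :
    momentSum (appellTail (2 * c)) 3 = (-32 / 35 : ℚ) • (e₁ ^ 3) + (-3168 / 35 : ℚ) • (e₁ ^ 2 * f₁) + (136 / 35 : ℚ) • (e₁ ^ 2) +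
    (6336 / 35 : ℚ) • (e₁ * f₁ ^ 2) + (-264 / 35 : ℚ) • (e₁ * f₁) +
    (-96 / 7 : ℚ) • (e₁ * e₃) + (-2 / 21 : ℚ) • e₁ + (-1984 / 35 : ℚ) • (f₁ ^ 3) +
    (-16 / 35 : ℚ) • (f₁ ^ 2) + (80 / 7 : ℚ) • (f₁ * e₃) + (9 / 35 : ℚ) • f₁ +
    (2 / 21 : ℚ) • e₃ := by
  have h := appell_eq_crank_moments hc 6
  have hc' := appell_constant_eq hc
  simp [crankSqLambertMom, Finset.sum_range_succ, Nat.choose, Nat.even_iff, momentSum_appellTail_one hc,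
    crankSqMom_zero, crankSqMom_one, crankSqMom_two, crankSqMom_three, crankSqMom_four, crankSqMom_five, crankSqMom_six] at h
  simp only [hc', eis_five, eisTwo_three, eisTwo_five] at h ⊢
  linear_combination (norm := algebra with ℚ) (1 / -240 : ℚ) • h

set_option maxHeartbeats 1000000 in
theorem momentSum_appellTail_five {c : ℚ⟦X⟧} (hc : c = -appellTail (2 * c) 0) :
    momentSum (appellTail (2 * c)) 5 = (4288 / 7 : ℚ) • (e₁ ^ 4) + (-34816 / 7 : ℚ) • (e₁ ^ 3 * f₁) + (736 / 7 : ℚ) • (e₁ ^ 3) +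
    (79104 / 7 : ℚ) • (e₁ ^ 2 * f₁ ^ 2) + (-320 : ℚ) • (e₁ ^ 2 * f₁) +
    (-2880 / 7 : ℚ) • (e₁ ^ 2 * e₃) + (-34 / 21 : ℚ) • (e₁ ^ 2) +
    (-10240 : ℚ) • (e₁ * f₁ ^ 3) + (2368 / 7 : ℚ) • (e₁ * f₁ ^ 2) +
    (3840 / 7 : ℚ) • (e₁ * f₁ * e₃) + (32 / 21 : ℚ) • (e₁ * f₁) + (80 / 7 : ℚ) • (e₁ * e₃) +
    (1 / 14 : ℚ) • e₁ + (27904 / 7 : ℚ) • (f₁ ^ 4) + (-1664 / 7 : ℚ) • (f₁ ^ 3) +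
    (-640 / 7 : ℚ) • (f₁ ^ 2 * e₃) + (52 / 7 : ℚ) • (f₁ ^ 2) + (-320 / 21 : ℚ) • (f₁ * e₃) +
    (-2 / 7 : ℚ) • f₁ + (-380 / 21 : ℚ) • (e₃ ^ 2) + (-1 / 14 : ℚ) • e₃ := by
  have h := appell_eq_crank_moments hc 8
  have hc' := appell_constant_eq hc
  simp [crankSqLambertMom, Finset.sum_range_succ, Nat.choose, Nat.even_iff, momentSum_appellTail_one hc, momentSum_appellTail_three hc,
    crankSqMom_zero, crankSqMom_one, crankSqMom_two, crankSqMom_three, crankSqMom_four, crankSqMom_five, crankSqMom_six, crankSqMom_seven, crankSqMom_eight] at h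
  simp only [hc', eis_five, eisTwo_three, eisTwo_five, eis_seven, eisTwo_seven] at h ⊢
  linear_combination (norm := algebra with ℚ) (1 / -672 : ℚ) • h

end AppellCrank

/-! ### Weighted generating functions of partitions. -/

section GeneratingFunctions

/-- The multisets of positive integers with sum `n`. -/
def partitionsOf (n : ℕ) : Finset (Multiset ℕ) := Finset.univ.image fun p : n.Partition => p.parts

theorem mem_partitionsOf {n : ℕ} {s : Multiset ℕ} :
    s ∈ partitionsOf n ↔ (∀ x ∈ s, 0 < x) ∧ s.sum = n := by
  rw [partitionsOf, Finset.mem_image]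
  constructor
  · rintro ⟨p, -, rfl⟩
    exact ⟨fun _ => p.parts_pos, p.parts_sum⟩
  · rintro ⟨h1, h2⟩
    exact ⟨⟨s, h1 _, h2⟩, Finset.mem_univ _, rfl⟩

variable {R : Type*} [CommRing R]

theorem sum_partitionsOf (n : ℕ) (ψ : Multiset ℕ → R) :
    ∑ p : n.Partition, ψ p.parts = ∑ s ∈ partitionsOf n, ψ s := by
  rw [partitionsOf, Finset.sum_image]
  intro p _ q _ h
  exact Nat.Partition.ext h

/-- The generating function of partitions, weighted by a function of the multiset of parts. -/
def gf (ψ : Multiset ℕ → R) : R⟦X⟧ := mk fun n => ∑ s ∈ partitionsOf n, ψ s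

theorem coeff_gf (ψ : Multiset ℕ → R) (n : ℕ) : coeff n (gf ψ) = ∑ s ∈ partitionsOf n, ψ s :=
  coeff_mk _ _

theorem gf_congr {ψ φ : Multiset ℕ → R} (h : ∀ s, (∀ x ∈ s, 0 < x) → ψ s = φ s) : gf ψ = gf φ := by
  ext n
  rw [coeff_gf, coeff_gf]
  exact Finset.sum_congr rfl fun s hs => h s (mem_partitionsOf.mp hs).1

theorem gf_add (ψ φ : Multiset ℕ → R) : gf (fun s => ψ s + φ s) = gf ψ + gf φ := by
  ext n
  simp only [coeff_gf, map_add, Finset.sum_add_distrib]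

theorem gf_sub (ψ φ : Multiset ℕ → R) : gf (fun s => ψ s - φ s) = gf ψ - gf φ := by
  ext n
  simp only [coeff_gf, map_sub, Finset.sum_sub_distrib]

theorem gf_const_mul (r : R) (ψ : Multiset ℕ → R) : gf (fun s => r * ψ s) = C r * gf ψ := by
  ext n
  simp only [coeff_gf, coeff_C_mul, Finset.mul_sum]

/-- Removing one copy of a prescribed part. -/
theorem gf_cons {a : ℕ} (ha : 0 < a) (ψ : Multiset ℕ → R) :
    gf (fun s => if a ∈ s then ψ s else 0) = X ^ a * gf fun s => ψ (a ::ₘ s) := by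
  ext n
  rw [coeff_gf, coeff_X_pow_mul', ← Finset.sum_filter]
  split_ifs with h
  · rw [coeff_gf]
    refine Finset.sum_bij' (fun s _ => s.erase a) (fun s _ => a ::ₘ s) ?_ ?_ ?_ ?_ ?_
    · intro s hs
      obtain ⟨h1, h2⟩ := Finset.mem_filter.mp hs
      obtain ⟨h3, h4⟩ := mem_partitionsOf.mp h1
      refine mem_partitionsOf.mpr ⟨fun x hx => h3 x (Multiset.mem_of_mem_erase hx), ?_⟩
      have := Multiset.sum_erase h2
      omega
    · intro s hs
      obtain ⟨h3, h4⟩ := mem_partitionsOf.mp hs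
      refine Finset.mem_filter.mpr ⟨mem_partitionsOf.mpr ⟨?_, ?_⟩, Multiset.mem_cons_self _ _⟩
      · intro x hx
        rcases Multiset.mem_cons.mp hx with rfl | hx
        exacts [ha, h3 x hx]
      · rw [Multiset.sum_cons, h4]; omega
    · intro s hs
      exact Multiset.cons_erase (Finset.mem_filter.mp hs).2
    · intro s _
      exact Multiset.erase_cons_head _ _
    · intro s hs
      rw [Multiset.cons_erase (Finset.mem_filter.mp hs).2]
  · refine Finset.sum_eq_zero fun s hs => ?_
    obtain ⟨h1, h2⟩ := Finset.mem_filter.mp hs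
    have := Multiset.le_sum_of_mem h2
    rw [(mem_partitionsOf.mp h1).2] at this
    exact absurd this h

theorem X_pow_dvd_gf {ψ : Multiset ℕ → R} {N : ℕ} (h : ∀ s, (∀ x ∈ s, 0 < x) → s.sum < N → ψ s = 0) :
    X ^ N ∣ gf ψ := by
  rw [X_pow_dvd_iff]
  intro n hn
  rw [coeff_gf]
  refine Finset.sum_eq_zero fun s hs => ?_
  obtain ⟨h1, h2⟩ := mem_partitionsOf.mp hs
  exact h s h1 (h2 ▸ hn)

theorem constantCoeff_gf (ψ : Multiset ℕ → R) : constantCoeff (gf ψ) = ψ 0 := by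
  rw [← coeff_zero_eq_constantCoeff_apply, coeff_gf, show partitionsOf 0 = {0} from ?_,
    Finset.sum_singleton]
  ext s
  rw [mem_partitionsOf, Finset.mem_singleton]
  constructor
  · rintro ⟨h1, h2⟩
    refine Multiset.eq_zero_of_forall_notMem fun x hx => ?_
    have := Multiset.le_sum_of_mem hx
    have := h1 x hx
    omega
  · rintro rfl
    simp

/-- Splitting a partition into the parts that satisfy a predicate and those that do not. -/
theorem gf_filter_mul (P : ℕ → Prop) [DecidablePred P] (φ χ : Multiset ℕ → R) :
    gf (fun s => φ (s.filter P) * χ (s.filter fun x => ¬P x)) =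
      gf (fun s => if ∀ x ∈ s, P x then φ s else 0) *
        gf (fun s => if ∀ x ∈ s, ¬P x then χ s else 0) := by
  ext n
  rw [coeff_gf, coeff_mul]
  simp only [coeff_gf, Finset.sum_mul_sum, ← Finset.sum_product', ite_mul, mul_ite, zero_mul, mul_zero]
  rw [Finset.sum_sigma']
  simp only [← ite_and, ← Finset.sum_filter]
  symm
  refine Finset.sum_bij' (fun x _ => x.2.1 + x.2.2)
    (fun s _ => ⟨((s.filter P).sum, (s.filter fun x => ¬P x).sum), (s.filter P, s.filter fun x => ¬P x)⟩)
    ?_ ?_ ?_ ?_ ?_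
  · rintro ⟨⟨i, j⟩, s, t⟩ h
    simp only [Finset.mem_filter, Finset.mem_sigma, Finset.HasAntidiagonal.mem_antidiagonal, Finset.mem_product,
      mem_partitionsOf] at h ⊢
    obtain ⟨⟨h1, ⟨h2, h3⟩, h4, h5⟩, h7, h6⟩ := h
    refine ⟨fun x hx => ?_, by rw [Multiset.sum_add, h3, h5, h1]⟩
    rcases Multiset.mem_add.mp hx with hx | hx
    exacts [h2 x hx, h4 x hx]
  · intro s h
    simp only [Finset.mem_filter, Finset.mem_sigma, Finset.HasAntidiagonal.mem_antidiagonal, Finset.mem_product,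
      mem_partitionsOf] at h ⊢
    refine ⟨⟨?_, ⟨fun x hx => h.1 x (Multiset.mem_of_mem_filter hx), trivial⟩,
      fun x hx => h.1 x (Multiset.mem_of_mem_filter hx), trivial⟩,
      fun x hx => (Multiset.mem_filter.mp hx).2, fun x hx => (Multiset.mem_filter.mp hx).2⟩
    rw [← Multiset.sum_add, Multiset.filter_add_not, h.2]
  · rintro ⟨⟨i, j⟩, s, t⟩ h
    simp only [Finset.mem_filter, Finset.mem_sigma, Finset.HasAntidiagonal.mem_antidiagonal, Finset.mem_product,
      mem_partitionsOf] at h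
    obtain ⟨⟨h1, ⟨h2, h3⟩, h4, h5⟩, h7, h6⟩ := h
    have e1 : (s + t).filter P = s := by
      rw [Multiset.filter_add, Multiset.filter_eq_self.mpr h6, Multiset.filter_eq_nil.mpr h7, add_zero]
    have e2 : (s + t).filter (fun x => ¬P x) = t := by
      rw [Multiset.filter_add, Multiset.filter_eq_self.mpr h7,
        Multiset.filter_eq_nil.mpr fun x hx => not_not.mpr (h6 x hx), zero_add]
    simp only [e1, e2, h3, h5]
  · intro s _
    exact Multiset.filter_add_not _ _
  · rintro ⟨⟨i, j⟩, s, t⟩ h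
    simp only [Finset.mem_filter, Finset.mem_sigma, Finset.HasAntidiagonal.mem_antidiagonal, Finset.mem_product,
      mem_partitionsOf] at h
    obtain ⟨-, h7, h6⟩ := h
    have e1 : (s + t).filter P = s := by
      rw [Multiset.filter_add, Multiset.filter_eq_self.mpr h6, Multiset.filter_eq_nil.mpr h7, add_zero]
    have e2 : (s + t).filter (fun x => ¬P x) = t := by
      rw [Multiset.filter_add, Multiset.filter_eq_self.mpr h7,
        Multiset.filter_eq_nil.mpr fun x hx => not_not.mpr (h6 x hx), zero_add]
    simp only [e1, e2]

theorem expand_gf (φ : Multiset ℕ → R) :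
    expand 2 two_ne_zero (gf φ) =
      gf fun s => if ∀ x ∈ s, Even x then φ (s.map fun x => x / 2) else 0 := by
  ext n
  rw [coeff_gf, ← Finset.sum_filter]
  have hmap : ∀ s : Multiset ℕ, (∀ x ∈ s, Even x) → (s.map fun x => x / 2).map (fun x => 2 * x) = s := by
    intro s hs
    rw [Multiset.map_map]
    conv_rhs => rw [← Multiset.map_id s]
    exact Multiset.map_congr rfl fun x hx => Nat.mul_div_cancel' (hs x hx).two_dvd
  rcases Nat.even_or_odd' n with ⟨k, rfl | rfl⟩
  · rw [coeff_expand_mul, coeff_gf]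
    refine Finset.sum_bij' (fun s _ => s.map fun x => 2 * x) (fun s _ => s.map fun x => x / 2) ?_ ?_ ?_ ?_ ?_
    · intro s hs
      obtain ⟨h1, h2⟩ := mem_partitionsOf.mp hs
      simp only [Finset.mem_filter, mem_partitionsOf, Multiset.mem_map, forall_exists_index, and_imp,
        forall_apply_eq_imp_iff₂, even_two_mul, implies_true, and_true]
      exact ⟨fun x hx => by have := h1 x hx; omega, by rw [Multiset.sum_map_mul_left, Multiset.map_id', h2]⟩
    · intro s hs
      obtain ⟨h0, h3⟩ := Finset.mem_filter.mp hs
      obtain ⟨h1, h2⟩ := mem_partitionsOf.mp h0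
      simp only [mem_partitionsOf, Multiset.mem_map, forall_exists_index, and_imp, forall_apply_eq_imp_iff₂]
      refine ⟨fun x hx => ?_, ?_⟩
      · have := h1 x hx
        obtain ⟨j, rfl⟩ := h3 x hx
        omega
      · have h4 := congrArg Multiset.sum (hmap s h3)
        rw [Multiset.sum_map_mul_left, Multiset.map_id', h2] at h4
        omega
    · intro s _
      rw [Multiset.map_map]
      simp
    · intro s hs
      exact hmap s (Finset.mem_filter.mp hs).2
    · intro s _
      congr 1
      rw [Multiset.map_map]
      simp
  · rw [coeff_expand_of_not_dvd _ _ _ (by omega), Finset.filter_false_of_mem, Finset.sum_empty]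
    intro s hs h3
    obtain ⟨h1, h2⟩ := mem_partitionsOf.mp hs
    have h4 := congrArg Multiset.sum (hmap s h3)
    rw [Multiset.sum_map_mul_left, h2] at h4
    omega

variable [TopologicalSpace R]

theorem summable_gf_fiber (ψ : Multiset ℕ → R) {κ : Multiset ℕ → ℕ}
    (hκ : ∀ s, (∀ x ∈ s, 0 < x) → κ s ≤ s.sum) :
    Summable fun j => gf fun s => if κ s = j then ψ s else 0 :=
  summable_of_X_pow_dvd (fun j => j) Set.finite_Iic fun j => X_pow_dvd_gf fun s hs hj => by
    rw [if_neg]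
    have := hκ s hs
    omega

/-- Splitting by a statistic bounded by the size: in each degree only finitely many fibres
contribute. -/
theorem gf_eq_tsum_fiber [T2Space R] (ψ : Multiset ℕ → R) {κ : Multiset ℕ → ℕ}
    (hκ : ∀ s, (∀ x ∈ s, 0 < x) → κ s ≤ s.sum) :
    gf ψ = ∑' j, gf fun s => if κ s = j then ψ s else 0 := by
  ext n
  rw [coeff_tsum (summable_gf_fiber ψ hκ), tsum_eq_sum (s := Finset.range (n + 1))]
  · simp only [coeff_gf]
    rw [Finset.sum_comm]
    refine Finset.sum_congr rfl fun s hs => ?_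
    obtain ⟨h1, h2⟩ := mem_partitionsOf.mp hs
    rw [Finset.sum_ite_eq, if_pos]
    have := hκ s h1
    rw [Finset.mem_range]
    omega
  · intro j hj
    rw [coeff_gf]
    refine Finset.sum_eq_zero fun s hs => ?_
    obtain ⟨h1, h2⟩ := mem_partitionsOf.mp hs
    have := hκ s h1
    rw [Finset.mem_range] at hj
    rw [if_neg (by omega)]

end GeneratingFunctions

/-! ### Overpartitions in a box and the rank. -/

section Rank

/-- The number of ways to overline parts of a partition. -/
def overWeight (s : Multiset ℕ) : ℚ := 2 ^ s.toFinset.card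

/-- The generating function of overpartitions. -/
noncomputable def overGf : ℚ⟦X⟧ := gf overWeight

/-- The generating function of overpartitions with bounded largest part and number of parts. -/
noncomputable def boxGf (l k : ℕ) : ℚ⟦X⟧ :=
  gf fun s => if largestPart s ≤ l ∧ s.card ≤ k then overWeight s else 0

theorem largestPart_le_iff {s : Multiset ℕ} {l : ℕ} : largestPart s ≤ l ↔ ∀ x ∈ s, x ≤ l :=
  Multiset.sup_le

theorem le_largestPart {s : Multiset ℕ} {x : ℕ} (h : x ∈ s) : x ≤ largestPart s :=
  Multiset.le_sup h

theorem largestPart_le_sum (s : Multiset ℕ) : largestPart s ≤ s.sum :=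
  largestPart_le_iff.mpr fun _ h => Multiset.le_sum_of_mem h

theorem card_le_sum {s : Multiset ℕ} (h : ∀ x ∈ s, 0 < x) : s.card ≤ s.sum := by
  simpa using Multiset.card_nsmul_le_sum h

theorem gf_eq_one {R : Type*} [CommRing R] {ψ : Multiset ℕ → R} (h0 : ψ 0 = 1)
    (h : ∀ s, (∀ x ∈ s, 0 < x) → s ≠ 0 → ψ s = 0) : gf ψ = 1 := by
  ext n
  rw [coeff_one]
  split_ifs with hn
  · rw [hn, coeff_zero_eq_constantCoeff_apply, constantCoeff_gf, h0]
  · rw [coeff_gf]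
    refine Finset.sum_eq_zero fun s hs => ?_
    obtain ⟨h1, h2⟩ := mem_partitionsOf.mp hs
    refine h s h1 ?_
    rintro rfl
    exact hn h2.symm

theorem boxGf_zero_left (k : ℕ) : boxGf 0 k = 1 := by
  refine gf_eq_one (by simp [largestPart, overWeight]) fun s hs h => if_neg fun hh => h ?_
  refine Multiset.eq_zero_of_forall_notMem fun x hx => ?_
  have := largestPart_le_iff.mp hh.1 x hx
  have := hs x hx
  omega

theorem boxGf_zero_right (l : ℕ) : boxGf l 0 = 1 := by
  refine gf_eq_one (by simp [largestPart, overWeight]) fun s hs h => if_neg fun hh => h ?_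
  exact Multiset.card_eq_zero.mp (Nat.le_zero.mp hh.2)

theorem overWeight_cons (a : ℕ) (s : Multiset ℕ) :
    overWeight (a ::ₘ s) = if a ∈ s then overWeight s else 2 * overWeight s := by
  rw [overWeight, Multiset.toFinset_cons]
  split_ifs with h
  · rw [Finset.insert_eq_of_mem (Multiset.mem_toFinset.mpr h), overWeight]
  · rw [Finset.card_insert_of_notMem (fun h' => h (Multiset.mem_toFinset.mp h')), pow_succ, overWeight,
      mul_comm]

theorem largestPart_le_succ_iff {s : Multiset ℕ} {l : ℕ} (h : l + 1 ∉ s) :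
    largestPart s ≤ l + 1 ↔ largestPart s ≤ l := by
  rw [largestPart_le_iff, largestPart_le_iff]
  refine forall₂_congr fun x hx => ?_
  have : x ≠ l + 1 := fun e => h (e ▸ hx)
  omega

theorem not_largestPart_le {s : Multiset ℕ} {l : ℕ} (h : l + 1 ∈ s) : ¬largestPart s ≤ l := by
  have := le_largestPart h
  omega

/-- One copy of the part l + 1 is removed, if there is one. Its removal halves the overlining weight
exactly when it was the last copy; the term with largest part at most l supplies the missing half.
-/
theorem boxGf_succ (l k : ℕ) : boxGf (l + 1) (k + 1) =
    boxGf l (k + 1) + X ^ (l + 1) * (boxGf (l + 1) k + boxGf l k) := by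
  have h1 : boxGf (l + 1) (k + 1) = boxGf l (k + 1) + gf fun s => if l + 1 ∈ s then
      (if largestPart s ≤ l + 1 ∧ s.card ≤ k + 1 then overWeight s else 0) else 0 := by
    rw [boxGf, boxGf, ← gf_add]
    refine gf_congr fun s _ => ?_
    by_cases h : l + 1 ∈ s
    · simp [h, not_largestPart_le h]
    · simp [h, largestPart_le_succ_iff h]
  rw [h1, gf_cons (a := l + 1) (Nat.succ_pos l), boxGf, boxGf, boxGf, ← gf_add]
  congr 2
  refine gf_congr fun s _ => ?_
  have h2 : largestPart ((l + 1) ::ₘ s) ≤ l + 1 ↔ largestPart s ≤ l + 1 := by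
    simp [largestPart_le_iff]
  simp only [h2, Multiset.card_cons, Nat.add_le_add_iff_right, overWeight_cons]
  by_cases h : l + 1 ∈ s
  · simp [h, not_largestPart_le h]
  · simp only [largestPart_le_succ_iff h, if_neg h]
    split_ifs <;> ring

/-- The conjugate recurrence, derived from the first by a double induction; symmetry of `boxGf` then
needs no bijection. -/
theorem boxGf_succ' (l k : ℕ) : boxGf (l + 1) (k + 1) =
    boxGf (l + 1) k + X ^ (k + 1) * (boxGf l (k + 1) + boxGf l k) := by
  induction l generalizing k with
  | zero =>
    induction k with
    | zero => rw [boxGf_succ]; simp [boxGf_zero_left, boxGf_zero_right]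
    | succ k ih =>
      simp only [boxGf_zero_left] at ih ⊢
      have h1 := boxGf_succ 0 (k + 1)
      have h2 := boxGf_succ 0 k
      simp only [boxGf_zero_left, zero_add, pow_one] at h1 h2 ih ⊢
      linear_combination h1 - h2 + X * ih
  | succ l ih =>
    induction k with
    | zero =>
      have h1 := boxGf_succ (l + 1) 0
      have h2 := ih 0
      have h3 := boxGf_succ l 0
      simp only [boxGf_zero_right, zero_add, pow_one] at h1 h2 h3 ⊢
      linear_combination h1 + h2 - X * h3
    | succ k ihk =>
      linear_combination boxGf_succ (l + 1) (k + 1) - boxGf_succ (l + 1) k + ih (k + 1) +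
        X ^ (l + 2) * (ihk + ih k) - X ^ (k + 2) * (boxGf_succ l (k + 1) + boxGf_succ l k)

theorem boxGf_comm (l k : ℕ) : boxGf l k = boxGf k l := by
  induction k generalizing l with
  | zero => rw [boxGf_zero_left, boxGf_zero_right]
  | succ k ihk =>
    induction l with
    | zero => rw [boxGf_zero_left, boxGf_zero_right]
    | succ l ihl => rw [boxGf_succ, boxGf_succ', ihl, ihk, ihk]

/-- The series `∑ q ^ k f (k + m) k`, where `f` is the generating function `boxGf`. -/
noncomputable def boxSum (m : ℕ) : ℚ⟦X⟧ := ∑' k, X ^ k * boxGf (k + m) k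

theorem summable_boxSum (m : ℕ) : Summable fun k => X ^ k * boxGf (k + m) k :=
  summable_of_X_pow_dvd (fun k => k) Set.finite_Iic fun _ => Dvd.intro _ rfl

/-- The generating function of overpartitions with rank at least a given positive number. -/
noncomputable def rankTail (m : ℕ) : ℚ⟦X⟧ := X ^ (m + 1) * (boxSum m + boxSum (m + 1))

/-- The summand counts largest part exactly k + m + 1 with at most k + 1 parts, that is, rank at
least m. -/
theorem hasSum_rankTail (m : ℕ) : HasSum
    (fun k => boxGf (k + m + 1) (k + 1) - boxGf (k + m) (k + 1)) (rankTail m) := by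
  have h := (((summable_boxSum m).hasSum.add (summable_boxSum (m + 1)).hasSum).mul_left (X ^ (m + 1)))
  refine HasSum.congr_fun (h : HasSum _ (rankTail m)) fun k => ?_
  rw [boxGf_succ (k + m) k, add_sub_cancel_left, ← add_assoc]
  ring

/-- The box grows along a staircase from (m + 2, 0). Raising the bound on the largest part adds a
summand of the rank tail at m + 2; raising the bound on the number of parts adds the other two, by
the conjugate recurrence. -/
theorem sum_boxGf (m N : ℕ) : boxGf (N + m + 2) N =
    ∑ k ∈ Finset.range N, (boxGf (k + (m + 2) + 1) (k + 1) - boxGf (k + (m + 2)) (k + 1)) +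
      ∑ k ∈ Finset.range (N + 1), X ^ k * boxGf (k + m) k +
      X * ∑ k ∈ Finset.range N, X ^ k * boxGf (k + (m + 1)) k := by
  induction N with
  | zero => simp [boxGf_zero_right]
  | succ N ih =>
    have h := boxGf_succ' (N + m + 1) N
    rw [show N + m + 1 + 1 = N + (m + 2) by ring] at h
    rw [show N + m + 2 = N + (m + 2) by ring] at ih
    rw [Finset.sum_range_succ, Finset.sum_range_succ (fun k => X ^ k * boxGf (k + m) k) (N + 1),
      Finset.sum_range_succ (fun k => X ^ k * boxGf (k + (m + 1)) k) N,
      show N + 1 + m + 2 = N + (m + 2) + 1 by ring, show N + 1 + m = N + m + 1 by ring,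
      show N + (m + 1) = N + m + 1 by ring]
    linear_combination ih + h

theorem tendsto_boxGf (m : ℕ) :
    Filter.Tendsto (fun N => boxGf (N + m) N) Filter.atTop (nhds overGf) := by
  refine tendsto_of_X_pow_dvd fun N => ?_
  rw [boxGf, overGf, ← gf_sub]
  refine X_pow_dvd_gf fun s hs h => ?_
  have h1 := largestPart_le_sum s
  have h2 := card_le_sum hs
  rw [if_pos ⟨by omega, by omega⟩, sub_self]

theorem overGf_eq (m : ℕ) : overGf = rankTail (m + 2) + boxSum m + X * boxSum (m + 1) := by
  refine tendsto_nhds_unique (tendsto_boxGf (m + 2)) ?_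
  have h1 := (hasSum_rankTail (m + 2)).tendsto_sum_nat
  have h2 := ((summable_boxSum m).hasSum.tendsto_sum_nat).comp (Filter.tendsto_add_atTop_nat 1)
  have h3 := ((summable_boxSum (m + 1)).hasSum.tendsto_sum_nat).const_mul X
  exact ((h1.add h2).add h3).congr fun N => (sum_boxGf m N).symm

/-- The sum of two consecutive rank tails is a partial theta series. -/
theorem rankTail_add (m : ℕ) :
    rankTail m + rankTail (m + 1) = -2 * (overGf * partialTheta m) := by
  -- Adding the decompositions of `overGf` at m and m + 1 gives K_m = q^{m+1}(2P - K_{m+2}) for the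
  -- sum K_m of consecutive tails.
  have hK : ∀ m, rankTail m + rankTail (m + 1) =
      X ^ (m + 1) * (2 * overGf - (rankTail (m + 2) + rankTail (m + 2 + 1))) := by
    intro m
    have h1 := overGf_eq m
    have h2 := overGf_eq (m + 1)
    rw [rankTail, rankTail]
    linear_combination -X ^ (m + 1) * h1 - X ^ (m + 1) * h2
  have hs : ∀ m, (partialTheta m : ℚ⟦X⟧) = -(X ^ (m + 1) * (1 + partialTheta (m + 2))) := by
    intro m
    have s0 : Summable (partialTerm m : ℕ → ℚ⟦X⟧) := summable_partialTerm m
    have s2 : Summable (partialTerm (m + 2) : ℕ → ℚ⟦X⟧) := summable_partialTerm (m + 2)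
    rw [partialTheta, s0.tsum_eq_zero_add, mul_add, partialTheta, ← s2.tsum_mul_left, neg_add, ← tsum_neg]
    congr 1
    · rw [partialTerm]; ring
    · refine tsum_congr fun n => ?_
      rw [partialTerm, partialTerm]
      ring
  -- Since -2P `partialTheta` obeys the same recurrence, the difference at m is ±q^{m+1} times the
  -- one at m + 2, hence divisible by every power of q.
  have hE : ∀ N m, X ^ N ∣ rankTail m + rankTail (m + 1) + 2 * (overGf * partialTheta m) := by
    intro N
    induction N with
    | zero => intro m; simp
    | succ N ih =>
      intro m
      have : rankTail m + rankTail (m + 1) + 2 * (overGf * partialTheta m) = X ^ (m + 1) *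
          -(rankTail (m + 2) + rankTail (m + 2 + 1) + 2 * (overGf * partialTheta (m + 2))) := by
        linear_combination hK m + 2 * overGf * hs m
      rw [this, pow_succ', pow_succ']
      exact mul_dvd_mul (Dvd.intro_left _ (mul_comm _ _)) (ih _).neg_right |>.trans (by
        rw [mul_assoc])
  have h := eq_zero_of_X_pow_dvd fun N => hE N m
  linear_combination h

/-- The generating function of the rank moments. -/
noncomputable def rankGf (k : ℕ) : ℚ⟦X⟧ :=
  gf fun s => overWeight s * ((largestPart s : ℚ) - s.card) ^ k

theorem eq_zero_of_card_eq {s : Multiset ℕ} (h : s.card = 0) : largestPart s = 0 := by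
  rw [Multiset.card_eq_zero.mp h]; rfl

theorem eq_zero_of_largestPart_eq {s : Multiset ℕ} (hs : ∀ x ∈ s, 0 < x) (h : largestPart s = 0) :
    s.card = 0 := by
  refine Multiset.card_eq_zero.mpr (Multiset.eq_zero_of_forall_notMem fun x hx => ?_)
  have := le_largestPart hx
  have := hs x hx
  omega

theorem gf_rank_ge {m : ℕ} (hm : 0 < m) :
    (gf fun s => if m + s.card ≤ largestPart s then overWeight s else 0) = rankTail m := by
  rw [gf_eq_tsum_fiber _ (κ := fun s => largestPart s - (m + 1)) fun s _ =>
    (Nat.sub_le _ _).trans (largestPart_le_sum s), ← (hasSum_rankTail m).tsum_eq]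
  refine tsum_congr fun k => ?_
  rw [boxGf, boxGf, ← gf_sub]
  refine gf_congr fun s hs => ?_
  have h1 := @eq_zero_of_card_eq s
  have h2 := eq_zero_of_largestPart_eq hs
  rw [← ite_and]
  by_cases h : largestPart s - (m + 1) = k ∧ m + s.card ≤ largestPart s
  · rw [if_pos h, if_pos (by omega), if_neg (by omega), sub_zero]
  · rw [if_neg h]
    by_cases h' : largestPart s ≤ k + m ∧ s.card ≤ k + 1
    · rw [if_pos h', if_pos (by omega), sub_self]
    · rw [if_neg h', if_neg (by omega), sub_self]

/-- The symmetry of the rank distribution enters here, through `boxGf_comm`. -/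
theorem gf_rank_le {m : ℕ} (hm : 0 < m) :
    (gf fun s => if m + largestPart s ≤ s.card then overWeight s else 0) = rankTail m := by
  rw [gf_eq_tsum_fiber _ (κ := fun s => s.card - (m + 1)) fun s hs =>
    (Nat.sub_le _ _).trans (card_le_sum hs), ← (hasSum_rankTail m).tsum_eq]
  refine tsum_congr fun k => ?_
  rw [boxGf_comm, boxGf_comm (k + m), boxGf, boxGf, ← gf_sub]
  refine gf_congr fun s hs => ?_
  have h1 := @eq_zero_of_card_eq s
  have h2 := eq_zero_of_largestPart_eq hs
  rw [← ite_and]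
  by_cases h : s.card - (m + 1) = k ∧ m + largestPart s ≤ s.card
  · rw [if_pos h, if_pos (by omega), if_neg (by omega), sub_zero]
  · rw [if_neg h]
    by_cases h' : largestPart s ≤ k + 1 ∧ s.card ≤ k + m
    · rw [if_pos h', if_pos (by omega), sub_self]
    · rw [if_neg h', if_neg (by omega), sub_self]

theorem X_pow_dvd_rankTail (m : ℕ) : X ^ (m + 1) ∣ rankTail m := Dvd.intro _ rfl

theorem summable_mul_rankTail (g : ℕ → ℚ⟦X⟧) (j : ℕ) : Summable fun m => g m * rankTail (m + j) :=
  summable_of_X_pow_dvd (fun m => m) Set.finite_Iic fun m =>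
    ((pow_dvd_pow _ (by omega)).trans (X_pow_dvd_rankTail (m + j))).mul_left _

theorem sum_range_pow_sub_pow {k : ℕ} (hk : k ≠ 0) (n : ℕ) :
    ∑ m ∈ Finset.range n, (((m : ℚ) + 1) ^ k - (m : ℚ) ^ k) = (n : ℚ) ^ k := by
  have := Finset.sum_range_sub (fun m : ℕ => (m : ℚ) ^ k) n
  push_cast at this
  rw [this, zero_pow hk, sub_zero]

/-- Summation by parts, r^k = ∑_{m<r} ((m+1)^k - m^k), applied to |r|. As k is even, positive and
negative ranks contribute equally; rank 0 contributes nothing since k ≠ 0. -/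
theorem rankGf_eq_tsum {k : ℕ} (hk : k ≠ 0) (hk2 : Even k) :
    rankGf k = 2 * ∑' m : ℕ, (((m : ℚ⟦X⟧) + 1) ^ k - (m : ℚ⟦X⟧) ^ k) * rankTail (m + 1) := by
  have hs := summable_mul_rankTail (fun m => ((m : ℚ⟦X⟧) + 1) ^ k - (m : ℚ⟦X⟧) ^ k) 1
  ext n
  rw [two_mul, map_add, coeff_tsum hs, tsum_eq_sum (s := Finset.range n)]
  · have hc : ∀ m : ℕ, (((m : ℚ⟦X⟧) + 1) ^ k - (m : ℚ⟦X⟧) ^ k) = C (((m : ℚ) + 1) ^ k - (m : ℚ) ^ k) := by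
      intro m; simp
    have h1 : ∀ m : ℕ, coeff n ((((m : ℚ⟦X⟧) + 1) ^ k - (m : ℚ⟦X⟧) ^ k) * rankTail (m + 1)) =
        ∑ s ∈ partitionsOf n, overWeight s * if m + 1 + s.card ≤ largestPart s then
          (((m : ℚ) + 1) ^ k - (m : ℚ) ^ k) else 0 := by
      intro m
      rw [hc, coeff_C_mul, ← gf_rank_ge m.succ_pos, coeff_gf, Finset.mul_sum]
      refine Finset.sum_congr rfl fun s _ => ?_
      split_ifs <;> ring
    have h2 : ∀ m : ℕ, coeff n ((((m : ℚ⟦X⟧) + 1) ^ k - (m : ℚ⟦X⟧) ^ k) * rankTail (m + 1)) =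
        ∑ s ∈ partitionsOf n, overWeight s * if m + 1 + largestPart s ≤ s.card then
          (((m : ℚ) + 1) ^ k - (m : ℚ) ^ k) else 0 := by
      intro m
      rw [hc, coeff_C_mul, ← gf_rank_le m.succ_pos, coeff_gf, Finset.mul_sum]
      refine Finset.sum_congr rfl fun s _ => ?_
      split_ifs <;> ring
    nth_rewrite 1 [Finset.sum_congr rfl fun m _ => h1 m]
    rw [Finset.sum_congr rfl fun m _ => h2 m, Finset.sum_comm, Finset.sum_comm (s := Finset.range n),
      rankGf, coeff_gf, ← Finset.sum_add_distrib]
    refine Finset.sum_congr rfl fun s hs => ?_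
    obtain ⟨h3, h4⟩ := mem_partitionsOf.mp hs
    have h5 := largestPart_le_sum s
    have h6 := card_le_sum h3
    rw [← Finset.mul_sum, ← Finset.mul_sum, ← mul_add]
    congr 1
    rw [← Finset.sum_filter, ← Finset.sum_filter]
    have e1 : (Finset.range n).filter (fun m => m + 1 + s.card ≤ largestPart s) =
        Finset.range (largestPart s - s.card) := by
      ext m; simp only [Finset.mem_filter, Finset.mem_range]; omega
    have e2 : (Finset.range n).filter (fun m => m + 1 + largestPart s ≤ s.card) =
        Finset.range (s.card - largestPart s) := by
      ext m; simp only [Finset.mem_filter, Finset.mem_range]; omega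
    rw [e1, e2, sum_range_pow_sub_pow hk, sum_range_pow_sub_pow hk]
    rcases le_total s.card (largestPart s) with h | h
    · rw [Nat.sub_eq_zero_of_le h, Nat.cast_sub h, Nat.cast_zero, zero_pow hk, add_zero]
    · rw [Nat.sub_eq_zero_of_le h, Nat.cast_sub h, Nat.cast_zero, zero_pow hk, zero_add, ← hk2.neg_pow,
        neg_sub]
  · intro m hm
    rw [Finset.mem_range] at hm
    exact X_pow_dvd_iff.mp ((X_pow_dvd_rankTail (m + 1)).mul_left _) n (by omega)

/-- Writing the differences as g(m+1) + g(m) pairs consecutive rank tails, so that `rankTail_add`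
applies; g(0) = 0 removes the boundary term. -/
theorem rankGf_eq {k : ℕ} (hk : k ≠ 0) (hk2 : Even k) {g : ℕ → ℚ⟦X⟧} (h0 : g 0 = 0)
    (hg : ∀ m : ℕ, ((m : ℚ⟦X⟧) + 1) ^ k - (m : ℚ⟦X⟧) ^ k = g (m + 1) + g m) :
    rankGf k = -4 * overGf * ∑' m : ℕ, g (m + 1) * partialTheta (m + 1) := by
  have hs0 := summable_mul_rankTail g 1
  have hs1 := summable_mul_rankTail (fun m => g (m + 1)) 1
  have hs2 := summable_mul_rankTail (fun m => g (m + 1)) 2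
  have hp : Summable fun m : ℕ => g (m + 1) * (partialTheta (m + 1) : ℚ⟦X⟧) :=
    summable_of_X_pow_dvd (fun m => m) Set.finite_Iic fun m =>
      ((pow_dvd_pow _ (by omega)).trans (X_pow_dvd_partialTheta (m + 1))).mul_left _
  have h1 : ∑' m : ℕ, g m * rankTail (m + 1) = ∑' m : ℕ, g (m + 1) * rankTail (m + 2) := by
    rw [hs0.tsum_eq_zero_add, h0, zero_mul, zero_add]
  rw [rankGf_eq_tsum hk hk2]
  simp only [hg, add_mul]
  rw [hs1.tsum_add hs0, h1, ← hs1.tsum_add hs2, ← hp.tsum_mul_left, ← (hs1.add hs2).tsum_mul_left]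
  refine tsum_congr fun m => ?_
  linear_combination 2 * g (m + 1) * rankTail_add (m + 1)

end Rank

/-! ### The generating function of the crank. -/

section CrankGeneratingFunction

variable {R : Type*} [CommRing R]

/-- The generating function of partitions with parts larger than `j`, by number of parts. -/
def tailGf (z : Rˣ) (j : ℕ) : R⟦X⟧ := gf fun s => if ∀ x ∈ s, j < x then zpw z s.card else 0

/-- The generating function of partitions with parts larger than `j`, by number of parts larger
than `w`. -/
def upperGf (z : Rˣ) (w j : ℕ) : R⟦X⟧ :=
  gf fun s => if ∀ x ∈ s, j < x then zpw z (s.filter (w < ·)).card else 0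

theorem zpw_add (z : Rˣ) (k l : ℤ) : zpw z (k + l) = zpw z k * zpw z l := by
  simp [zpw, zpow_add]

theorem zpw_zero (z : Rˣ) : zpw z 0 = 1 := by simp [zpw]

theorem forall_lt_and_notMem {s : Multiset ℕ} {j : ℕ} :
    (∀ x ∈ s, j + 1 < x) ↔ (∀ x ∈ s, j < x) ∧ j + 1 ∉ s := by
  constructor
  · exact fun h => ⟨fun x hx => by have := h x hx; omega, fun hm => by have := h _ hm; omega⟩
  · rintro ⟨h1, h2⟩ x hx
    have h3 := h1 x hx
    have h4 : x ≠ j + 1 := fun e => h2 (e ▸ hx)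
    omega

theorem gf_lower_step (φ : Multiset ℕ → R) (j : ℕ) :
    (gf fun s => if ∀ x ∈ s, j < x then φ s else 0) =
      (gf fun s => if ∀ x ∈ s, j + 1 < x then φ s else 0) +
        X ^ (j + 1) * gf fun s => if ∀ x ∈ s, j < x then φ ((j + 1) ::ₘ s) else 0 := by
  have h1 : (gf fun s => if ∀ x ∈ s, j < x then φ s else 0) =
      (gf fun s => if ∀ x ∈ s, j + 1 < x then φ s else 0) +
        gf fun s => if j + 1 ∈ s then (if ∀ x ∈ s, j < x then φ s else 0) else 0 := by
    rw [← gf_add]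
    refine gf_congr fun s _ => ?_
    by_cases h : j + 1 ∈ s
    · simp [forall_lt_and_notMem, h]
    · simp [forall_lt_and_notMem, h]
  rw [h1, gf_cons (a := j + 1) (Nat.succ_pos j)]
  congr 2
  refine gf_congr fun s _ => ?_
  simp [Multiset.mem_cons]

theorem tailGf_step (z : Rˣ) (j : ℕ) :
    (1 - zC z 1 * X ^ (j + 1)) * tailGf z j = tailGf z (j + 1) := by
  have h := gf_lower_step (fun s => zpw z s.card) j
  have h2 : (gf fun s => if ∀ x ∈ s, j < x then zpw z ((j + 1) ::ₘ s).card else 0) =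
      zC z 1 * tailGf z j := by
    rw [← C_zpw, tailGf, ← gf_const_mul]
    refine gf_congr fun s _ => ?_
    rw [mul_ite, mul_zero, Multiset.card_cons]
    congr 1
    push_cast
    rw [zpw_add, mul_comm]
  rw [h2] at h
  rw [tailGf] at h ⊢
  rw [tailGf]
  linear_combination h

theorem upperGf_step (z : Rˣ) {w j : ℕ} (hj : j < w) :
    (1 - X ^ (j + 1)) * upperGf z w j = upperGf z w (j + 1) := by
  have h := gf_lower_step (fun s => zpw z (s.filter (w < ·)).card) j
  have h2 : (gf fun s => if ∀ x ∈ s, j < x then zpw z (((j + 1) ::ₘ s).filter (w < ·)).card else 0) =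
      upperGf z w j := by
    refine gf_congr fun s _ => ?_
    rw [Multiset.filter_cons_of_neg _ (by omega)]
  rw [h2] at h
  rw [upperGf] at h ⊢
  rw [upperGf]
  linear_combination h

theorem upperGf_self (z : Rˣ) (w : ℕ) : upperGf z w w = tailGf z w := by
  refine gf_congr fun s _ => ?_
  split_ifs with h
  · rw [Multiset.filter_eq_self.mpr h]
  · rfl

theorem eulerFin_mul_upperGf (z : Rˣ) {w j : ℕ} (hj : j + 1 ≤ w) :
    eulerFin R (j + 1) * upperGf z w 1 = (1 - X) * upperGf z w (j + 1) := by
  induction j with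
  | zero => rw [eulerFin_succ, eulerFin_zero, zero_add, pow_one, one_mul]
  | succ j ih =>
    rw [eulerFin_succ, ← upperGf_step z (show j + 1 < w by omega)]
    linear_combination (1 - X ^ (j + 1 + 1)) * ih (by omega)

/-- The parts 2, …, w + 1 carry no power of z and contribute (1 - q)/(q)_{w+1}; the larger ones form
`tailGf`. -/
theorem upperGf_one (z : Rˣ) (w : ℕ) :
    upperGf z (w + 1) 1 = (1 - X) * eulerInv R (w + 1) * tailGf z (w + 1) := by
  have h := eulerFin_mul_upperGf z (le_refl (w + 1))
  rw [upperGf_self] at h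
  linear_combination eulerInv R (w + 1) * h - upperGf z (w + 1) 1 * eulerFin_mul_inv R (w + 1)

theorem gf_count_one (φ : Multiset ℕ → R) (w : ℕ) :
    (gf fun s => if s.count 1 = w then φ s else 0) =
      X ^ w * gf fun s => if ∀ x ∈ s, 1 < x then φ (s + Multiset.replicate w 1) else 0 := by
  induction w generalizing φ with
  | zero =>
    rw [pow_zero, one_mul]
    refine gf_congr fun s hs => ?_
    have : (∀ x ∈ s, 1 < x) ↔ Multiset.count 1 s = 0 := by
      rw [forall_lt_and_notMem (j := 0), Multiset.count_eq_zero]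
      exact and_iff_right hs
    simp [this]
  | succ w ih =>
    have h1 : (gf fun s => if s.count 1 = w + 1 then φ s else 0) =
        gf fun s => if 1 ∈ s then (if s.count 1 = w + 1 then φ s else 0) else 0 := by
      refine gf_congr fun s _ => ?_
      by_cases h : 1 ∈ s
      · simp [h]
      · simp [h]
    rw [h1, gf_cons one_pos]
    simp only [Multiset.count_cons_self, Nat.add_right_cancel_iff]
    rw [ih fun s => φ (1 ::ₘ s), pow_succ', pow_one, mul_assoc]
    simp only [Multiset.replicate_succ, Multiset.add_cons]

theorem gf_crank_count (z : Rˣ) (w : ℕ) :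
    (gf fun s => if s.count 1 = w + 1 then zpw z (agCrank s) else 0) =
      X ^ (w + 1) * (zC z (-((w + 1 : ℕ) : ℤ)) * ((1 - X) * eulerInv R (w + 1) * tailGf z (w + 1))) := by
  rw [gf_count_one, ← upperGf_one, upperGf, ← C_zpw, ← gf_const_mul]
  congr 1
  refine gf_congr fun s _ => ?_
  rw [mul_ite, mul_zero]
  split_ifs with h
  · have hc : s.count 1 = 0 := Multiset.count_eq_zero.mpr fun h1 => absurd (h 1 h1) (lt_irrefl 1)
    have h1 : (s + Multiset.replicate (w + 1) 1).count 1 = w + 1 := by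
      rw [Multiset.count_add, hc, Multiset.count_replicate_self, zero_add]
    have h2 : (s + Multiset.replicate (w + 1) 1).filter (fun x => w + 1 < x) = s.filter (w + 1 < ·) := by
      have hr : (Multiset.replicate (w + 1) 1).filter (fun x => w + 1 < x) = 0 :=
        Multiset.filter_eq_nil.mpr fun x hx => by
          rw [Multiset.eq_of_mem_replicate hx]
          omega
      rw [Multiset.filter_add, hr, add_zero]
    rw [agCrank, if_neg (by omega), h1, h2, ← zpw_add]
    congr 1
  · rfl

/-- The generating function of partitions with parts between `2` and `L`. -/
def middleGf (R : Type*) [CommRing R] (L : ℕ) : R⟦X⟧ :=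
  gf fun s => if (∀ x ∈ s, 1 < x) ∧ largestPart s ≤ L then 1 else 0

theorem middleGf_one : middleGf R 1 = 1 := by
  refine gf_eq_one (by simp [largestPart]) fun s _ hs => if_neg fun h => hs ?_
  refine Multiset.eq_zero_of_forall_notMem fun x hx => ?_
  have h1 := h.1 x hx
  have h2 := largestPart_le_iff.mp h.2 x hx
  omega

theorem gf_largestPart_eq (L : ℕ) :
    (gf fun s => if (∀ x ∈ s, 1 < x) ∧ largestPart s = L + 2 then (1 : R) else 0) =
      X ^ (L + 2) * middleGf R (L + 2) := by
  have h1 : (gf fun s => if (∀ x ∈ s, 1 < x) ∧ largestPart s = L + 2 then (1 : R) else 0) =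
      gf fun s => if L + 2 ∈ s then
        (if (∀ x ∈ s, 1 < x) ∧ largestPart s ≤ L + 2 then 1 else 0) else 0 := by
    refine gf_congr fun s _ => ?_
    by_cases h : L + 2 ∈ s
    · have := le_largestPart h
      simp only [h, if_true]
      congr 2
      exact propext ⟨le_of_eq, fun h' => le_antisymm h' this⟩
    · rw [if_neg h, if_neg]
      rintro ⟨-, h2⟩
      have := (largestPart_le_succ_iff (l := L + 1) h).mp h2.le
      omega
  rw [h1, gf_cons (a := L + 2) (by omega), middleGf]
  congr 1
  refine gf_congr fun s _ => ?_
  simp only [largestPart_le_iff, Multiset.mem_cons, forall_eq_or_imp, le_refl, true_and]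
  simp

theorem middleGf_succ (L : ℕ) : (1 - X ^ (L + 2)) * middleGf R (L + 2) = middleGf R (L + 1) := by
  have h : middleGf R (L + 2) = middleGf R (L + 1) + X ^ (L + 2) * middleGf R (L + 2) := by
    conv_lhs => rw [middleGf]
    rw [← gf_largestPart_eq, middleGf, ← gf_add]
    refine gf_congr fun s _ => ?_
    by_cases h : largestPart s = L + 2
    · simp [h]
    · have : largestPart s ≤ L + 2 ↔ largestPart s ≤ L + 1 := by omega
      simp [h, this]
  linear_combination h

theorem middleGf_eq (L : ℕ) : middleGf R (L + 1) = (1 - X) * eulerInv R (L + 1) := by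
  have h : ∀ L, eulerFin R (L + 1) * middleGf R (L + 1) = 1 - X := by
    intro L
    induction L with
    | zero => rw [eulerFin_succ, eulerFin_zero, zero_add, middleGf_one, pow_one, one_mul, mul_one]
    | succ L ih => rw [eulerFin_succ, mul_assoc, middleGf_succ, ih]
  linear_combination eulerInv R (L + 1) * h L - middleGf R (L + 1) * eulerFin_mul_inv R (L + 1)

theorem gf_singleton_one (r : R) : (gf fun s => if s = {1} then r else 0) = C r * X := by
  ext n
  rw [coeff_gf, coeff_C_mul, coeff_X, ← Finset.sum_filter]
  by_cases hn : n = 1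
  · rw [if_pos hn, mul_one, Finset.sum_filter, Finset.sum_ite_eq', if_pos]
    rw [mem_partitionsOf, hn]
    simp
  · rw [if_neg hn, mul_zero, Finset.filter_false_of_mem, Finset.sum_empty]
    rintro s hs rfl
    have := (mem_partitionsOf.mp hs).2
    simp at this
    omega

/-- The modified crank weight of a partition. -/
def crankZ (z : Rˣ) (s : Multiset ℕ) : R :=
  if s = {1} then zpw z 1 + zpw z (-1) - 1 else zpw z (agCrank s)

/-- The unmodified crank of the partition 1 is -1, so the modification adds z + z^{-1} - 1 - z^{-1}
= z - 1 in degree one. -/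
theorem gf_crankZ (z : Rˣ) :
    gf (crankZ z) = gf (fun s => zpw z (agCrank s)) + (zC z 1 - 1) * X := by
  rw [← C_zpw, ← map_one C, ← map_sub, ← gf_singleton_one, ← gf_add]
  refine gf_congr fun s _ => ?_
  rw [crankZ]
  split_ifs with h
  · have : agCrank {1} = -1 := by decide
    rw [h, this]
    ring
  · rw [add_zero]

variable [TopologicalSpace R]

/-- Euler's series for the generating function `tailGf`. -/
noncomputable def eulerSeries (z : Rˣ) (j : ℕ) : R⟦X⟧ :=
  ∑' m : ℕ, zC z m * X ^ (m * (j + 1)) * eulerInv R m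

theorem summable_eulerSeries (z : Rˣ) (j : ℕ) :
    Summable fun m : ℕ => zC z m * X ^ (m * (j + 1)) * eulerInv R m :=
  summable_of_X_pow_dvd (fun m => m * (j + 1))
    (fun N => (Set.finite_Iic N).subset fun m (hm : m * (j + 1) ≤ N) => by
      simp only [Set.mem_Iic]; nlinarith [Nat.zero_le (m * j)])
    fun _ => Dvd.dvd.mul_right (Dvd.intro_left _ rfl) _

variable [IsTopologicalRing R] [T2Space R]

theorem eulerSeries_step (z : Rˣ) (j : ℕ) :
    (1 - zC z 1 * X ^ (j + 1)) * eulerSeries z j = eulerSeries z (j + 1) := by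
  have h0 := summable_eulerSeries z j
  have h1 := summable_eulerSeries z (j + 1)
  have h : eulerSeries z j - eulerSeries z (j + 1) = zC z 1 * X ^ (j + 1) * eulerSeries z j := by
    have hs : Summable fun m : ℕ => zC z m * X ^ (m * (j + 1)) * eulerInv R m -
      zC z m * X ^ (m * (j + 1 + 1)) * eulerInv R m := h0.sub h1
    rw [eulerSeries, eulerSeries, ← h0.tsum_sub h1, ← h0.tsum_mul_left, hs.tsum_eq_zero_add]
    simp only [zero_mul, pow_zero, sub_self, zero_add]
    refine tsum_congr fun m => ?_
    rw [← eulerInv_succ R m]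
    push_cast
    rw [zC_add]
    ring
  linear_combination h

theorem X_pow_dvd_eulerSeries (z : Rˣ) (j : ℕ) : X ^ (j + 1) ∣ eulerSeries z j - 1 := by
  have h0 := summable_eulerSeries z j
  rw [eulerSeries, h0.tsum_eq_zero_add]
  simp only [Nat.cast_zero, zC_zero, zero_mul, pow_zero, one_mul, eulerInv_zero]
  rw [add_sub_cancel_left]
  refine X_pow_dvd_tsum _ fun m => Dvd.dvd.mul_right (Dvd.dvd.mul_left (pow_dvd_pow _ ?_) _) _
  nlinarith

omit [TopologicalSpace R] [IsTopologicalRing R] [T2Space R] in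
theorem X_pow_dvd_tailGf (z : Rˣ) (j : ℕ) : X ^ (j + 1) ∣ tailGf z j - 1 := by
  have h : (gf fun s => if s = 0 then (1 : R) else 0) = 1 :=
    gf_eq_one (if_pos rfl) fun s _ hs => if_neg hs
  rw [← h, tailGf, ← gf_sub]
  refine X_pow_dvd_gf fun s hs hlt => ?_
  by_cases h0 : s = 0
  · simp [h0, zpw_zero]
  · rw [if_neg h0, if_neg, sub_zero]
    intro h1
    obtain ⟨x, hx⟩ := Multiset.exists_mem_of_ne_zero h0
    have h2 := h1 x hx
    have h3 := Multiset.le_sum_of_mem hx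
    omega

/-- Euler's expansion: both sides satisfy the same recurrence in `j` with a unit factor, and both
tend to 1 as `j` grows. -/
theorem tailGf_eq_eulerSeries (z : Rˣ) (j : ℕ) : tailGf z j = eulerSeries z j := by
  have h : ∀ N j, X ^ (j + 1 + N) ∣ tailGf z j - eulerSeries z j := by
    intro N
    induction N with
    | zero =>
      intro j
      have := (X_pow_dvd_tailGf z j).sub (X_pow_dvd_eulerSeries z j)
      rwa [sub_sub_sub_cancel_right] at this
    | succ N ih =>
      intro j
      have hu : IsUnit (1 - zC z 1 * X ^ (j + 1)) :=
        isUnit_of_constantCoeff_eq_one (by simp)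
      have h1 := ih (j + 1)
      rw [← tailGf_step, ← eulerSeries_step, ← mul_sub, hu.dvd_mul_left] at h1
      rwa [show j + 1 + (N + 1) = j + 1 + 1 + N by ring]
  refine sub_eq_zero.mp (eq_zero_of_X_pow_dvd fun N => (pow_dvd_pow _ ?_).trans (h N j))
  omega

/-- The partitions without parts equal to one, weighted by the largest part. -/
theorem gf_crank_zero (z : Rˣ) :
    (gf fun s => if s.count 1 = 0 then zpw z (agCrank s) else 0) =
      (1 - X) * eulerSeries z 0 + X - zC z 1 * X := by
  -- The uniform formula fails only for L = 0, where 1 - q must become 1, and for L = 1, where no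
  -- partition without ones exists but the formula gives zq.
  have h1 : ∀ L : ℕ, (gf fun s => if largestPart s = L then
      (if s.count 1 = 0 then zpw z (agCrank s) else 0) else 0) =
      (1 - X) * (zC z L * X ^ (L * (0 + 1)) * eulerInv R L) +
        ((if L = 0 then X else 0) + if L = 1 then -(zC z 1 * X) else 0) := by
    intro L
    have h2 : (gf fun s => if largestPart s = L then
        (if s.count 1 = 0 then zpw z (agCrank s) else 0) else 0) =
        zC z L * gf fun s => if (∀ x ∈ s, 1 < x) ∧ largestPart s = L then 1 else 0 := by
      rw [← C_zpw, ← gf_const_mul]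
      refine gf_congr fun s hs => ?_
      have h3 : (∀ x ∈ s, 1 < x) ↔ Multiset.count 1 s = 0 := by
        rw [forall_lt_and_notMem (j := 0), Multiset.count_eq_zero]
        exact and_iff_right hs
      rw [← ite_and, mul_ite, mul_one, mul_zero]
      simp only [h3]
      by_cases h4 : largestPart s = L ∧ Multiset.count 1 s = 0
      · rw [if_pos h4, if_pos h4.symm, agCrank, if_pos h4.2, h4.1]
      · rw [if_neg h4, if_neg fun h => h4 h.symm]
    rw [h2]
    match L with
    | 0 =>
      have : (gf fun s => if (∀ x ∈ s, 1 < x) ∧ largestPart s = 0 then (1 : R) else 0) = 1 := by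
        refine gf_eq_one (by simp [largestPart]) fun s hs h => if_neg fun hh => h ?_
        exact Multiset.card_eq_zero.mp (eq_zero_of_largestPart_eq hs hh.2)
      rw [this]
      simp [zC_zero, eulerInv_zero]
    | 1 =>
      have : (gf fun s => if (∀ x ∈ s, 1 < x) ∧ largestPart s = 1 then (1 : R) else 0) = 0 := by
        ext n
        rw [coeff_gf, map_zero]
        refine Finset.sum_eq_zero fun s _ => if_neg fun hh => ?_
        have h3 : largestPart s ≤ 0 := largestPart_le_iff.mpr fun x hx => by
          have h4 := hh.1 x hx
          have h5 := le_largestPart hx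
          omega
        omega
      rw [this]
      have h5 := eulerInv_succ R 0
      rw [zero_add, pow_one, eulerInv_zero] at h5
      simp only [Nat.cast_one, one_ne_zero, if_false, if_true, zero_add, mul_zero, one_mul, pow_one]
      linear_combination -(zC z 1 * X) * h5
    | L + 2 =>
      rw [gf_largestPart_eq, middleGf_eq]
      simp
      ring
  have h0 := (summable_eulerSeries z 0)
  have e1 : HasSum (fun L : ℕ => if L = 0 then (X : R⟦X⟧) else 0) X := hasSum_ite_eq 0 X
  have e2 : HasSum (fun L : ℕ => if L = 1 then -(zC z 1 * X : R⟦X⟧) else 0) (-(zC z 1 * X)) :=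
    hasSum_ite_eq 1 _
  have e3 := (h0.hasSum.mul_left (1 - X)).add (e1.add e2)
  rw [gf_eq_tsum_fiber _ (κ := largestPart) fun s _ => largestPart_le_sum s, tsum_congr h1, e3.tsum_eq,
    eulerSeries]
  ring

theorem crankSeries_eq_tsum (z : Rˣ) : crankSeries z 1 1 =
    ∑' w : ℕ, X ^ w * (zC z (-(w : ℤ)) * (eulerInv R w * eulerSeries z w)) := by
  have hf : ∀ w : ℕ, Summable fun m : ℕ => crankTerm z 1 1 (w, m) := fun w =>
    summable_of_X_pow_dvd (fun m => w * m + 1 * m + 1 * w)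
      (fun N => (Set.finite_Iic N).subset fun m (hm : w * m + 1 * m + 1 * w ≤ N) => by
        simp only [Set.mem_Iic]; nlinarith [Nat.zero_le (w * m)])
      fun _ => Dvd.intro _ rfl
  rw [crankSeries, (summable_crankTerm z 0 0).tsum_prod' hf]
  refine tsum_congr fun w => ?_
  have h0 := summable_eulerSeries z w
  rw [eulerSeries, ← mul_assoc, ← mul_assoc, ← h0.tsum_mul_left]
  refine tsum_congr fun m => ?_
  rw [crankTerm, sub_eq_add_neg, zC_add]
  ring

/-- The crank generating function as a double series. -/
theorem gf_crankZ_eq (z : Rˣ) : gf (crankZ z) = (1 - X) * crankSeries z 1 1 := by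
  have hs : Summable fun w : ℕ => X ^ w * (zC z (-(w : ℤ)) * (eulerInv R w * eulerSeries z w)) :=
    summable_of_X_pow_dvd (fun w => w) Set.finite_Iic fun _ => Dvd.intro _ rfl
  have hκ : ∀ s : Multiset ℕ, (∀ x ∈ s, 0 < x) → s.count 1 ≤ s.sum := fun s hs =>
    (Multiset.count_le_card 1 s).trans (card_le_sum hs)
  have hg := summable_gf_fiber (fun s => zpw z (agCrank s)) hκ
  have hs1 : Summable fun w : ℕ => X ^ (w + 1) * (zC z (-((w + 1 : ℕ) : ℤ)) *
      (eulerInv R (w + 1) * eulerSeries z (w + 1))) := 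
    summable_of_X_pow_dvd (fun w => w + 1) (fun N => (Set.finite_Iic N).subset fun m (hm : m + 1 ≤ N) => by
        simp only [Set.mem_Iic]; omega) fun _ => Dvd.intro _ rfl
  -- The leftover q - zq of the case without ones cancels (z - 1)q: this is why the crank of the
  -- partition 1 is modified.
  rw [gf_crankZ, gf_eq_tsum_fiber _ hκ, hg.tsum_eq_zero_add, gf_crank_zero, crankSeries_eq_tsum,
    hs.tsum_eq_zero_add, mul_add, ← hs1.tsum_mul_left]
  simp only [gf_crank_count, tailGf_eq_eulerSeries, eulerInv_zero, Nat.cast_zero, neg_zero, zC_zero]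
  have : ∀ w : ℕ, X ^ (w + 1) * (zC z (-((w + 1 : ℕ) : ℤ)) * ((1 - X) * eulerInv R (w + 1) * eulerSeries z (w + 1))) =
    (1 - X) * (X ^ (w + 1) * (zC z (-((w + 1 : ℕ) : ℤ)) * (eulerInv R (w + 1) * eulerSeries z (w + 1)))) :=
    fun w => by ring
  simp only [this]
  ring

end CrankGeneratingFunction

/-! ### Generating functions of the modified crank moments. -/

section CrankMomentGf

/-- The `k`-th power of the crank, modified for the partition of one. -/
def crankPow (k : ℕ) (s : Multiset ℕ) : ℤ :=
  if s = {1} then 1 + (-1) ^ k - 0 ^ k else agCrank s ^ k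

/-- The generating function of the crank moments of partitions. -/
noncomputable def crankGf (k : ℕ) : ℚ⟦X⟧ := gf fun s => (crankPow k s : ℚ)

theorem umom_gf (k : ℕ) (ψ : Multiset ℕ → ℚ⟦X⟧) :
    umom k (gf ψ) = gf fun s => (k.factorial : ℚ) * coeff k (ψ s) := by
  ext n
  rw [umom_eq, ← map_natCast (C (R := ℚ)), coeff_C_mul, coeff_ucoeff, coeff_gf, coeff_gf, map_sum,
    Finset.mul_sum]

theorem factorial_mul_coeff_crankZ (k : ℕ) (s : Multiset ℕ) :
    (k.factorial : ℚ) * coeff k (crankZ (sgnExp 1) s) = crankPow k s := by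
  rw [crankZ, crankPow]
  split_ifs with h
  · rw [map_sub, map_add, mul_sub, mul_add, coeff_zpw, coeff_zpw, coeff_one]
    rcases Nat.eq_zero_or_pos k with rfl | hk
    · simp
    · simp [hk.ne']
  · rw [coeff_zpw]
    simp

theorem euler_mul_crankGf (k : ℕ) : euler ℚ * crankGf k = crankMom k := by
  have h : umom k (gf (crankZ (sgnExp 1))) = crankGf k := by
    rw [umom_gf, crankGf]
    simp only [factorial_mul_coeff_crankZ]
  rw [crankMom, crankC, ← gf_crankZ_eq, ← lift_euler, umom_lift_mul, h]

theorem crankGf_zero : crankGf 0 = gf fun _ => (1 : ℚ) := by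
  rw [crankGf]
  refine gf_congr fun s _ => ?_
  rw [crankPow]
  split_ifs <;> simp

end CrankMomentGf

/-! ### Splitting overpartitions into overlined, odd and even parts. -/

section Splitting

/-- The generating function of partitions into distinct parts. -/
noncomputable def distinctGf : ℚ⟦X⟧ := gf fun s => if s.Nodup then 1 else 0

/-- An overpartition is an arbitrary partition (non-overlined parts) together with one into distinct
parts (overlined parts). -/
theorem sum_nonOverlined (n : ℕ) (ψ : Multiset ℕ → ℚ) :
    ∑ l : Overpartition n, ψ l.nonOverlined = coeff n (gf ψ * distinctGf) := by
  rw [coeff_mul]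
  simp only [distinctGf, coeff_gf, Finset.sum_mul_sum, ← Finset.sum_product', mul_ite, mul_one, mul_zero]
  rw [Finset.sum_sigma', ← Finset.sum_filter]
  have hle : ∀ l : Overpartition n, l.overlined.val ≤ l.toPartition.parts := fun l =>
    (Multiset.le_iff_subset l.overlined.nodup).mpr fun x hx =>
      Multiset.mem_toFinset.mp (l.overlined_subset (Finset.mem_val.mp hx))
  have hadd : ∀ l : Overpartition n, l.nonOverlined + l.overlined.val = l.toPartition.parts := fun l =>
    Multiset.sub_add_cancel (hle l)
  refine Finset.sum_bij'
    (fun l _ => ⟨(l.nonOverlined.sum, l.overlined.val.sum), (l.nonOverlined, l.overlined.val)⟩)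
    (fun x hx => ⟨⟨x.2.1 + x.2.2, ?_, ?_⟩, x.2.2.toFinset, ?_⟩) ?_ ?_ ?_ ?_ ?_
  · intro i hi
    simp only [Finset.mem_filter, Finset.mem_sigma, Finset.mem_product, mem_partitionsOf] at hx
    rcases Multiset.mem_add.mp hi with h | h
    exacts [hx.1.2.1.1 i h, hx.1.2.2.1 i h]
  · simp only [Finset.mem_filter, Finset.mem_sigma, Finset.mem_product, mem_partitionsOf,
      Finset.HasAntidiagonal.mem_antidiagonal] at hx
    rw [Multiset.sum_add, hx.1.2.1.2, hx.1.2.2.2, hx.1.1]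
  · intro i hi
    rw [Multiset.mem_toFinset] at hi ⊢
    exact Multiset.mem_add.mpr (Or.inr hi)
  · intro l _
    simp only [Finset.mem_filter, Finset.mem_sigma, Finset.mem_product, mem_partitionsOf,
      Finset.HasAntidiagonal.mem_antidiagonal]
    refine ⟨⟨?_, ⟨fun x hx => l.toPartition.parts_pos (Multiset.mem_of_le (Multiset.sub_le_self _ _) hx), trivial⟩,
      fun x hx => l.toPartition.parts_pos (Multiset.mem_of_le (hle l) hx), trivial⟩, l.overlined.nodup⟩
    rw [← Multiset.sum_add, hadd, l.toPartition.parts_sum]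
  · intro x hx
    exact Finset.mem_univ _
  · intro l _
    ext1
    · exact Nat.Partition.ext (hadd l)
    · exact Finset.val_toFinset _
  · rintro ⟨⟨i, j⟩, s, t⟩ hx
    simp only [Finset.mem_filter, Finset.mem_sigma, Finset.mem_product, mem_partitionsOf,
      Finset.HasAntidiagonal.mem_antidiagonal] at hx
    obtain ⟨⟨h1, ⟨h2, rfl⟩, h4, rfl⟩, h5⟩ := hx
    have e1 : t.toFinset.val = t := by rw [Multiset.toFinset_val, h5.dedup]
    simp only [Overpartition.nonOverlined, e1, Multiset.add_sub_cancel_right]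
  · intro l _
    rfl

theorem sum_toPartition (n : ℕ) (ψ : Multiset ℕ → ℚ) :
    ∑ l : Overpartition n, ψ l.toPartition.parts = coeff n (gf fun s => overWeight s * ψ s) := by
  rw [coeff_gf, ← sum_partitionsOf n fun s => overWeight s * ψ s]
  let e : Overpartition n ≃ (p : n.Partition) × {s : Finset ℕ // s ∈ p.parts.toFinset.powerset} :=
    { toFun := fun l => ⟨l.toPartition, l.overlined, Finset.mem_powerset.mpr l.overlined_subset⟩
      invFun := fun x => ⟨x.1, x.2.1, Finset.mem_powerset.mp x.2.2⟩
      left_inv := fun _ => rfl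
      right_inv := fun _ => rfl }
  rw [Fintype.sum_equiv e (fun l => ψ l.toPartition.parts) (fun x => ψ x.1.parts) fun _ => rfl,
    Fintype.sum_sigma]
  refine Finset.sum_congr rfl fun p _ => ?_
  change ∑ _y : {s : Finset ℕ // s ∈ p.parts.toFinset.powerset}, ψ p.parts = _
  rw [Finset.sum_const, Finset.card_univ, Fintype.card_coe, Finset.card_powerset, nsmul_eq_mul, overWeight]
  push_cast
  rfl

theorem overGf_eq_mul : overGf = crankGf 0 * distinctGf := by
  ext n
  rw [crankGf_zero, ← sum_nonOverlined n fun _ => 1, sum_toPartition n fun _ => 1, overGf]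
  simp only [mul_one]

theorem gf_odd : (gf fun s => if ∀ x ∈ s, ¬Even x then (1 : ℚ) else 0) = distinctGf := by
  ext n
  rw [distinctGf, coeff_gf, coeff_gf, ← sum_partitionsOf n fun s => if ∀ x ∈ s, ¬Even x then (1 : ℚ) else 0,
    ← sum_partitionsOf n fun s => if s.Nodup then (1 : ℚ) else 0, Finset.sum_boole, Finset.sum_boole]
  exact_mod_cast Nat.Partition.card_odds_eq_card_distincts n

/-- The odd parts are free, and Euler's theorem replaces their generating function by that of
distinct parts. -/
theorem gf_even_halved (ψ : Multiset ℕ → ℚ) :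
    (gf fun s => ψ ((s.filter fun x => Even x).map fun x => x / 2)) =
      expand 2 two_ne_zero (gf ψ) * distinctGf := by
  rw [expand_gf, ← gf_odd, ← gf_filter_mul (fun x => Even x) (fun s => ψ (s.map fun x => x / 2)) fun _ => 1]
  simp only [mul_one]

theorem sum_evenNonOverlinedHalved (n : ℕ) (ψ : Multiset ℕ → ℚ) :
    ∑ l : Overpartition n, ψ l.evenNonOverlinedHalved =
      coeff n (expand 2 two_ne_zero (gf ψ) * distinctGf * distinctGf) := by
  rw [← gf_even_halved, ← sum_nonOverlined]
  rfl

theorem crankGf_zero_eq : crankGf 0 = expand 2 two_ne_zero (crankGf 0) * distinctGf := by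
  rw [crankGf_zero, ← gf_even_halved fun _ => 1]

theorem euler_mul_crankGf_zero : euler ℚ * crankGf 0 = 1 := by
  rw [euler_mul_crankGf, crankMom_zero]

theorem expand_euler_mul_crankGf (k : ℕ) : expand 2 two_ne_zero (euler ℚ) *
    expand 2 two_ne_zero (crankGf k) = expand 2 two_ne_zero (crankMom k) := by
  rw [← map_mul, euler_mul_crankGf]

theorem crankGf_mul_distinctGf (k : ℕ) : crankGf k * distinctGf = overGf * crankMom k := by
  rw [overGf_eq_mul, ← euler_mul_crankGf k]
  linear_combination -(crankGf k * distinctGf) * euler_mul_crankGf_zero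

/-- The odd non-overlined and the overlined parts contribute one distinct-parts factor each; for the
zeroth moment the product is P itself. -/
theorem expand_crankGf_mul (k : ℕ) : expand 2 two_ne_zero (crankGf k) * distinctGf * distinctGf =
    overGf * expand 2 two_ne_zero (crankMom k) := by
  have h := expand_euler_mul_crankGf 0
  rw [crankMom_zero, map_one] at h
  rw [overGf_eq_mul, crankGf_zero_eq, ← expand_euler_mul_crankGf]
  linear_combination -(expand 2 two_ne_zero (crankGf k) * distinctGf * distinctGf) * h

theorem qD_crankGf_zero : qD (crankGf 0) = crankGf 0 * eis ℚ 1 := by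
  have h := euler_mul_crankGf_zero
  have h1 := congrArg qD h
  rw [Derivation.leibniz, qD_euler, Derivation.map_one_eq_zero] at h1
  simp only [smul_eq_mul] at h1
  linear_combination crankGf 0 * h1 - (qD (crankGf 0) - crankGf 0 * eis ℚ 1) * h

theorem overGf_eq_expand : overGf = expand 2 two_ne_zero (euler ℚ) * crankGf 0 ^ 2 := by
  have h := expand_euler_mul_crankGf 0
  rw [crankMom_zero, map_one] at h
  rw [overGf_eq_mul]
  linear_combination -(expand 2 two_ne_zero (euler ℚ)) * crankGf 0 * crankGf_zero_eq -
    crankGf 0 * distinctGf * h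

theorem qD_expand_euler : qD (expand 2 two_ne_zero (euler ℚ)) =
    -2 * (expand 2 two_ne_zero (euler ℚ) * eisTwo 1) := by
  rw [qD_expand, qD_euler, map_neg, map_mul, eisTwo]
  ring

theorem qD_overGf : qD overGf = overGf * (2 * eis ℚ 1 - 2 * eisTwo 1) := by
  rw [overGf_eq_expand, Derivation.leibniz, Derivation.leibniz_pow, qD_expand_euler, qD_crankGf_zero]
  simp only [smul_eq_mul, nsmul_eq_mul]
  push_cast
  ring

end Splitting

/-! ### The stated moments and F as coefficients of rational power series. -/

section FrozenMoments

theorem finsum_pow_mul_crankWeight (k : ℕ) (s : Multiset ℕ) :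
    ∑ᶠ m : ℤ, m ^ k * crankWeight m s = crankPow k s := by
  rw [crankPow]
  split_ifs with h
  · rw [finsum_eq_sum_of_support_subset (s := {0, 1, -1})]
    · rw [Finset.sum_insert (by decide), Finset.sum_insert (by decide), Finset.sum_singleton]
      simp [crankWeight, h]
      ring
    · intro m hm
      simp only [Function.mem_support, crankWeight, if_pos h] at hm
      simp only [Finset.coe_insert, Finset.coe_singleton, Set.mem_insert_iff, Set.mem_singleton_iff]
      by_contra h'
      simp only [not_or] at h'
      rw [if_neg h'.1, if_neg (by tauto), mul_zero] at hm
      exact hm rfl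
  · rw [finsum_eq_single _ (agCrank s)]
    · simp [crankWeight, h]
    · intro m hm
      simp [crankWeight, h, hm.symm]

theorem finsum_pow_mul_sum_crankWeight {n : ℕ} (k : ℕ) (f : Overpartition n → Multiset ℕ) :
    ∑ᶠ m : ℤ, m ^ k * ∑ l : Overpartition n, crankWeight m (f l) =
      ∑ l : Overpartition n, crankPow k (f l) := by
  simp only [Finset.mul_sum]
  rw [finsum_sum_comm]
  · exact Finset.sum_congr rfl fun l _ => finsum_pow_mul_crankWeight k (f l)
  · intro l _
    refine (crankWeight_support_finite (f l)).subset fun m hm => ?_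
    exact right_ne_zero_of_mul hm

theorem firstCrankMoment_eq (k n : ℕ) :
    (firstCrankMoment k n : ℚ) = coeff n (overGf * crankMom k) := by
  rw [firstCrankMoment]
  simp only [overM]
  rw [finsum_pow_mul_sum_crankWeight, ← crankGf_mul_distinctGf, crankGf, ← sum_nonOverlined]
  push_cast
  rfl

theorem secondCrankMoment_eq (k n : ℕ) :
    (secondCrankMoment k n : ℚ) = coeff n (overGf * expand 2 two_ne_zero (crankMom k)) := by
  rw [secondCrankMoment]
  simp only [overM2]
  rw [finsum_pow_mul_sum_crankWeight, ← expand_crankGf_mul, crankGf, ← sum_evenNonOverlinedHalved]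
  push_cast
  rfl

theorem rankMoment_eq (k n : ℕ) : (rankMoment k n : ℚ) = coeff n (rankGf k) := by
  have h : rankMoment k n = ∑ l : Overpartition n, l.rank ^ k := by
    rw [rankMoment]
    simp only [overN, Finset.card_filter, Nat.cast_sum, Finset.mul_sum]
    rw [finsum_sum_comm]
    · refine Finset.sum_congr rfl fun l _ => ?_
      rw [finsum_eq_single _ l.rank]
      · simp
      · intro m hm
        simp [hm.symm]
    · intro l _
      refine (Set.finite_singleton l.rank).subset fun m hm => ?_
      by_contra h
      exact hm (by simp [Ne.symm h])
  rw [h, rankGf, ← sum_toPartition n fun s => ((largestPart s : ℚ) - s.card) ^ k]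
  push_cast
  refine Finset.sum_congr rfl fun l _ => ?_
  rw [Overpartition.rank]
  push_cast
  rfl

theorem X_pow_dvd_euler_sub (R : Type*) [CommRing R] [TopologicalSpace R] [IsTopologicalRing R]
    [T2Space R] (N : ℕ) : X ^ (N + 1) ∣ euler R - eulerFin R N := by
  have h := (X_pow_dvd_euler_mul_inv (R := R) N).mul_left (eulerFin R N)
  have h2 := eulerFin_mul_inv R N
  rwa [show eulerFin R N * (euler R * eulerInv R N - 1) = euler R - eulerFin R N by
    linear_combination euler R * h2] at h

theorem qPochInf_eq_of_tendsto {d : ℕ} (hd : 1 ≤ d) {b : ℤ⟦X⟧}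
    (h : ∀ N, X ^ N ∣ ∏ k ∈ Finset.range N, (1 - (X : ℤ⟦X⟧) ^ d * (X ^ d) ^ k) - b) :
    qPochInf (X ^ d) (X ^ d) = b :=
  tendsto_nhds_unique (multipliable_qPochInf_X_pow d hd).hasProd.tendsto_prod_nat
    (tendsto_of_X_pow_dvd h)

theorem qPochInf_X : qPochInf X X = euler ℤ := by
  have h := qPochInf_eq_of_tendsto (d := 1) le_rfl (b := euler ℤ) fun N => by
    have h1 := (pow_dvd_pow X N.le_succ).trans (X_pow_dvd_euler_sub ℤ N)
    rw [← dvd_neg, neg_sub] at h1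
    convert h1 using 2
    rw [eulerFin]
    exact Finset.prod_congr rfl fun k _ => by ring
  rwa [pow_one] at h

theorem qPochInf_X_sq : qPochInf (X ^ 2) (X ^ 2) = expand 2 two_ne_zero (euler ℤ) :=
  qPochInf_eq_of_tendsto one_le_two fun N => by
    have h1 := map_dvd (expand 2 two_ne_zero) (X_pow_dvd_euler_sub ℤ N)
    rw [map_pow, expand_X, ← pow_mul, map_sub, ← dvd_neg, neg_sub] at h1
    refine (pow_dvd_pow X (by omega : N ≤ 2 * (N + 1))).trans ?_
    convert h1 using 2
    rw [eulerFin, map_prod]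
    refine Finset.prod_congr rfl fun k _ => ?_
    rw [map_sub, map_one, map_pow, expand_X]
    ring

theorem map_euler : PowerSeries.map (Int.castRingHom ℚ) (euler ℤ) = euler ℚ := by
  refine sub_eq_zero.mp (eq_zero_of_X_pow_dvd fun N => (pow_dvd_pow X N.le_succ).trans ?_)
  have h1 := map_dvd (PowerSeries.map (Int.castRingHom ℚ)) (X_pow_dvd_euler_sub ℤ N)
  rw [map_pow, map_X, map_sub] at h1
  have h2 := h1.sub (X_pow_dvd_euler_sub ℚ N)
  have h3 : PowerSeries.map (Int.castRingHom ℚ) (eulerFin ℤ N) = eulerFin ℚ N := by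
    simp [eulerFin, map_prod]
  rw [h3] at h2
  rwa [sub_sub_sub_cancel_right] at h2

theorem coeffF_eq (n : ℕ) : (coeffF n : ℚ) =
    coeff n (X * (euler ℚ ^ 6 * expand 2 two_ne_zero (euler ℚ) ^ 9)) := by
  have h : PowerSeries.map (Int.castRingHom ℚ) seriesF =
      X * (euler ℚ ^ 6 * expand 2 two_ne_zero (euler ℚ) ^ 9) := by
    rw [seriesF, qPochInf_X, qPochInf_X_sq, map_mul, map_mul, map_pow, map_pow, map_X, map_expand, map_euler,
      mul_assoc]
  rw [← h, coeff_map, coeffF]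
  rfl

end FrozenMoments

/-! ### Reduction to polynomials in e₁, f₁, e₃, and their q-derivatives. -/

section FinalIdentity

local notation "e₁" => eis ℚ 1
local notation "e₃" => eis ℚ 3
local notation "f₁" => eisTwo 1
local notation "f₃" => eisTwo 3
local notation "f₅" => eisTwo 5
local notation "f₇" => eisTwo 7

/-- After factoring out P, differentiation becomes `qD` plus multiplication by 2e₁ - 2f₁, so each
q-derivative below is again P times a polynomial in e₁, f₁, e₃. -/
theorem qD_overGf_mul (p : ℚ⟦X⟧) :
    qD (overGf * p) = overGf * (qD p + (2 * e₁ - 2 * f₁) * p) := by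
  rw [Derivation.leibniz, qD_overGf]
  simp only [smul_eq_mul]
  ring

theorem qD_eisTwo_one' : qD f₁ = (5 : ℚ) • (e₁ ^ 2) + (-20 : ℚ) • (e₁ * f₁) + (5 / 12 : ℚ) • e₁ + (16 : ℚ) • (f₁ ^ 2) +
    (-1 / 2 : ℚ) • f₁ + (-5 / 12 : ℚ) • e₃ := by
  rw [qD_eisTwo_one, eisTwo_three]
  algebra with ℚ

theorem qD_eis_three' : qD e₃ = (-384 / 5 : ℚ) • (e₁ ^ 3) + (2304 / 5 : ℚ) • (e₁ ^ 2 * f₁) + (-48 / 5 : ℚ) • (e₁ ^ 2) +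
    (-4608 / 5 : ℚ) • (e₁ * f₁ ^ 2) + (192 / 5 : ℚ) • (e₁ * f₁) + (16 : ℚ) • (e₁ * e₃) +
    (-1 / 3 : ℚ) • e₁ + (3072 / 5 : ℚ) • (f₁ ^ 3) + (-192 / 5 : ℚ) • (f₁ ^ 2) +
    (-48 : ℚ) • (f₁ * e₃) + (3 / 5 : ℚ) • f₁ + (4 / 3 : ℚ) • e₃ := by
  rw [qD_eis_three, eis_five]
  algebra with ℚ

theorem crankMom_two_reduced : crankMom 2 =
    (2 : ℚ) • e₁ := by
  rw [crankMom_two]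
  algebra with ℚ

theorem expand_crankMom_two : expand 2 two_ne_zero (crankMom 2) =
    (2 : ℚ) • f₁ := by
  have h : expand 2 two_ne_zero (crankMom 2) = 2 * f₁ := by
    rw [crankMom_two]
    simp only [map_mul, map_ofNat, eisTwo]
  rw [h]
  algebra with ℚ

theorem crankMom_four_reduced : crankMom 4 =
    (12 : ℚ) • (e₁ ^ 2) + (2 : ℚ) • e₃ := by
  rw [crankMom_four]
  algebra with ℚ

theorem expand_crankMom_four : expand 2 two_ne_zero (crankMom 4) =
    (6 : ℚ) • (e₁ ^ 2) + (-24 : ℚ) • (e₁ * f₁) + (1 / 2 : ℚ) • e₁ + (36 : ℚ) • (f₁ ^ 2) +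
    (-1 : ℚ) • f₁ + (-1 / 2 : ℚ) • e₃ := by
  have h : expand 2 two_ne_zero (crankMom 4) = 12 * f₁ ^ 2 + 2 * f₃ := by
    rw [crankMom_four]
    simp only [map_add, map_mul, map_pow, map_ofNat, eisTwo]
  rw [h, eisTwo_three]
  algebra with ℚ

theorem crankMom_six_reduced : crankMom 6 =
    (-696 / 7 : ℚ) • (e₁ ^ 3) + (9216 / 7 : ℚ) • (e₁ ^ 2 * f₁) + (-192 / 7 : ℚ) • (e₁ ^ 2) +
    (-18432 / 7 : ℚ) • (e₁ * f₁ ^ 2) + (768 / 7 : ℚ) • (e₁ * f₁) + (900 / 7 : ℚ) • (e₁ * e₃) +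
    (-6 / 7 : ℚ) • e₁ + (12288 / 7 : ℚ) • (f₁ ^ 3) + (-768 / 7 : ℚ) • (f₁ ^ 2) +
    (-960 / 7 : ℚ) • (f₁ * e₃) + (12 / 7 : ℚ) • f₁ + (20 / 7 : ℚ) • e₃ := by
  rw [crankMom_six, eis_five]
  algebra with ℚ

theorem expand_crankMom_six : expand 2 two_ne_zero (crankMom 6) =
    (-528 / 7 : ℚ) • (e₁ ^ 3) + (4428 / 7 : ℚ) • (e₁ ^ 2 * f₁) + (-66 / 7 : ℚ) • (e₁ ^ 2) +
    (-11376 / 7 : ℚ) • (e₁ * f₁ ^ 2) + (369 / 7 : ℚ) • (e₁ * f₁) + (60 / 7 : ℚ) • (e₁ * e₃) +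
    (-5 / 14 : ℚ) • e₁ + (10104 / 7 : ℚ) • (f₁ ^ 3) + (-474 / 7 : ℚ) • (f₁ ^ 2) +
    (-225 / 7 : ℚ) • (f₁ * e₃) + (5 / 7 : ℚ) • f₁ + (5 / 14 : ℚ) • e₃ := by
  have h : expand 2 two_ne_zero (crankMom 6) = 120 * f₁ ^ 3 + 60 * f₁ * f₃ + 2 * f₅ := by
    rw [crankMom_six]
    simp only [map_add, map_mul, map_pow, map_ofNat, eisTwo]
  rw [h, eisTwo_three, eisTwo_five]
  algebra with ℚ

theorem crankMom_eight_reduced : crankMom 8 =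
    (-10608 : ℚ) • (e₁ ^ 4) + (73728 : ℚ) • (e₁ ^ 3 * f₁) + (-1536 : ℚ) • (e₁ ^ 3) +
    (-147456 : ℚ) • (e₁ ^ 2 * f₁ ^ 2) + (6144 : ℚ) • (e₁ ^ 2 * f₁) +
    (5520 : ℚ) • (e₁ ^ 2 * e₃) + (-48 : ℚ) • (e₁ ^ 2) + (98304 : ℚ) • (e₁ * f₁ ^ 3) +
    (-6144 : ℚ) • (e₁ * f₁ ^ 2) + (-7680 : ℚ) • (e₁ * f₁ * e₃) + (96 : ℚ) • (e₁ * f₁) +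
    (160 : ℚ) • (e₁ * e₃) + (380 : ℚ) • (e₃ ^ 2) + (2 : ℚ) • e₃ := by
  rw [crankMom_eight, eis_five, eis_seven]
  algebra with ℚ

theorem expand_crankMom_eight : expand 2 two_ne_zero (crankMom 8) =
    (3420 : ℚ) • (e₁ ^ 4) + (-31584 : ℚ) • (e₁ ^ 3 * f₁) + (570 : ℚ) • (e₁ ^ 3) +
    (112464 : ℚ) • (e₁ ^ 2 * f₁ ^ 2) + (-3948 : ℚ) • (e₁ ^ 2 * f₁) +
    (-570 : ℚ) • (e₁ ^ 2 * e₃) + (119 / 4 : ℚ) • (e₁ ^ 2) + (-180288 : ℚ) • (e₁ * f₁ ^ 3) +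
    (9372 : ℚ) • (e₁ * f₁ ^ 2) + (2760 : ℚ) • (e₁ * f₁ * e₃) + (-139 : ℚ) • (e₁ * f₁) +
    (-95 / 2 : ℚ) • (e₁ * e₃) + (1 / 2 : ℚ) • e₁ + (110352 : ℚ) • (f₁ ^ 4) +
    (-7512 : ℚ) • (f₁ ^ 3) + (-3660 : ℚ) • (f₁ ^ 2 * e₃) + (159 : ℚ) • (f₁ ^ 2) +
    (115 : ℚ) • (f₁ * e₃) + (-1 : ℚ) • f₁ + (95 / 4 : ℚ) • (e₃ ^ 2) + (-1 / 2 : ℚ) • e₃ := by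
  have h : expand 2 two_ne_zero (crankMom 8) = 1680 * f₁ ^ 4 + 1680 * f₁ ^ 2 * f₃ + 112 * f₁ * f₅ + 140 * f₃ ^ 2 + 2 * f₇ := by
    rw [crankMom_eight]
    simp only [map_add, map_mul, map_pow, map_ofNat, eisTwo]
  rw [h, eisTwo_three, eisTwo_five, eisTwo_seven]
  algebra with ℚ

theorem qD_crank_two_one : qD (overGf * ((2 : ℚ) • e₁)) =
    overGf * ((-4 : ℚ) • (e₁ * f₁) + (1 / 3 : ℚ) • e₁ + (5 / 3 : ℚ) • e₃) := by
  rw [qD_overGf_mul]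
  congr 1
  simp only [Derivation.map_smul, qD_eis_one]
  algebra with ℚ

theorem qD_crank_two_two : qD (overGf * ((-4 : ℚ) • (e₁ * f₁) + (1 / 3 : ℚ) • e₁ + (5 / 3 : ℚ) • e₃)) =
    overGf * ((-148 : ℚ) • (e₁ ^ 3) + (848 : ℚ) • (e₁ ^ 2 * f₁) + (-53 / 3 : ℚ) • (e₁ ^ 2) +
    (-1592 : ℚ) • (e₁ * f₁ ^ 2) + (194 / 3 : ℚ) • (e₁ * f₁) + (95 / 3 : ℚ) • (e₁ * e₃) +
    (-1 / 2 : ℚ) • e₁ + (1024 : ℚ) • (f₁ ^ 3) + (-64 : ℚ) • (f₁ ^ 2) +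
    (-260 / 3 : ℚ) • (f₁ * e₃) + (1 : ℚ) • f₁ + (5 / 2 : ℚ) • e₃) := by
  rw [qD_overGf_mul]
  congr 1
  simp only [map_add, Derivation.map_smul, Derivation.leibniz, qD_eis_one,
    qD_eisTwo_one', qD_eis_three', smul_eq_mul]
  algebra with ℚ

theorem qD_crank_two_three : qD (overGf * ((-148 : ℚ) • (e₁ ^ 3) + (848 : ℚ) • (e₁ ^ 2 * f₁) + (-53 / 3 : ℚ) • (e₁ ^ 2) +
    (-1592 : ℚ) • (e₁ * f₁ ^ 2) + (194 / 3 : ℚ) • (e₁ * f₁) + (95 / 3 : ℚ) • (e₁ * e₃) +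
    (-1 / 2 : ℚ) • e₁ + (1024 : ℚ) • (f₁ ^ 3) + (-64 : ℚ) • (f₁ ^ 2) +
    (-260 / 3 : ℚ) • (f₁ * e₃) + (1 : ℚ) • f₁ + (5 / 2 : ℚ) • e₃)) =
    overGf * ((2400 : ℚ) • (e₁ ^ 4) + (-13032 : ℚ) • (e₁ ^ 3 * f₁) + (142 : ℚ) • (e₁ ^ 3) +
    (21792 : ℚ) • (e₁ ^ 2 * f₁ ^ 2) + (-166 : ℚ) • (e₁ ^ 2 * f₁) +
    (-650 : ℚ) • (e₁ ^ 2 * e₃) + (-17 / 2 : ℚ) • (e₁ ^ 2) + (-7824 : ℚ) • (e₁ * f₁ ^ 3) +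
    (-904 : ℚ) • (e₁ * f₁ ^ 2) + (1330 : ℚ) • (e₁ * f₁ * e₃) + (52 : ℚ) • (e₁ * f₁) +
    (-1 / 2 : ℚ) • e₁ + (-6144 : ℚ) • (f₁ ^ 4) + (1408 : ℚ) • (f₁ ^ 3) +
    (340 : ℚ) • (f₁ ^ 2 * e₃) + (-70 : ℚ) • (f₁ ^ 2) + (-90 : ℚ) • (f₁ * e₃) + (1 : ℚ) • f₁ +
    (125 / 2 : ℚ) • (e₃ ^ 2) + (5 / 2 : ℚ) • e₃) := by
  rw [qD_overGf_mul]
  congr 1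
  simp only [map_add, Derivation.map_smul, Derivation.leibniz, Derivation.leibniz_pow, qD_eis_one,
    qD_eisTwo_one', qD_eis_three', smul_eq_mul, nsmul_eq_mul, Nat.cast_ofNat, Nat.add_one_sub_one, pow_one]
  algebra with ℚ

theorem qD_crank_four_one : qD (overGf * ((12 : ℚ) • (e₁ ^ 2) + (2 : ℚ) • e₃)) =
    overGf * ((-888 / 5 : ℚ) • (e₁ ^ 3) + (4488 / 5 : ℚ) • (e₁ ^ 2 * f₁) + (-76 / 5 : ℚ) • (e₁ ^ 2) +
    (-9216 / 5 : ℚ) • (e₁ * f₁ ^ 2) + (384 / 5 : ℚ) • (e₁ * f₁) + (56 : ℚ) • (e₁ * e₃) +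
    (-2 / 3 : ℚ) • e₁ + (6144 / 5 : ℚ) • (f₁ ^ 3) + (-384 / 5 : ℚ) • (f₁ ^ 2) +
    (-100 : ℚ) • (f₁ * e₃) + (6 / 5 : ℚ) • f₁ + (8 / 3 : ℚ) • e₃) := by
  rw [qD_overGf_mul]
  congr 1
  simp only [map_add, Derivation.map_smul, Derivation.leibniz_pow, qD_eis_one,
    qD_eis_three', smul_eq_mul, nsmul_eq_mul, Nat.cast_ofNat, Nat.add_one_sub_one, pow_one]
  algebra with ℚ

theorem qD_crank_four_two : qD (overGf * ((-888 / 5 : ℚ) • (e₁ ^ 3) + (4488 / 5 : ℚ) • (e₁ ^ 2 * f₁) + (-76 / 5 : ℚ) • (e₁ ^ 2) +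
    (-9216 / 5 : ℚ) • (e₁ * f₁ ^ 2) + (384 / 5 : ℚ) • (e₁ * f₁) + (56 : ℚ) • (e₁ * e₃) +
    (-2 / 3 : ℚ) • e₁ + (6144 / 5 : ℚ) • (f₁ ^ 3) + (-384 / 5 : ℚ) • (f₁ ^ 2) +
    (-100 : ℚ) • (f₁ * e₃) + (6 / 5 : ℚ) • f₁ + (8 / 3 : ℚ) • e₃)) =
    overGf * ((4488 / 5 : ℚ) • (e₁ ^ 4) + (-21696 / 5 : ℚ) • (e₁ ^ 3 * f₁) + (-214 / 5 : ℚ) • (e₁ ^ 3) +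
    (35184 / 5 : ℚ) • (e₁ ^ 2 * f₁ ^ 2) + (380 : ℚ) • (e₁ ^ 2 * f₁) +
    (-422 : ℚ) • (e₁ ^ 2 * e₃) + (-34 / 3 : ℚ) • (e₁ ^ 2) + (-6912 / 5 : ℚ) • (e₁ * f₁ ^ 2) +
    (432 : ℚ) • (e₁ * f₁ * e₃) + (892 / 15 : ℚ) • (e₁ * f₁) + (33 : ℚ) • (e₁ * e₃) +
    (-1 / 2 : ℚ) • e₁ + (-24576 / 5 : ℚ) • (f₁ ^ 4) + (6656 / 5 : ℚ) • (f₁ ^ 3) +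
    (328 : ℚ) • (f₁ ^ 2 * e₃) + (-344 / 5 : ℚ) • (f₁ ^ 2) + (-266 / 3 : ℚ) • (f₁ * e₃) +
    (1 : ℚ) • f₁ + (265 / 3 : ℚ) • (e₃ ^ 2) + (5 / 2 : ℚ) • e₃) := by
  rw [qD_overGf_mul]
  congr 1
  simp only [map_add, Derivation.map_smul, Derivation.leibniz, Derivation.leibniz_pow, qD_eis_one,
    qD_eisTwo_one', qD_eis_three', smul_eq_mul, nsmul_eq_mul, Nat.cast_ofNat, Nat.add_one_sub_one, pow_one]
  algebra with ℚ

theorem qD_crank_six_one : qD (overGf * ((-696 / 7 : ℚ) • (e₁ ^ 3) + (9216 / 7 : ℚ) • (e₁ ^ 2 * f₁) + (-192 / 7 : ℚ) • (e₁ ^ 2) +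
    (-18432 / 7 : ℚ) • (e₁ * f₁ ^ 2) + (768 / 7 : ℚ) • (e₁ * f₁) + (900 / 7 : ℚ) • (e₁ * e₃) +
    (-6 / 7 : ℚ) • e₁ + (12288 / 7 : ℚ) • (f₁ ^ 3) + (-768 / 7 : ℚ) • (f₁ ^ 2) +
    (-960 / 7 : ℚ) • (f₁ * e₃) + (12 / 7 : ℚ) • f₁ + (20 / 7 : ℚ) • e₃)) =
    overGf * ((-20256 / 7 : ℚ) • (e₁ ^ 4) + (102768 / 7 : ℚ) • (e₁ ^ 3 * f₁) +
    (-2460 / 7 : ℚ) • (e₁ ^ 3) + (-221184 / 7 : ℚ) • (e₁ ^ 2 * f₁ ^ 2) +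
    (1920 : ℚ) • (e₁ ^ 2 * f₁) + (4020 / 7 : ℚ) • (e₁ ^ 2 * e₃) + (-176 / 7 : ℚ) • (e₁ ^ 2) +
    (24576 : ℚ) • (e₁ * f₁ ^ 3) + (-19200 / 7 : ℚ) • (e₁ * f₁ ^ 2) +
    (-12360 / 7 : ℚ) • (e₁ * f₁ * e₃) + (528 / 7 : ℚ) • (e₁ * f₁) +
    (670 / 7 : ℚ) • (e₁ * e₃) + (-8 / 21 : ℚ) • e₁ + (-24576 / 7 : ℚ) • (f₁ ^ 4) +
    (7680 / 7 : ℚ) • (f₁ ^ 3) + (1920 / 7 : ℚ) • (f₁ ^ 2 * e₃) + (-408 / 7 : ℚ) • (f₁ ^ 2) +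
    (-520 / 7 : ℚ) • (f₁ * e₃) + (6 / 7 : ℚ) • f₁ + (1150 / 7 : ℚ) • (e₃ ^ 2) +
    (50 / 21 : ℚ) • e₃) := by
  rw [qD_overGf_mul]
  congr 1
  simp only [map_add, Derivation.map_smul, Derivation.leibniz, Derivation.leibniz_pow, qD_eis_one,
    qD_eisTwo_one', qD_eis_three', smul_eq_mul, nsmul_eq_mul, Nat.cast_ofNat, Nat.add_one_sub_one, pow_one]
  algebra with ℚ

theorem qD_crankTwo_two_one : qD (overGf * ((2 : ℚ) • f₁)) =
    overGf * ((10 : ℚ) • (e₁ ^ 2) + (-36 : ℚ) • (e₁ * f₁) + (5 / 6 : ℚ) • e₁ + (28 : ℚ) • (f₁ ^ 2) +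
    (-1 : ℚ) • f₁ + (-5 / 6 : ℚ) • e₃) := by
  rw [qD_overGf_mul]
  congr 1
  simp only [Derivation.map_smul, qD_eisTwo_one']
  algebra with ℚ

theorem qD_crankTwo_two_two : qD (overGf * ((10 : ℚ) • (e₁ ^ 2) + (-36 : ℚ) • (e₁ * f₁) + (5 / 6 : ℚ) • e₁ + (28 : ℚ) • (f₁ ^ 2) +
    (-1 : ℚ) • f₁ + (-5 / 6 : ℚ) • e₃)) =
    overGf * ((-136 : ℚ) • (e₁ ^ 3) + (596 : ℚ) • (e₁ ^ 2 * f₁) + (-26 / 3 : ℚ) • (e₁ ^ 2) +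
    (-800 : ℚ) • (e₁ * f₁ ^ 2) + (59 / 3 : ℚ) • (e₁ * f₁) + (50 / 3 : ℚ) • (e₁ * e₃) +
    (328 : ℚ) • (f₁ ^ 3) + (-10 : ℚ) • (f₁ ^ 2) + (-35 / 3 : ℚ) • (f₁ * e₃)) := by
  rw [qD_overGf_mul]
  congr 1
  simp only [map_add, Derivation.map_smul, Derivation.leibniz, Derivation.leibniz_pow, qD_eis_one,
    qD_eisTwo_one', qD_eis_three', smul_eq_mul, nsmul_eq_mul, Nat.cast_ofNat, Nat.add_one_sub_one, pow_one]
  algebra with ℚ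

theorem qD_crankTwo_two_three : qD (overGf * ((-136 : ℚ) • (e₁ ^ 3) + (596 : ℚ) • (e₁ ^ 2 * f₁) + (-26 / 3 : ℚ) • (e₁ ^ 2) +
    (-800 : ℚ) • (e₁ * f₁ ^ 2) + (59 / 3 : ℚ) • (e₁ * f₁) + (50 / 3 : ℚ) • (e₁ * e₃) +
    (328 : ℚ) • (f₁ ^ 3) + (-10 : ℚ) • (f₁ ^ 2) + (-35 / 3 : ℚ) • (f₁ * e₃))) =
    overGf * ((2244 : ℚ) • (e₁ ^ 4) + (-12264 : ℚ) • (e₁ ^ 3 * f₁) + (136 : ℚ) • (e₁ ^ 3) +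
    (24528 : ℚ) • (e₁ ^ 2 * f₁ ^ 2) + (-490 : ℚ) • (e₁ ^ 2 * f₁) +
    (-380 : ℚ) • (e₁ ^ 2 * e₃) + (-1 / 4 : ℚ) • (e₁ ^ 2) + (-22032 : ℚ) • (e₁ * f₁ ^ 3) +
    (644 : ℚ) • (e₁ * f₁ ^ 2) + (850 : ℚ) • (e₁ * f₁ * e₃) + (-1 : ℚ) • (e₁ * f₁) +
    (-5 / 2 : ℚ) • (e₁ * e₃) + (7920 : ℚ) • (f₁ ^ 4) + (-344 : ℚ) • (f₁ ^ 3) +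
    (-680 : ℚ) • (f₁ ^ 2 * e₃) + (3 : ℚ) • (f₁ ^ 2) + (15 : ℚ) • (f₁ * e₃) +
    (75 / 4 : ℚ) • (e₃ ^ 2)) := by
  rw [qD_overGf_mul]
  congr 1
  simp only [map_add, Derivation.map_smul, Derivation.leibniz, Derivation.leibniz_pow, qD_eis_one,
    qD_eisTwo_one', qD_eis_three', smul_eq_mul, nsmul_eq_mul, Nat.cast_ofNat, Nat.add_one_sub_one, pow_one]
  algebra with ℚ

theorem qD_crankTwo_four_one : qD (overGf * ((6 : ℚ) • (e₁ ^ 2) + (-24 : ℚ) • (e₁ * f₁) + (1 / 2 : ℚ) • e₁ + (36 : ℚ) • (f₁ ^ 2) +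
    (-1 : ℚ) • f₁ + (-1 / 2 : ℚ) • e₃)) =
    overGf * ((-468 / 5 : ℚ) • (e₁ ^ 3) + (2988 / 5 : ℚ) • (e₁ ^ 2 * f₁) + (-41 / 5 : ℚ) • (e₁ ^ 2) +
    (-6216 / 5 : ℚ) • (e₁ * f₁ ^ 2) + (179 / 5 : ℚ) • (e₁ * f₁) + (11 : ℚ) • (e₁ * e₃) +
    (-1 / 6 : ℚ) • e₁ + (3864 / 5 : ℚ) • (f₁ ^ 3) + (-154 / 5 : ℚ) • (f₁ ^ 2) +
    (-25 : ℚ) • (f₁ * e₃) + (1 / 5 : ℚ) • f₁ + (1 / 6 : ℚ) • e₃) := by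
  rw [qD_overGf_mul]
  congr 1
  simp only [map_add, Derivation.map_smul, Derivation.leibniz, Derivation.leibniz_pow, qD_eis_one,
    qD_eisTwo_one', qD_eis_three', smul_eq_mul, nsmul_eq_mul, Nat.cast_ofNat, Nat.add_one_sub_one, pow_one]
  algebra with ℚ

theorem qD_crankTwo_four_two : qD (overGf * ((-468 / 5 : ℚ) • (e₁ ^ 3) + (2988 / 5 : ℚ) • (e₁ ^ 2 * f₁) + (-41 / 5 : ℚ) • (e₁ ^ 2) +
    (-6216 / 5 : ℚ) • (e₁ * f₁ ^ 2) + (179 / 5 : ℚ) • (e₁ * f₁) + (11 : ℚ) • (e₁ * e₃) +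
    (-1 / 6 : ℚ) • e₁ + (3864 / 5 : ℚ) • (f₁ ^ 3) + (-154 / 5 : ℚ) • (f₁ ^ 2) +
    (-25 : ℚ) • (f₁ * e₃) + (1 / 5 : ℚ) • f₁ + (1 / 6 : ℚ) • e₃)) =
    overGf * ((12588 / 5 : ℚ) • (e₁ ^ 4) + (-92016 / 5 : ℚ) • (e₁ ^ 3 * f₁) +
    (1396 / 5 : ℚ) • (e₁ ^ 3) + (240144 / 5 : ℚ) • (e₁ ^ 2 * f₁ ^ 2) +
    (-1404 : ℚ) • (e₁ ^ 2 * f₁) + (-432 : ℚ) • (e₁ ^ 2 * e₃) + (95 / 12 : ℚ) • (e₁ ^ 2) +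
    (-52320 : ℚ) • (e₁ * f₁ ^ 3) + (10688 / 5 : ℚ) • (e₁ * f₁ ^ 2) +
    (1532 : ℚ) • (e₁ * f₁ * e₃) + (-293 / 15 : ℚ) • (e₁ * f₁) + (-39 / 2 : ℚ) • (e₁ * e₃) +
    (100944 / 5 : ℚ) • (f₁ ^ 4) + (-5104 / 5 : ℚ) • (f₁ ^ 3) + (-1152 : ℚ) • (f₁ ^ 2 * e₃) +
    (61 / 5 : ℚ) • (f₁ ^ 2) + (79 / 3 : ℚ) • (f₁ * e₃) + (235 / 12 : ℚ) • (e₃ ^ 2)) := by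
  rw [qD_overGf_mul]
  congr 1
  simp only [map_add, Derivation.map_smul, Derivation.leibniz, Derivation.leibniz_pow, qD_eis_one,
    qD_eisTwo_one', qD_eis_three', smul_eq_mul, nsmul_eq_mul, Nat.cast_ofNat, Nat.add_one_sub_one, pow_one]
  algebra with ℚ

theorem qD_crankTwo_six_one : qD (overGf * ((-528 / 7 : ℚ) • (e₁ ^ 3) + (4428 / 7 : ℚ) • (e₁ ^ 2 * f₁) + (-66 / 7 : ℚ) • (e₁ ^ 2) +
    (-11376 / 7 : ℚ) • (e₁ * f₁ ^ 2) + (369 / 7 : ℚ) • (e₁ * f₁) + (60 / 7 : ℚ) • (e₁ * e₃) +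
    (-5 / 14 : ℚ) • e₁ + (10104 / 7 : ℚ) • (f₁ ^ 3) + (-474 / 7 : ℚ) • (f₁ ^ 2) +
    (-225 / 7 : ℚ) • (f₁ * e₃) + (5 / 7 : ℚ) • f₁ + (5 / 14 : ℚ) • e₃)) =
    overGf * ((19644 / 7 : ℚ) • (e₁ ^ 4) + (-165192 / 7 : ℚ) • (e₁ ^ 3 * f₁) +
    (2790 / 7 : ℚ) • (e₁ ^ 3) + (509616 / 7 : ℚ) • (e₁ ^ 2 * f₁ ^ 2) +
    (-2370 : ℚ) • (e₁ ^ 2 * f₁) + (-3330 / 7 : ℚ) • (e₁ ^ 2 * e₃) +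
    (451 / 28 : ℚ) • (e₁ ^ 2) + (-97584 : ℚ) • (e₁ * f₁ ^ 3) +
    (32040 / 7 : ℚ) • (e₁ * f₁ ^ 2) + (14310 / 7 : ℚ) • (e₁ * f₁ * e₃) +
    (-396 / 7 : ℚ) • (e₁ * f₁) + (-445 / 14 : ℚ) • (e₁ * e₃) + (5 / 42 : ℚ) • e₁ +
    (326544 / 7 : ℚ) • (f₁ ^ 4) + (-19200 / 7 : ℚ) • (f₁ ^ 3) +
    (-14460 / 7 : ℚ) • (f₁ ^ 2 * e₃) + (313 / 7 : ℚ) • (f₁ ^ 2) + (390 / 7 : ℚ) • (f₁ * e₃) +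
    (-1 / 7 : ℚ) • f₁ + (575 / 28 : ℚ) • (e₃ ^ 2) + (-5 / 42 : ℚ) • e₃) := by
  rw [qD_overGf_mul]
  congr 1
  simp only [map_add, Derivation.map_smul, Derivation.leibniz, Derivation.leibniz_pow, qD_eis_one,
    qD_eisTwo_one', qD_eis_three', smul_eq_mul, nsmul_eq_mul, Nat.cast_ofNat, Nat.add_one_sub_one, pow_one]
  algebra with ℚ

theorem qD_appell_one_one : qD (overGf * ((-4 : ℚ) • (e₁ ^ 2) + (2 / 3 : ℚ) • e₁ + (8 : ℚ) • (f₁ ^ 2) + (-1 : ℚ) • f₁ +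
    (-2 / 3 : ℚ) • e₃)) =
    overGf * ((296 / 5 : ℚ) • (e₁ ^ 3) + (-1096 / 5 : ℚ) • (e₁ ^ 2 * f₁) + (1 / 15 : ℚ) • (e₁ ^ 2) +
    (1552 / 5 : ℚ) • (e₁ * f₁ ^ 2) + (-34 / 15 : ℚ) • (e₁ * f₁) + (-56 / 3 : ℚ) • (e₁ * e₃) +
    (-1 / 12 : ℚ) • e₁ + (-848 / 5 : ℚ) • (f₁ ^ 3) + (18 / 5 : ℚ) • (f₁ ^ 2) +
    (80 / 3 : ℚ) • (f₁ * e₃) + (1 / 10 : ℚ) • f₁ + (1 / 12 : ℚ) • e₃) := by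
  rw [qD_overGf_mul]
  congr 1
  simp only [map_add, Derivation.map_smul, Derivation.leibniz_pow, qD_eis_one,
    qD_eisTwo_one', qD_eis_three', smul_eq_mul, nsmul_eq_mul, Nat.cast_ofNat, Nat.add_one_sub_one, pow_one]
  algebra with ℚ

theorem qD_appell_one_two : qD (overGf * ((296 / 5 : ℚ) • (e₁ ^ 3) + (-1096 / 5 : ℚ) • (e₁ ^ 2 * f₁) + (1 / 15 : ℚ) • (e₁ ^ 2) +
    (1552 / 5 : ℚ) • (e₁ * f₁ ^ 2) + (-34 / 15 : ℚ) • (e₁ * f₁) + (-56 / 3 : ℚ) • (e₁ * e₃) +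
    (-1 / 12 : ℚ) • e₁ + (-848 / 5 : ℚ) • (f₁ ^ 3) + (18 / 5 : ℚ) • (f₁ ^ 2) +
    (80 / 3 : ℚ) • (f₁ * e₃) + (1 / 10 : ℚ) • f₁ + (1 / 12 : ℚ) • e₃)) =
    overGf * ((504 / 5 : ℚ) • (e₁ ^ 4) + (-14208 / 5 : ℚ) • (e₁ ^ 3 * f₁) + (498 / 5 : ℚ) • (e₁ ^ 3) +
    (57312 / 5 : ℚ) • (e₁ ^ 2 * f₁ ^ 2) + (-558 : ℚ) • (e₁ ^ 2 * f₁) +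
    (74 : ℚ) • (e₁ ^ 2 * e₃) + (5 : ℚ) • (e₁ ^ 2) + (-16896 : ℚ) • (e₁ * f₁ ^ 3) +
    (5124 / 5 : ℚ) • (e₁ * f₁ ^ 2) + (256 : ℚ) • (e₁ * f₁ * e₃) +
    (-443 / 30 : ℚ) • (e₁ * f₁) + (-43 / 3 : ℚ) • (e₁ * e₃) + (42912 / 5 : ℚ) • (f₁ ^ 4) +
    (-3052 / 5 : ℚ) • (f₁ ^ 3) + (-436 : ℚ) • (f₁ ^ 2 * e₃) + (53 / 5 : ℚ) • (f₁ ^ 2) +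
    (79 / 6 : ℚ) • (f₁ * e₃) + (-80 / 3 : ℚ) • (e₃ ^ 2)) := by
  rw [qD_overGf_mul]
  congr 1
  simp only [map_add, Derivation.map_smul, Derivation.leibniz, Derivation.leibniz_pow, qD_eis_one,
    qD_eisTwo_one', qD_eis_three', smul_eq_mul, nsmul_eq_mul, Nat.cast_ofNat, Nat.add_one_sub_one, pow_one]
  algebra with ℚ

theorem qD_appell_three_one : qD (overGf * ((-32 / 35 : ℚ) • (e₁ ^ 3) + (-3168 / 35 : ℚ) • (e₁ ^ 2 * f₁) + (136 / 35 : ℚ) • (e₁ ^ 2) +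
    (6336 / 35 : ℚ) • (e₁ * f₁ ^ 2) + (-264 / 35 : ℚ) • (e₁ * f₁) +
    (-96 / 7 : ℚ) • (e₁ * e₃) + (-2 / 21 : ℚ) • e₁ + (-1984 / 35 : ℚ) • (f₁ ^ 3) +
    (-16 / 35 : ℚ) • (f₁ ^ 2) + (80 / 7 : ℚ) • (f₁ * e₃) + (9 / 35 : ℚ) • f₁ +
    (2 / 21 : ℚ) • e₃)) =
    overGf * ((21152 / 35 : ℚ) • (e₁ ^ 4) + (-118784 / 35 : ℚ) • (e₁ ^ 3 * f₁) +
    (1424 / 35 : ℚ) • (e₁ ^ 3) + (299136 / 35 : ℚ) • (e₁ ^ 2 * f₁ ^ 2) +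
    (-288 : ℚ) • (e₁ ^ 2 * f₁) + (-888 / 7 : ℚ) • (e₁ ^ 2 * e₃) + (65 / 21 : ℚ) • (e₁ ^ 2) +
    (-10240 : ℚ) • (e₁ * f₁ ^ 3) + (19872 / 35 : ℚ) • (e₁ * f₁ ^ 2) +
    (2528 / 7 : ℚ) • (e₁ * f₁ * e₃) + (-374 / 35 : ℚ) • (e₁ * f₁) +
    (-94 / 21 : ℚ) • (e₁ * e₃) + (5 / 84 : ℚ) • e₁ + (154496 / 35 : ℚ) • (f₁ ^ 4) +
    (-10816 / 35 : ℚ) • (f₁ ^ 3) + (-1168 / 7 : ℚ) • (f₁ ^ 2 * e₃) +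
    (254 / 35 : ℚ) • (f₁ ^ 2) + (-8 / 7 : ℚ) • (f₁ * e₃) + (-1 / 14 : ℚ) • f₁ +
    (-340 / 21 : ℚ) • (e₃ ^ 2) + (-5 / 84 : ℚ) • e₃) := by
  rw [qD_overGf_mul]
  congr 1
  simp only [map_add, Derivation.map_smul, Derivation.leibniz, Derivation.leibniz_pow, qD_eis_one,
    qD_eisTwo_one', qD_eis_three', smul_eq_mul, nsmul_eq_mul, Nat.cast_ofNat, Nat.add_one_sub_one, pow_one]
  algebra with ℚ

end FinalIdentity

/-! ### The cusp form F/P of weight eight. -/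

section CuspForm

local notation "e₁" => eis ℚ 1
local notation "e₃" => eis ℚ 3
local notation "f₁" => eisTwo 1

/-- The quotient of `seriesF` by the generating function of overpartitions. -/
noncomputable def cuspQuot : ℚ⟦X⟧ :=
    (-2304 : ℚ) • (e₁ ^ 4) + (18432 : ℚ) • (e₁ ^ 3 * f₁) + (-384 : ℚ) • (e₁ ^ 3) +
    (-55296 : ℚ) • (e₁ ^ 2 * f₁ ^ 2) + (2304 : ℚ) • (e₁ ^ 2 * f₁) +
    (1200 : ℚ) • (e₁ ^ 2 * e₃) + (-19 : ℚ) • (e₁ ^ 2) + (73728 : ℚ) • (e₁ * f₁ ^ 3) +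
    (-4608 : ℚ) • (e₁ * f₁ ^ 2) + (-4800 : ℚ) • (e₁ * f₁ * e₃) + (76 : ℚ) • (e₁ * f₁) +
    (100 : ℚ) • (e₁ * e₃) + (-1 / 4 : ℚ) • e₁ + (-36864 : ℚ) • (f₁ ^ 4) +
    (3072 : ℚ) • (f₁ ^ 3) + (4800 : ℚ) • (f₁ ^ 2 * e₃) + (-76 : ℚ) • (f₁ ^ 2) +
    (-200 : ℚ) • (f₁ * e₃) + (1 / 2 : ℚ) • f₁ + (-100 : ℚ) • (e₃ ^ 2) + (5 / 4 : ℚ) • e₃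

/-- The logarithmic derivative expected of q (q;q)^8 (q²;q²)^8, which is F/P because P =
(q²;q²)/(q;q)². -/
theorem qD_cuspQuot : qD cuspQuot = cuspQuot * (1 - 8 * e₁ - 16 * f₁) := by
  rw [cuspQuot]
  simp only [map_add, Derivation.map_smul, Derivation.leibniz, Derivation.leibniz_pow, qD_eis_one,
    qD_eisTwo_one', qD_eis_three', smul_eq_mul, nsmul_eq_mul, Nat.cast_ofNat, Nat.add_one_sub_one, pow_one]
  algebra with ℚ

theorem constantCoeff_eis (k : ℕ) : constantCoeff (eis ℚ k) = 0 := constantCoeff_lambert _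

theorem constantCoeff_eisTwo (k : ℕ) : constantCoeff (eisTwo k) = 0 := by
  rw [eisTwo, constantCoeff_expand, constantCoeff_eis]

theorem coeff_one_eis (k : ℕ) : coeff 1 (eis ℚ k) = 1 := by
  rw [eis, coeff_lambert]
  simp

theorem coeff_one_eisTwo (k : ℕ) : coeff 1 (eisTwo k) = 0 := by
  rw [eisTwo, coeff_expand]
  simp

theorem constantCoeff_overGf : constantCoeff overGf = 1 := by
  rw [overGf, constantCoeff_gf]
  simp [overWeight]

/-- Both sides satisfy the same first-order equation. The factor q is stripped first, since
uniqueness requires a logarithmic derivative without constant term. -/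
theorem overGf_mul_cuspQuot :
    overGf * cuspQuot = X * (euler ℚ ^ 6 * expand 2 two_ne_zero (euler ℚ) ^ 9) := by
  have h0 : constantCoeff cuspQuot = 0 := by
    simp [cuspQuot, constantCoeff_eis, constantCoeff_eisTwo]
  have h1 : coeff 1 cuspQuot = 1 := by
    simp [cuspQuot, pow_succ, coeff_one_mul, constantCoeff_eis, constantCoeff_eisTwo, coeff_one_eis, coeff_one_eisTwo]
    norm_num
  obtain ⟨h, hh⟩ : X ∣ cuspQuot := X_dvd_iff.mpr h0
  have hh1 : constantCoeff h = 1 := by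
    rw [← h1, hh, ← coeff_zero_eq_constantCoeff_apply, ← coeff_succ_X_mul]
  have hd : qD h = h * (-8 * e₁ - 16 * f₁) := by
    have hX : qD (X : ℚ⟦X⟧) = X := by simpa using qD_X_pow (R := ℚ) 1
    have := qD_cuspQuot
    rw [hh, Derivation.leibniz, hX] at this
    simp only [smul_eq_mul] at this
    refine mul_left_cancel₀ (X_ne_zero (R := ℚ)) ?_
    linear_combination this
  have key : overGf * h = euler ℚ ^ 6 * expand 2 two_ne_zero (euler ℚ) ^ 9 := by
    refine eq_of_qD_eq_mul (g := -6 * e₁ - 18 * f₁) ?_ ?_ ?_ ?_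
    · simp [constantCoeff_eis, constantCoeff_eisTwo]
    · simp [constantCoeff_overGf, hh1, constantCoeff_euler]
    · rw [Derivation.leibniz, qD_overGf, hd]
      simp only [smul_eq_mul]
      ring
    · rw [Derivation.leibniz, Derivation.leibniz_pow, Derivation.leibniz_pow, qD_euler, qD_expand_euler]
      simp only [smul_eq_mul, nsmul_eq_mul]
      push_cast
      ring
  rw [hh, ← key]
  ring

end CuspForm

/-! ### Rank moments through partial theta moments. -/

section RankMoments

/-- The moment sum of the partial theta series, times the generating function of overpartitions. -/
noncomputable def overMomentSum (k : ℕ) : ℚ⟦X⟧ := overGf * momentSum partialTheta k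

theorem rankGf_two : rankGf 2 = (-4 : ℚ) • overMomentSum 1 := by
  rw [rankGf_eq two_ne_zero even_two (g := fun m => (m : ℚ⟦X⟧)) (by simp) (by intro m; push_cast; ring),
    overMomentSum, momentSum]
  simp only [Nat.cast_add, Nat.cast_one, pow_one]
  algebra with ℚ

/-- The polynomial g = 4m⁷ - 14m⁵ + 28m³ - 17m solves g(m+1) + g(m) = (m+1)⁸ - m⁸; the coefficients
are -4 times those of g. -/
theorem rankGf_eight : rankGf 8 = (-16 : ℚ) • overMomentSum 7 + (56 : ℚ) • overMomentSum 5 +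
    (-112 : ℚ) • overMomentSum 3 + (68 : ℚ) • overMomentSum 1 := by
  rw [rankGf_eq (by norm_num) (by decide)
    (g := fun m => 4 * (m : ℚ⟦X⟧) ^ 7 - 14 * (m : ℚ⟦X⟧) ^ 5 + 28 * (m : ℚ⟦X⟧) ^ 3 - 17 * (m : ℚ⟦X⟧))
    (by simp) (by intro m; push_cast; ring)]
  have hp : ∀ m, X ^ m ∣ (partialTheta m : ℚ⟦X⟧) := fun m =>
    (pow_dvd_pow _ m.le_succ).trans (X_pow_dvd_partialTheta m)
  have hs := fun k => (summable_momentSum hp k).hasSum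
  have h := ((((hs 7).mul_left 4).sub ((hs 5).mul_left 14)).add ((hs 3).mul_left 28)).sub ((hs 1).mul_left 17)
  rw [tsum_congr (fun m : ℕ => show _ = 4 * (((m : ℚ⟦X⟧) + 1) ^ 7 * partialTheta (m + 1)) -
      14 * (((m : ℚ⟦X⟧) + 1) ^ 5 * partialTheta (m + 1)) + 28 * (((m : ℚ⟦X⟧) + 1) ^ 3 * partialTheta (m + 1)) -
      17 * (((m : ℚ⟦X⟧) + 1) ^ 1 * partialTheta (m + 1)) by push_cast; ring), h.tsum_eq]
  change _ * (4 * momentSum partialTheta 7 - 14 * momentSum partialTheta 5 +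
    28 * momentSum partialTheta 3 - 17 * momentSum partialTheta 1) = _
  simp only [overMomentSum]
  generalize momentSum partialTheta 7 = s₇, momentSum partialTheta 5 = s₅, momentSum partialTheta 3 = s₃,
    momentSum partialTheta 1 = s₁
  algebra with ℚ

/-- As 2c = 8e₁ - 8f₁ is four times the logarithmic derivative of P, the constant is absorbed when P
is moved inside the derivative. -/
theorem overGf_mul_momentSum_appellTail {c : ℚ⟦X⟧} (hc : c = -appellTail (2 * c) 0) (k : ℕ) :
    overGf * momentSum (appellTail (2 * c)) k = overMomentSum (k + 2) + (4 : ℚ) • qD (overMomentSum k) := by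
  rw [momentSum_appellTail, overMomentSum, overMomentSum, qD_overGf_mul]
  have h := appell_constant_eq hc
  generalize momentSum partialTheta k = s
  rw [h]
  algebra with ℚ

end RankMoments

/-! ### Elimination and the final linear relation. -/

section Assembly

local notation "e₁" => eis ℚ 1
local notation "e₃" => eis ℚ 3
local notation "f₁" => eisTwo 1

/-- With A_k = P times the k-th Appell moment, T_{k+2} = A_k - 4DT_k is applied for k = 1, 3, 5. The
terms in T₁ are (68 + 448D + 896D² + 1024D³)T₁, and T₁ is -1/4 of the second moment. -/
theorem rankGf_eight_eq : rankGf 8 = (-17 : ℚ) • rankGf 2 - (112 : ℚ) • qD (rankGf 2) -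
    (224 : ℚ) • qD (qD (rankGf 2)) - (256 : ℚ) • qD (qD (qD (rankGf 2))) +
    ((-112 : ℚ) • (overGf * ((-4 : ℚ) • (e₁ ^ 2) + (2 / 3 : ℚ) • e₁ + (8 : ℚ) • (f₁ ^ 2) + (-1 : ℚ) • f₁ +
    (-2 / 3 : ℚ) • e₃)) + (56 : ℚ) • (overGf * ((-32 / 35 : ℚ) • (e₁ ^ 3) + (-3168 / 35 : ℚ) • (e₁ ^ 2 * f₁) + (136 / 35 : ℚ) • (e₁ ^ 2) +
    (6336 / 35 : ℚ) • (e₁ * f₁ ^ 2) + (-264 / 35 : ℚ) • (e₁ * f₁) +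
    (-96 / 7 : ℚ) • (e₁ * e₃) + (-2 / 21 : ℚ) • e₁ + (-1984 / 35 : ℚ) • (f₁ ^ 3) +
    (-16 / 35 : ℚ) • (f₁ ^ 2) + (80 / 7 : ℚ) • (f₁ * e₃) + (9 / 35 : ℚ) • f₁ +
    (2 / 21 : ℚ) • e₃) - (4 : ℚ) • qD (overGf * ((-4 : ℚ) • (e₁ ^ 2) + (2 / 3 : ℚ) • e₁ + (8 : ℚ) • (f₁ ^ 2) + (-1 : ℚ) • f₁ +
    (-2 / 3 : ℚ) • e₃))) -
    (16 : ℚ) • (overGf * ((4288 / 7 : ℚ) • (e₁ ^ 4) + (-34816 / 7 : ℚ) • (e₁ ^ 3 * f₁) + (736 / 7 : ℚ) • (e₁ ^ 3) +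
    (79104 / 7 : ℚ) • (e₁ ^ 2 * f₁ ^ 2) + (-320 : ℚ) • (e₁ ^ 2 * f₁) +
    (-2880 / 7 : ℚ) • (e₁ ^ 2 * e₃) + (-34 / 21 : ℚ) • (e₁ ^ 2) +
    (-10240 : ℚ) • (e₁ * f₁ ^ 3) + (2368 / 7 : ℚ) • (e₁ * f₁ ^ 2) +
    (3840 / 7 : ℚ) • (e₁ * f₁ * e₃) + (32 / 21 : ℚ) • (e₁ * f₁) + (80 / 7 : ℚ) • (e₁ * e₃) +
    (1 / 14 : ℚ) • e₁ + (27904 / 7 : ℚ) • (f₁ ^ 4) + (-1664 / 7 : ℚ) • (f₁ ^ 3) +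
    (-640 / 7 : ℚ) • (f₁ ^ 2 * e₃) + (52 / 7 : ℚ) • (f₁ ^ 2) + (-320 / 21 : ℚ) • (f₁ * e₃) +
    (-2 / 7 : ℚ) • f₁ + (-380 / 21 : ℚ) • (e₃ ^ 2) + (-1 / 14 : ℚ) • e₃) - (4 : ℚ) • qD (overGf * ((-32 / 35 : ℚ) • (e₁ ^ 3) + (-3168 / 35 : ℚ) • (e₁ ^ 2 * f₁) + (136 / 35 : ℚ) • (e₁ ^ 2) +
    (6336 / 35 : ℚ) • (e₁ * f₁ ^ 2) + (-264 / 35 : ℚ) • (e₁ * f₁) +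
    (-96 / 7 : ℚ) • (e₁ * e₃) + (-2 / 21 : ℚ) • e₁ + (-1984 / 35 : ℚ) • (f₁ ^ 3) +
    (-16 / 35 : ℚ) • (f₁ ^ 2) + (80 / 7 : ℚ) • (f₁ * e₃) + (9 / 35 : ℚ) • f₁ +
    (2 / 21 : ℚ) • e₃)) + (16 : ℚ) • qD (qD (overGf * ((-4 : ℚ) • (e₁ ^ 2) + (2 / 3 : ℚ) • e₁ + (8 : ℚ) • (f₁ ^ 2) + (-1 : ℚ) • f₁ +
    (-2 / 3 : ℚ) • e₃))))) := by
  obtain ⟨c, hc⟩ := exists_appell_constant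
  rw [← momentSum_appellTail_one hc, ← momentSum_appellTail_three hc, ← momentSum_appellTail_five hc]
  simp only [overGf_mul_momentSum_appellTail hc, rankGf_two, rankGf_eight, map_add, Derivation.map_smul]
  module

-- With weights 2, 2, 4 for e₁, f₁, e₃, both sides are P times polynomials of weight at most 8, and
-- the rational constants make all monomial coefficients agree.
set_option maxHeartbeats 4000000 in
theorem rank_crank_identity :
    (-112 : ℚ) • (overGf * ((-4 : ℚ) • (e₁ ^ 2) + (2 / 3 : ℚ) • e₁ + (8 : ℚ) • (f₁ ^ 2) + (-1 : ℚ) • f₁ +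
    (-2 / 3 : ℚ) • e₃)) + (56 : ℚ) • (overGf * ((-32 / 35 : ℚ) • (e₁ ^ 3) + (-3168 / 35 : ℚ) • (e₁ ^ 2 * f₁) + (136 / 35 : ℚ) • (e₁ ^ 2) +
    (6336 / 35 : ℚ) • (e₁ * f₁ ^ 2) + (-264 / 35 : ℚ) • (e₁ * f₁) +
    (-96 / 7 : ℚ) • (e₁ * e₃) + (-2 / 21 : ℚ) • e₁ + (-1984 / 35 : ℚ) • (f₁ ^ 3) +
    (-16 / 35 : ℚ) • (f₁ ^ 2) + (80 / 7 : ℚ) • (f₁ * e₃) + (9 / 35 : ℚ) • f₁ +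
    (2 / 21 : ℚ) • e₃) - (4 : ℚ) • qD (overGf * ((-4 : ℚ) • (e₁ ^ 2) + (2 / 3 : ℚ) • e₁ + (8 : ℚ) • (f₁ ^ 2) + (-1 : ℚ) • f₁ +
    (-2 / 3 : ℚ) • e₃))) -
    (16 : ℚ) • (overGf * ((4288 / 7 : ℚ) • (e₁ ^ 4) + (-34816 / 7 : ℚ) • (e₁ ^ 3 * f₁) + (736 / 7 : ℚ) • (e₁ ^ 3) +
    (79104 / 7 : ℚ) • (e₁ ^ 2 * f₁ ^ 2) + (-320 : ℚ) • (e₁ ^ 2 * f₁) +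
    (-2880 / 7 : ℚ) • (e₁ ^ 2 * e₃) + (-34 / 21 : ℚ) • (e₁ ^ 2) +
    (-10240 : ℚ) • (e₁ * f₁ ^ 3) + (2368 / 7 : ℚ) • (e₁ * f₁ ^ 2) +
    (3840 / 7 : ℚ) • (e₁ * f₁ * e₃) + (32 / 21 : ℚ) • (e₁ * f₁) + (80 / 7 : ℚ) • (e₁ * e₃) +
    (1 / 14 : ℚ) • e₁ + (27904 / 7 : ℚ) • (f₁ ^ 4) + (-1664 / 7 : ℚ) • (f₁ ^ 3) +
    (-640 / 7 : ℚ) • (f₁ ^ 2 * e₃) + (52 / 7 : ℚ) • (f₁ ^ 2) + (-320 / 21 : ℚ) • (f₁ * e₃) +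
    (-2 / 7 : ℚ) • f₁ + (-380 / 21 : ℚ) • (e₃ ^ 2) + (-1 / 14 : ℚ) • e₃) - (4 : ℚ) • qD (overGf * ((-32 / 35 : ℚ) • (e₁ ^ 3) + (-3168 / 35 : ℚ) • (e₁ ^ 2 * f₁) + (136 / 35 : ℚ) • (e₁ ^ 2) +
    (6336 / 35 : ℚ) • (e₁ * f₁ ^ 2) + (-264 / 35 : ℚ) • (e₁ * f₁) +
    (-96 / 7 : ℚ) • (e₁ * e₃) + (-2 / 21 : ℚ) • e₁ + (-1984 / 35 : ℚ) • (f₁ ^ 3) +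
    (-16 / 35 : ℚ) • (f₁ ^ 2) + (80 / 7 : ℚ) • (f₁ * e₃) + (9 / 35 : ℚ) • f₁ +
    (2 / 21 : ℚ) • e₃)) + (16 : ℚ) • qD (qD (overGf * ((-4 : ℚ) • (e₁ ^ 2) + (2 / 3 : ℚ) • e₁ + (8 : ℚ) • (f₁ ^ 2) + (-1 : ℚ) • f₁ +
    (-2 / 3 : ℚ) • e₃)))) =
      (15815680 / 70153149 : ℚ) • (overGf * cuspQuot) +
      ((-3743678558672 / 83365325395 : ℚ) • (overGf * crankMom 2) +
      (-141447890442736 / 1750671833295 : ℚ) • (qD (overGf * crankMom 2)) +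
      (-135995781048448 / 1750671833295 : ℚ) • (qD (qD (overGf * crankMom 2))) +
      (9269071448192 / 583557277765 : ℚ) • (qD (qD (qD (overGf * crankMom 2)))) +
      (772193500416 / 16673065079 : ℚ) • (overGf * crankMom 4) +
      (9412063348224 / 116711455553 : ℚ) • (qD (overGf * crankMom 4)) +
      (9106119501824 / 116711455553 : ℚ) • (qD (qD (overGf * crankMom 4))) +
      (-75923065344 / 7578665945 : ℚ) • (overGf * crankMom 6) +
      (-737849634816 / 83365325395 : ℚ) • (qD (overGf * crankMom 6)) +
      (2715648 / 2125853 : ℚ) • (overGf * crankMom 8) +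
      (4640559869932 / 83365325395 : ℚ) • (overGf * expand 2 two_ne_zero (crankMom 2)) +
      (260410320833296 / 1750671833295 : ℚ) • (qD (overGf * expand 2 two_ne_zero (crankMom 2))) +
      (345677277049024 / 1750671833295 : ℚ) • (qD (qD (overGf * expand 2 two_ne_zero (crankMom 2)))) +
      (50935374262656 / 583557277765 : ℚ) • (qD (qD (qD (overGf * expand 2 two_ne_zero (crankMom 2))))) +
      (-1173668372016 / 16673065079 : ℚ) • (overGf * expand 2 two_ne_zero (crankMom 4)) +
      (-2419446071808 / 16673065079 : ℚ) • (qD (overGf * expand 2 two_ne_zero (crankMom 4))) +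
      (-2390306267136 / 16673065079 : ℚ) • (qD (qD (overGf * expand 2 two_ne_zero (crankMom 4)))) +
      (130253841984 / 7578665945 : ℚ) • (overGf * expand 2 two_ne_zero (crankMom 6)) +
      (1671243657216 / 83365325395 : ℚ) • (qD (overGf * expand 2 two_ne_zero (crankMom 6))) +
      (-4858240 / 2125853 : ℚ) • (overGf * expand 2 two_ne_zero (crankMom 8))) := by
  simp only [expand_crankMom_two, expand_crankMom_four, expand_crankMom_six, expand_crankMom_eight]
  simp only [crankMom_two_reduced, crankMom_four_reduced, crankMom_six_reduced, crankMom_eight_reduced]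
  simp only [qD_crank_two_one, qD_crank_two_two, qD_crank_two_three, qD_crank_four_one, qD_crank_four_two, qD_crank_six_one, qD_crankTwo_two_one, qD_crankTwo_two_two, qD_crankTwo_two_three, qD_crankTwo_four_one, qD_crankTwo_four_two, qD_crankTwo_six_one, qD_appell_one_one, qD_appell_one_two, qD_appell_three_one, cuspQuot]
  -- P is distributed over the monomials, whose products with P then serve as atoms of a ℚ-linear
  -- identity.
  simp only [mul_add, mul_smul_comm]
  module

end Assembly

end OverRank

theorem corollary3p3 (n : ℕ) :
    (rankMoment 8 n : ℚ) =
      (-17 - 112 * (n : ℚ) - 224 * (n : ℚ) ^ 2 - 256 * (n : ℚ) ^ 3) * (rankMoment 2 n : ℚ)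
      + (15815680 / 70153149 : ℚ) * (coeffF n : ℚ)
      + (-3743678558672 / 83365325395 + -141447890442736 * (n : ℚ) / 1750671833295
          + -135995781048448 * (n : ℚ) ^ 2 / 1750671833295
          + 9269071448192 * (n : ℚ) ^ 3 / 583557277765) * (firstCrankMoment 2 n : ℚ)
      + (772193500416 / 16673065079 + 9412063348224 * (n : ℚ) / 116711455553
          + 9106119501824 * (n : ℚ) ^ 2 / 116711455553) * (firstCrankMoment 4 n : ℚ)
      + (-75923065344 / 7578665945 + -737849634816 * (n : ℚ) / 83365325395)
          * (firstCrankMoment 6 n : ℚ)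
      + (2715648 / 2125853 : ℚ) * (firstCrankMoment 8 n : ℚ)
      + (4640559869932 / 83365325395 + 260410320833296 * (n : ℚ) / 1750671833295
          + 345677277049024 * (n : ℚ) ^ 2 / 1750671833295
          + 50935374262656 * (n : ℚ) ^ 3 / 583557277765) * (secondCrankMoment 2 n : ℚ)
      + (-1173668372016 / 16673065079 + -2419446071808 * (n : ℚ) / 16673065079
          + -2390306267136 * (n : ℚ) ^ 2 / 16673065079) * (secondCrankMoment 4 n : ℚ)
      + (130253841984 / 7578665945 + 1671243657216 * (n : ℚ) / 83365325395)
          * (secondCrankMoment 6 n : ℚ)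
      + (-4858240 / 2125853 : ℚ) * (secondCrankMoment 8 n : ℚ) := by
  -- On the coefficient of q^n each `qD` is multiplication by n, which produces the polynomial
  -- coefficients in n.
  have h := congrArg (PowerSeries.coeff n) OverRank.rankGf_eight_eq
  rw [OverRank.rank_crank_identity, OverRank.overGf_mul_cuspQuot] at h
  simp only [map_add, map_sub, PowerSeries.coeff_smul, OverRank.coeff_qD, ← OverRank.rankMoment_eq,
    ← OverRank.firstCrankMoment_eq, ← OverRank.secondCrankMoment_eq, ← OverRank.coeffF_eq] at h
  linear_combination h
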